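/- Let $p\neq 2$ be a prime and let $K$ be a finite-dimensional division algebra over $\mathbb{Q}_p$, $n=\dim_{\mathbb{Q}_p}K$ (for instance a field extension of degree $n\le 3$, or the quaternion division algebra if $n=4$), with the absolute value $|\cdot|_K$ that extends the one of $\mathbb{Q}_p$. Let $dx$ be the additive Haar measure on $K$ for which the ring $\{|x|_K\le 1\}$ has measure $1$, let $\chi$ be an additive character of $K$ of rank zero (trivial on $\{|x|_K\le1\}$ and on no larger ball), and put $(Ff)(\xi)=\int_K\chi(\xi x)f(x)\,dx$. Let $h$ be an anisotropic quadratic form on the $\mathbb{Q}_p$-vector space $K$ (such forms exist only for $n\le 4$), let $\alpha\ge n/2$ and $m>0$, and let $A=F^{-1}M_aF$, where $M_a$ is multiplication by $a(\xi)=|h(\xi)|_p^{\alpha}$. Put $$E(x)=\lim_{k\to\infty}\int_{|\xi|_K\le k}\frac{\chi(-\xi x)}{a(\xi)+m^2}\,d\xi ,$$ a finite real number for $x\ne0$, and also for $x=0$ if $\alpha>n/2$, while $E(0)=+\infty$ if $\alpha=n/2$. For a compact open set $\Pi\subset K$ (equivalently, a finite union of disjoint balls) let $\mathcal D(\Pi)$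 be the space of locally constant functions $K\to\mathbb{C}$ with compact support which vanish outside $\Pi$, and let $A_\Pi$ be the closure in $L_2(\Pi)$ of the operator that sends $f\in\mathcal D(\Pi)$ to the restriction of $Af$ to $\Pi$. Then $E$ is the convolution kernel of the resolvent of $A$: on $L_2(K)$, the inverse $(A+m^2)^{-1}$ of the closure of $A+m^2$ on the locally constant functions with compact support is the integral operator with kernel $E(x-y)$. Moreover, for every compact open $\Pi$, the resolvent $(A_\Pi+m^2)^{-1}$ exists as a bounded operator on $L_2(\Pi)$ and is an integral operator with a kernel of the form $$E_\Pi(x,y)=E(x-y)+\Phi(x,y),\qquad x,y\in\Pi,$$ where $\Phi=\Phi_\Pi$ is a real-valued locally constant function on $\Pi\times\Pi$, and $$0\le E_\Pi(x,y)\le E(x-y),\qquad x,y\in\Pi .$$ Finally, $E_\Pi$ is monotone in $\Pi$: if $\Pi_1\subset\Pi_2$ are compact open sets, then $E_{\Pi_1}(x,y)\le E_{\Pi_2}(x,y)$ for all $x,y\in\Pi_1$. (If $\alpha=n/2$, the two displayed inequalities and the monotonicity are claimed for $x\neq y$; both sides are infinite for $x=y$, apart from the bound $0$.) -/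

import Mathlib

open MeasureTheory Filter Topology

namespace PadicElliptic

section

variable {K : Type*} [NormedDivisionRing K]

/-- An additive character of rank zero: trivial on the closed unit ball, and on no strictly
larger ball. -/
def IsRankZero (χ : AddChar K Circle) : Prop :=
  (∀ x : K, ‖x‖ ≤ 1 → χ x = 1) ∧ ∀ c : K, 1 < ‖c‖ → ∃ x : K, ‖x‖ ≤ ‖c‖ ∧ χ x ≠ 1

/-- The symbol `a(ξ) = |h(ξ)|_p ^ α` attached to a quadratic form `h` on `K`, where `K` is seen as
a vector space over the `p`-adic numbers. -/
noncomputable def symbol {p : ℕ} [Fact p.Prime] [NormedAlgebra ℚ_[p] K]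
    (h : QuadraticForm ℚ_[p] K) (α : ℝ) (ξ : K) : ℝ :=
  ‖h ξ‖ ^ α

variable [MeasurableSpace K]

/-- The Fourier transform `(F f)(ξ) = ∫ χ(ξ x) f(x) dx`. -/
noncomputable def fourierK (χ : AddChar K Circle) (μ : Measure K) (f : K → ℂ) (ξ : K) : ℂ :=
  ∫ x, (χ (ξ * x) : ℂ) * f x ∂μ

/-- The inverse Fourier transform `(F⁻¹ g)(x) = ∫ χ(-ξ x) g(ξ) dξ`. -/
noncomputable def fourierInvK (χ : AddChar K Circle) (μ : Measure K) (g : K → ℂ) (x : K) : ℂ :=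
  ∫ ξ, (χ (-(ξ * x)) : ℂ) * g ξ ∂μ

/-- The pseudo-differential operator `A = F⁻¹ M_a F` with symbol `a`. -/
noncomputable def pseudoDiff (χ : AddChar K Circle) (μ : Measure K) (a : K → ℝ) (f : K → ℂ) :
    K → ℂ :=
  fourierInvK χ μ (fun ξ => (a ξ : ℂ) * fourierK χ μ f ξ)

/-- `f` is a test function on `S`: a locally constant function on `K` with compact support
which vanishes outside `S`. -/
def IsTestFunction (S : Set K) (f : K → ℂ) : Prop :=
  IsLocallyConstant f ∧ HasCompactSupport f ∧ Function.support f ⊆ S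

/-- The graph, in `L²(S) × L²(S)`, of the operator `A_S` with domain the test functions on `S`,
which sends `φ` to the restriction of `A φ` to `S`. -/
def restrictedGraph (χ : AddChar K Circle) (μ : Measure K) (a : K → ℝ) (S : Set K) :
    Set (Lp ℂ 2 (μ.restrict S) × Lp ℂ 2 (μ.restrict S)) :=
  {w | ∃ φ : K → ℂ, IsTestFunction S φ ∧ w.1 =ᵐ[μ.restrict S] φ ∧
    w.2 =ᵐ[μ.restrict S] pseudoDiff χ μ a φ}

/-- The bounded operator `R` is the resolvent `(A_S + m²)⁻¹`, where `A_S` now stands for its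
closure: `R f = u` if and only if `u` lies in the domain of `A_S` and `A_S u + m² u = f`. -/
def IsResolvent (χ : AddChar K Circle) (μ : Measure K) (a : K → ℝ) (m : ℝ) (S : Set K)
    (R : Lp ℂ 2 (μ.restrict S) →L[ℂ] Lp ℂ 2 (μ.restrict S)) : Prop :=
  ∀ f u : Lp ℂ 2 (μ.restrict S),
    R f = u ↔ (u, f - ((m : ℂ) ^ 2) • u) ∈ closure (restrictedGraph χ μ a S)

/-- `R` is the integral operator on `L²(S)` with kernel `G`; the integral converges absolutely
for almost all `x`. -/
def IsIntegralOperator (μ : Measure K) (S : Set K)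
    (R : Lp ℂ 2 (μ.restrict S) →L[ℂ] Lp ℂ 2 (μ.restrict S)) (G : K → K → ℝ) : Prop :=
  ∀ f : Lp ℂ 2 (μ.restrict S), ∀ᵐ x ∂(μ.restrict S),
    Integrable (fun y => (G x y : ℂ) * f y) (μ.restrict S) ∧
      R f x = ∫ y, (G x y : ℂ) * f y ∂(μ.restrict S)

/-- The resolvent `(A_S + m²)⁻¹` exists and is the integral operator with kernel `G`. -/
def IsResolventKernel (χ : AddChar K Circle) (μ : Measure K) (a : K → ℝ) (m : ℝ) (S : Set K)
    (G : K → K → ℝ) : Prop :=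
  ∃ R : Lp ℂ 2 (μ.restrict S) →L[ℂ] Lp ℂ 2 (μ.restrict S),
    IsResolvent χ μ a m S R ∧ IsIntegralOperator μ S R G

/-- The Green function `E` of the operator with symbol `a` on the whole of `K`: the inverse
Fourier transform of `1 / (a + m²)`, as the limit of the integrals over balls. (The function
`1 / (a + m²)` need not be integrable. The real part only serves to get a real number: for an even
symbol the integrals are real.) The value at `0` is meaningful only if the limit is finite there. -/
noncomputable def greenFunction (χ : AddChar K Circle) (μ : Measure K) (a : K → ℝ) (m : ℝ)
    (x : K) : ℝ :=
  limUnder atTop (fun k : ℕ =>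
    (∫ ξ in Metric.closedBall (0 : K) (k : ℝ),
      (χ (-(ξ * x)) : ℂ) * (((a ξ + m ^ 2)⁻¹ : ℝ) : ℂ) ∂μ).re)

end

end PadicElliptic

/-! The absolute value of an anisotropic quadratic form over `ℚ_[p]` is ultrametric. If the
Cauchy–Schwarz inequality `‖B(x,y)‖² ≤ ‖h x‖ ‖h y‖` for the polar form failed, Hensel's lemma would
give a zero of `h` on the line `x + t y`; anisotropy then makes `x` a multiple of `y`, for which the
inequality holds (`norm_polar_sq_le`, `norm_map_add_le_max`). Hence the sublevel sets `L_j = {‖h‖ ≤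
p^j}` are compact open subgroups, and with `λ_j = p^(jα)` the symbol is the layered sum `a = ∑_j
(λ_(j+1) - λ_j) 1_{ξ ∉ L_j}`.

The Fourier transform turns multiplication by `1_{L_j}` into averaging over the cosets of the
annihilator `D_j` of `L_j`. So `A = ∑_j (λ_(j+1) - λ_j) (1 - avg_j)` is a hierarchical Laplacian
(`pseudoDiff_symbol`). In the same way `1 / (a + m²) = ∑_j c_j 1_{L_j}` with `c_j ≥ 0`, which gives
`E = ∑_j c_j 1_{D_j} / μ(D_j) ≥ 0` (`greenFunction_eq`). Apart from these identifications,
everything is proved for an abstract chain `D_j` with eigenvalues `λ_j`.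

At a global minimum a function is at most each of its averages, so `A u ≤ 0` there. This maximum
principle (`neg_le_of_lap_ge`) yields uniqueness for the Dirichlet problem on `Π` and all the
inequalities. Existence is linear algebra: `A` preserves `D_J`-invariance, and the `D_J`-invariant
functions vanishing off a compact `Π` form a finite-dimensional space (`exists_lap_eq`).

Let `gam_J(x, ·)` solve the Dirichlet problem whose right-hand side is the normalized indicator of
`x + D_J`, and let `eker_J` be `E` averaged over the cosets of `D_J`. Passing from `J` to `J + 1`
changes `gam_J(x, y)` and `eker_J(x - y)` by the same amount, because the change of `eker_J` is
supported in `x + D_J ⊆ Π` and solves the equation exactly (`gam_succ`). So `Φ = gam_J - eker_J`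
does not depend on a sufficiently large `J`, and it is locally constant. Off the diagonal `E + Φ =
gam_J` for large `J`, and comparison gives `0 ≤ gam_J ≤ eker_J` and monotonicity in `Π`.

For the operators in `L²`, the Schur test bounds the integral operators, the kernel inverts `A + m²`
on test functions, and the range of `A + m²` on test functions is dense (`isResolvent_of_kernel`).
-/

set_option linter.unusedSectionVars false

/-! ### Chains of compact open subgroups, test functions and averages over cosets. -/

namespace PadicElliptic

/-- A decreasing chain of compact open subgroups with union `G` and trivial intersection, together
with an increasing sequence of eigenvalues. -/
structure Hierarchy (G : Type*) [AddCommGroup G] [TopologicalSpace G] where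
  D : ℤ → AddSubgroup G
  antitone_D : Antitone D
  isOpen_D : ∀ j, IsOpen (D j : Set G)
  isCompact_D : ∀ j, IsCompact (D j : Set G)
  exists_mem : ∀ x, ∃ j, x ∈ D j
  exists_subset : ∀ U ∈ 𝓝 (0 : G), ∃ j, (D j : Set G) ⊆ U
  lam : ℤ → ℝ
  lam_mono : Monotone lam
  lam_atBot : Tendsto lam atBot (𝓝 0)
  lam_atTop : Tendsto lam atTop atTop

/-- Locally constant compactly supported functions that vanish outside `S`. -/
def IsTestMap {G F : Type*} [TopologicalSpace G] [Zero F] (S : Set G) (u : G → F) : Prop :=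
  IsLocallyConstant u ∧ HasCompactSupport u ∧ Function.support u ⊆ S

namespace IsTestMap

variable {G F : Type*} [TopologicalSpace G] {S : Set G} {u v : G → F}

lemma mono [Zero F] {T : Set G} (hu : IsTestMap S u) (h : S ⊆ T) : IsTestMap T u :=
  ⟨hu.1, hu.2.1, hu.2.2.trans h⟩

lemma eq_zero [Zero F] (hu : IsTestMap S u) {x : G} (hx : x ∉ S) : u x = 0 := by
  by_contra h
  exact hx (hu.2.2 h)

lemma add [AddGroup F] (hu : IsTestMap S u) (hv : IsTestMap S v) :
    IsTestMap S (fun x => u x + v x) := by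
  refine ⟨hu.1.add hv.1, hu.2.1.add hv.2.1, fun x hx => ?_⟩
  by_contra h
  exact hx (by simp [hu.eq_zero h, hv.eq_zero h])

lemma sub [AddGroup F] (hu : IsTestMap S u) (hv : IsTestMap S v) :
    IsTestMap S (fun x => u x - v x) := by
  refine ⟨hu.1.sub hv.1, hu.2.1.sub hv.2.1, fun x hx => ?_⟩
  by_contra h
  exact hx (by simp [hu.eq_zero h, hv.eq_zero h])

lemma comp_zero {F' : Type*} [Zero F] [Zero F'] (hu : IsTestMap S u) (f : F → F') (hf : f 0 = 0) :
    IsTestMap S (fun x => f (u x)) := by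
  refine ⟨hu.1.comp f, hu.2.1.comp_left hf, fun x hx => ?_⟩
  by_contra h
  exact hx (by simp [hu.eq_zero h, hf])

lemma exists_bound [NormedAddCommGroup F] (hu : IsTestMap S u) : ∃ C, 0 ≤ C ∧ ∀ x, ‖u x‖ ≤ C := by
  obtain ⟨C, hC⟩ := hu.1.continuous.bounded_above_of_compact_support hu.2.1
  exact ⟨max C 0, le_max_right _ _, fun x => (hC x).trans (le_max_left _ _)⟩

end IsTestMap

lemma setIntegral_addSubgroup_add_right {G F : Type*} [AddCommGroup G] [MeasurableSpace G]
    [MeasurableAdd G] {μ : Measure G} [μ.IsAddLeftInvariant] [NormedAddCommGroup F]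
    [NormedSpace ℝ F] {L : AddSubgroup G} (hL : MeasurableSet (L : Set G)) (u : G → F) {d : G}
    (hd : d ∈ L) : ∫ z in (L : Set G), u (z + d) ∂μ = ∫ z in (L : Set G), u z ∂μ := by
  rw [← integral_indicator hL, ← integral_indicator hL,
    ← integral_add_left_eq_self ((L : Set G).indicator u) d]
  congr 1
  ext z
  rw [add_comm d z]
  by_cases hz : z ∈ L
  · rw [Set.indicator_of_mem hz, Set.indicator_of_mem (by exact L.add_mem hz hd)]
  · rw [Set.indicator_of_notMem hz, Set.indicator_of_notMem]
    exact fun h => hz ((L.add_mem_cancel_right hd).1 h)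

namespace Hierarchy

variable {G : Type*} [NormedAddCommGroup G] (H : Hierarchy G)
  {F : Type*} [NormedAddCommGroup F]

/-- Invariance under translations by `D j`. -/
def Inv (j : ℤ) (u : G → F) : Prop := ∀ x, ∀ d ∈ H.D j, u (x + d) = u x

variable {H}

lemma D_mono {i j : ℤ} (h : i ≤ j) : H.D j ≤ H.D i := H.antitone_D h

lemma Inv.mono {i j : ℤ} (h : i ≤ j) {u : G → F} (hu : H.Inv i u) : H.Inv j u :=
  fun x d hd => hu x d (D_mono h hd)

lemma Inv.eq_of_sub_mem {j : ℤ} {u : G → F} (hu : H.Inv j u) {x y : G} (h : x - y ∈ H.D j) :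
    u x = u y := by
  simpa using hu y _ h

lemma coset_mem_nhds (j : ℤ) (x : G) : {y | y - x ∈ H.D j} ∈ 𝓝 x := by
  have : Continuous fun y : G => y - x := by fun_prop
  exact ((H.isOpen_D j).preimage this).mem_nhds (by simp [(H.D j).zero_mem])

lemma Inv.isLocallyConstant {j : ℤ} {u : G → F} (hu : H.Inv j u) : IsLocallyConstant u := by
  rw [IsLocallyConstant.iff_eventually_eq]
  intro x
  filter_upwards [coset_mem_nhds j x] with y hy
  exact hu.eq_of_sub_mem hy

/-- A locally constant function with compact support is invariant under some `D j`. -/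
lemma exists_inv {S : Set G} {u : G → F} (hu : IsTestMap S u) : ∃ J, H.Inv J u := by
  have key : ∃ J, ∀ x ∈ tsupport u, ∀ d ∈ H.D J, u (x + d) = u x := by
    refine IsCompact.induction_on (p := fun s => ∃ J, ∀ x ∈ s, ∀ d ∈ H.D J, u (x + d) = u x)
      hu.2.1 ⟨0, by simp⟩ ?_ ?_ ?_
    · rintro s t hst ⟨J, hJ⟩
      exact ⟨J, fun x hx => hJ x (hst hx)⟩
    · rintro s t ⟨J, hJ⟩ ⟨J', hJ'⟩
      refine ⟨max J J', ?_⟩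
      rintro x (hx | hx) d hd
      · exact hJ x hx d (D_mono (le_max_left _ _) hd)
      · exact hJ' x hx d (D_mono (le_max_right _ _) hd)
    -- Local constancy at `x` gives a coset `x + D J` on which `u` is constant; as `D J` is a group,
    -- this `J` serves every point of the coset.
    · intro x _
      have h1 : {y | u y = u x} ∈ 𝓝 x := (IsLocallyConstant.iff_eventually_eq u).1 hu.1 x
      have h2 : (fun z => x + z) ⁻¹' {y | u y = u x} ∈ 𝓝 (0 : G) := by
        apply ContinuousAt.preimage_mem_nhds
        · fun_prop
        · simpa using h1
      obtain ⟨J, hJ⟩ := H.exists_subset _ h2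
      refine ⟨_, mem_nhdsWithin_of_mem_nhds (coset_mem_nhds (H := H) J x), J, fun y hy d hd => ?_⟩
      have e1 := hJ hy
      have e2 := hJ ((H.D J).add_mem hy hd)
      simp only [Set.mem_preimage, Set.mem_ofPred_eq, add_sub_cancel] at e1 e2
      rw [e1, ← e2]
      congr 1
      abel
  obtain ⟨J, hJ⟩ := key
  refine ⟨J, fun x d hd => ?_⟩
  by_cases hx : x ∈ tsupport u
  · exact hJ x hx d hd
  -- A translation could move a point into the support; translating back by `-d` excludes a change
  -- of value.
  by_cases hy : x + d ∈ tsupport u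
  · simpa using (hJ _ hy (-d) ((H.D J).neg_mem hd)).symm
  · rw [image_eq_zero_of_notMem_tsupport hx, image_eq_zero_of_notMem_tsupport hy]

/-- The indicator of `S` is a test function, so `exists_inv` applies to it: `S` is a union of cosets
of some `D J`. -/
lemma exists_inv_set {S : Set G} (hS : IsCompact S) (hS' : IsOpen S) :
    ∃ J, ∀ x ∈ S, ∀ d ∈ H.D J, x + d ∈ S := by
  have ht : IsTestMap S (S.indicator fun _ => (1 : ℝ)) := by
    refine ⟨?_, ?_, by simp⟩
    · exact (LocallyConstant.charFn ℝ ⟨hS.isClosed, hS'⟩).isLocallyConstant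
    · refine HasCompactSupport.intro hS fun x hx => by simp [hx]
  obtain ⟨J, hJ⟩ := exists_inv (H := H) ht
  refine ⟨J, fun x hx d hd => ?_⟩
  by_contra h
  have := hJ x d hd
  simp [hx, h] at this

variable [NormedSpace ℝ F] [MeasurableSpace G] (H) (μ : Measure G)

/-- The reciprocal of the measure of `D j`. -/
noncomputable def wt (j : ℤ) : ℝ := (μ.real (H.D j))⁻¹

/-- The average of `u` over the coset `x + D j`. -/
noncomputable def avg (j : ℤ) (u : G → F) (x : G) : F :=
  H.wt μ j • ∫ z in (H.D j : Set G), u (x + z) ∂μ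

variable [BorelSpace G] [μ.IsAddHaarMeasure]

lemma measure_D_pos (j : ℤ) : 0 < μ.real (H.D j) := by
  refine ENNReal.toReal_pos ?_ (H.isCompact_D j).measure_ne_top
  exact ((H.isOpen_D j).measure_pos μ ⟨0, (H.D j).zero_mem⟩).ne'

lemma measurableSet_D (j : ℤ) : MeasurableSet (H.D j : Set G) := (H.isOpen_D j).measurableSet

variable {H} {μ}

omit [NormedSpace ℝ F] in
lemma integrableOn_translate {u : G → F} (hu : Continuous u) (x : G) (j : ℤ) :
    IntegrableOn (fun z => u (x + z)) (H.D j) μ :=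
  (by fun_prop : Continuous fun z => u (x + z)).continuousOn.integrableOn_compact (H.isCompact_D j)

variable [CompleteSpace F]

lemma avg_of_const {j : ℤ} {u : G → F} {x : G} {c : F} (h : ∀ d ∈ H.D j, u (x + d) = c) :
    H.avg μ j u x = c := by
  have h1 : ∫ z in (H.D j : Set G), u (x + z) ∂μ = ∫ z in (H.D j : Set G), c ∂μ :=
    setIntegral_congr_fun (H.measurableSet_D j) fun z hz => h z hz
  rw [avg, h1, setIntegral_const, smul_smul, wt, inv_mul_cancel₀ (H.measure_D_pos μ j).ne', one_smul]

lemma avg_of_inv {j : ℤ} {u : G → F} (hu : H.Inv j u) (x : G) : H.avg μ j u x = u x :=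
  avg_of_const (hu x)

lemma avg_add {j : ℤ} {u v : G → F} (hu : Continuous u) (hv : Continuous v) (x : G) :
    H.avg μ j (fun y => u y + v y) x = H.avg μ j u x + H.avg μ j v x := by
  simp only [avg]
  rw [integral_add (integrableOn_translate hu x j) (integrableOn_translate hv x j), smul_add]

lemma avg_sub {j : ℤ} {u v : G → F} (hu : Continuous u) (hv : Continuous v) (x : G) :
    H.avg μ j (fun y => u y - v y) x = H.avg μ j u x - H.avg μ j v x := by
  simp only [avg]
  rw [integral_sub (integrableOn_translate hu x j) (integrableOn_translate hv x j), smul_sub]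

lemma norm_avg_le {j : ℤ} {u : G → F} {C : ℝ} (hC : ∀ x, ‖u x‖ ≤ C) (x : G) :
    ‖H.avg μ j u x‖ ≤ C := by
  have h := H.measure_D_pos μ j
  have h1 : ‖∫ z in (H.D j : Set G), u (x + z) ∂μ‖ ≤ C * μ.real (H.D j) :=
    norm_setIntegral_le_of_norm_le_const (H.isCompact_D j).measure_lt_top fun z _ => hC _
  rw [avg, wt, norm_smul, norm_inv, Real.norm_of_nonneg h.le, inv_mul_le_iff₀ h]
  linarith

lemma setIntegral_D_add_right {j : ℤ} (u : G → F) {d : G} (hd : d ∈ H.D j) :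
    ∫ z in (H.D j : Set G), u (z + d) ∂μ = ∫ z in (H.D j : Set G), u z ∂μ :=
  setIntegral_addSubgroup_add_right (H.measurableSet_D j) u hd

lemma inv_avg_self (j : ℤ) (u : G → F) : H.Inv j (H.avg μ j u) := by
  intro x d hd
  simp only [avg]
  rw [← setIntegral_D_add_right (fun z => u (x + z)) hd]
  simp only [add_assoc, add_comm d]

lemma Inv.avg {k : ℤ} {u : G → F} (hu : H.Inv k u) (j : ℤ) : H.Inv k (H.avg μ j u) := by
  intro x d hd
  simp only [Hierarchy.avg]
  congr 2 with z
  rw [add_right_comm, hu _ _ hd]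

/-- Averaging enlarges the support by at most `D j`, and `hS` says that `S` is a union of cosets of
`D j`. -/
lemma isTestMap_avg {S : Set G} {u : G → F} (hu : IsTestMap S u) {j : ℤ}
    (hS : ∀ x ∈ S, ∀ d ∈ H.D j, x + d ∈ S) : IsTestMap S (H.avg μ j u) := by
  refine ⟨(inv_avg_self j u).isLocallyConstant, ?_, ?_⟩
  · refine HasCompactSupport.intro (hu.2.1.isCompact.add (H.isCompact_D j)) fun x hx => ?_
    refine avg_of_const fun d hd => ?_
    by_contra h
    refine hx ⟨x + d, subset_tsupport _ h, -d, (H.D j).neg_mem hd, by simp⟩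
  · intro x hx
    by_contra h
    refine hx (avg_of_const fun d hd => hu.eq_zero fun h' => h ?_)
    simpa using hS _ h' (-d) ((H.D j).neg_mem hd)

end Hierarchy
end PadicElliptic

/-! ### The hierarchical Laplacian, its symmetry and the maximum principle. -/

namespace PadicElliptic

/-- The increments are nonnegative, so partial sums along `j = i - 1 - k` suffice, and these
telescope. This gives the layer decompositions of the eigenvalues and of the resolvent. -/
lemma hasSum_telescope_lt {f : ℤ → ℝ} (hf : Monotone f) {l : ℝ} (hl : Tendsto f atBot (𝓝 l))
    (i : ℤ) : HasSum (fun j => if j < i then f (j + 1) - f j else 0) (f i - l) := by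
  have hinj : Function.Injective fun k : ℕ => i - 1 - (k : ℤ) := fun a b h => by
    simp only at h; omega
  rw [← hinj.hasSum_iff]
  · rw [hasSum_iff_tendsto_nat_of_nonneg]
    · have h1 : ∀ n : ℕ, ∑ k ∈ Finset.range n, ((fun j => if j < i then f (j + 1) - f j else 0) ∘
          fun k : ℕ => i - 1 - (k : ℤ)) k = f i - f (i - n) := by
        intro n
        induction n with
        | zero => simp
        | succ n ih =>
          rw [Finset.sum_range_succ, ih]
          simp only [Function.comp]
          rw [if_pos (by omega)]
          have e1 : i - 1 - (n : ℤ) + 1 = i - n := by ring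
          have e2 : i - 1 - (n : ℤ) = i - (n + 1 : ℕ) := by push_cast; ring
          rw [e1, e2]
          ring
      simp_rw [h1]
      refine tendsto_const_nhds.sub (hl.comp ?_)
      exact tendsto_atBot_add_const_left _ i (tendsto_neg_atTop_atBot.comp
        tendsto_natCast_atTop_atTop)
    · intro k
      simp only [Function.comp]
      split_ifs
      · exact sub_nonneg.2 (hf (by omega))
      · exact le_rfl
  · intro j hj
    rw [if_neg]
    intro h
    exact hj ⟨(i - 1 - j).toNat, by simp only; omega⟩

lemma hasSum_telescope_ge {f : ℤ → ℝ} (hf : Antitone f) {l : ℝ} (hl : Tendsto f atTop (𝓝 l))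
    (i : ℤ) : HasSum (fun j => if i ≤ j then f j - f (j + 1) else 0) (f i - l) := by
  have h := hasSum_telescope_lt (f := fun j => f (-j)) (fun a b h => hf (by omega))
    (hl.comp tendsto_neg_atBot_atTop) (-i)
  rw [neg_neg] at h
  have hinj : Function.Injective fun j : ℤ => -j - 1 := fun a b h => by
    simp only at h; omega
  rw [← hinj.hasSum_iff] at h
  · refine h.congr_fun ?_
    intro j
    simp only [Function.comp]
    by_cases hij : i ≤ j
    · rw [if_pos hij, if_pos (by omega)]
      congr 2 <;> ring
    · rw [if_neg hij, if_neg (by omega)]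
  · intro j hj
    exact absurd ⟨-j - 1, by simp⟩ hj

namespace Hierarchy

variable {G : Type*} [NormedAddCommGroup G] [ProperSpace G] {H : Hierarchy G}
  {F : Type*} [NormedAddCommGroup F] [NormedSpace ℝ F] [CompleteSpace F]
  [MeasurableSpace G] [BorelSpace G] {μ : Measure G} [μ.IsAddHaarMeasure]

lemma integrable_test {S : Set G} {u : G → F} (hu : IsTestMap S u) : Integrable u μ :=
  hu.1.continuous.integrable_of_hasCompactSupport hu.2.1

lemma tendsto_measure_D [NoncompactSpace G] :
    Tendsto (fun j => μ.real (H.D j)) atBot atTop := by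
  have h1 : Tendsto (fun j => μ (H.D j)) atBot (𝓝 (μ (⋃ j, (H.D j : Set G)))) :=
    tendsto_measure_iUnion_atBot fun i j h => H.antitone_D h
  have h2 : (⋃ j, (H.D j : Set G)) = Set.univ := by
    ext x
    simpa using H.exists_mem x
  rw [h2, measure_univ_of_isAddLeftInvariant] at h1
  rw [tendsto_atTop]
  intro b
  filter_upwards [h1.eventually (lt_mem_nhds (ENNReal.ofReal_lt_top (r := b)))] with j hj
  exact (ENNReal.ofReal_le_iff_le_toReal (H.isCompact_D j).measure_ne_top).1 hj.le

lemma wt_pos (j : ℤ) : 0 < H.wt μ j := inv_pos.2 (H.measure_D_pos μ j)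

lemma wt_mul_measure (j : ℤ) : H.wt μ j * μ.real (H.D j) = 1 :=
  inv_mul_cancel₀ (H.measure_D_pos μ j).ne'

lemma wt_mono : Monotone (H.wt μ) := fun i j h =>
  inv_anti₀ (H.measure_D_pos μ j) (measureReal_mono (D_mono h) (H.isCompact_D i).measure_ne_top)

/-- The measure of `D j` tends to that of the whole group, which is infinite by noncompactness.
Every limit `i → -∞` below rests on this. -/
lemma tendsto_wt [NoncompactSpace G] : Tendsto (H.wt μ) atBot (𝓝 0) :=
  tendsto_inv_atTop_zero.comp tendsto_measure_D

lemma norm_avg_le_integral {u : G → F} (hu : Integrable u μ) (j : ℤ) (x : G) :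
    ‖H.avg μ j u x‖ ≤ H.wt μ j * ∫ y, ‖u y‖ ∂μ := by
  rw [avg, norm_smul, Real.norm_of_nonneg (wt_pos (H := H) (μ := μ) j).le]
  refine mul_le_mul_of_nonneg_left ?_ (wt_pos j).le
  refine (norm_integral_le_integral_norm _).trans ?_
  rw [← integral_add_left_eq_self (fun y => ‖u y‖) x]
  exact setIntegral_le_integral (hu.comp_add_left x).norm
    (Eventually.of_forall fun _ => norm_nonneg _)

lemma integrable_prod_of_bound {f : G → G → F} (hf : Continuous (Function.uncurry f)) {b : G → ℝ}
    (hb : Integrable b μ) (hfb : ∀ x z, ‖f x z‖ ≤ b x) (j : ℤ) :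
    Integrable (Function.uncurry f) (μ.prod (μ.restrict (H.D j))) := by
  have : IsFiniteMeasure (μ.restrict (H.D j : Set G)) :=
    ⟨by simpa using (H.isCompact_D j).measure_lt_top⟩
  have h1 : Integrable (fun p : G × G => b p.1 * (1 : ℝ)) (μ.prod (μ.restrict (H.D j))) :=
    hb.mul_prod (integrable_const (1 : ℝ))
  refine h1.mono' hf.aestronglyMeasurable (Eventually.of_forall fun p => ?_)
  rw [mul_one]
  exact hfb p.1 p.2

lemma setIntegral_D_neg (j : ℤ) (u : G → F) :
    ∫ z in (H.D j : Set G), u (-z) ∂μ = ∫ z in (H.D j : Set G), u z ∂μ := by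
  rw [← integral_indicator (H.measurableSet_D j), ← integral_indicator (H.measurableSet_D j),
    ← integral_neg_eq_self ((H.D j : Set G).indicator u)]
  congr 1
  ext z
  by_cases hz : z ∈ H.D j
  · rw [Set.indicator_of_mem hz, Set.indicator_of_mem (by simpa using hz)]
  · rw [Set.indicator_of_notMem hz, Set.indicator_of_notMem (by simpa using hz)]

/-- Averages are symmetric. -/
lemma integral_smul_avg {S T : Set G} {u : G → ℝ} {v : G → F} (hu : IsTestMap S u)
    (hv : IsTestMap T v) (j : ℤ) :
    ∫ x, u x • H.avg μ j v x ∂μ = ∫ x, H.avg μ j u x • v x ∂μ := by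
  obtain ⟨C, -, hC⟩ := hu.exists_bound
  obtain ⟨C', -, hC'⟩ := hv.exists_bound
  have cu := hu.1.continuous
  have cv := hv.1.continuous
  have i1 : Integrable (Function.uncurry fun x z => u x • v (x + z))
      (μ.prod (μ.restrict (H.D j))) := by
    refine integrable_prod_of_bound (by simp only [Function.uncurry_def]; fun_prop)
      ((integrable_test (μ := μ) hu).norm.mul_const C') (fun x z => ?_) j
    rw [norm_smul]
    exact mul_le_mul_of_nonneg_left (hC' _) (norm_nonneg _)
  have i2 : Integrable (Function.uncurry fun x z => u (x - z) • v x)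
      (μ.prod (μ.restrict (H.D j))) := by
    refine integrable_prod_of_bound (by simp only [Function.uncurry_def]; fun_prop)
      ((integrable_test (μ := μ) hv).norm.const_mul C) (fun x z => ?_) j
    rw [norm_smul]
    exact mul_le_mul_of_nonneg_right (hC _) (norm_nonneg _)
  calc ∫ x, u x • H.avg μ j v x ∂μ
      = ∫ x, H.wt μ j • ∫ z in (H.D j : Set G), u x • v (x + z) ∂μ ∂μ := by
        congr 1; ext x
        rw [integral_smul, smul_comm]; rfl
    _ = H.wt μ j • ∫ z in (H.D j : Set G), ∫ x, u x • v (x + z) ∂μ ∂μ := by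
        rw [integral_smul, integral_integral_swap i1]
    _ = H.wt μ j • ∫ z in (H.D j : Set G), ∫ x, u (x - z) • v x ∂μ ∂μ := by
        congr 2; ext z
        rw [← integral_add_right_eq_self (fun x => u (x - z) • v x) z]
        simp
    _ = ∫ x, H.wt μ j • ∫ z in (H.D j : Set G), u (x - z) • v x ∂μ ∂μ := by
        rw [integral_smul, integral_integral_swap i2]
    _ = ∫ x, H.avg μ j u x • v x ∂μ := by
        congr 1; ext x
        rw [integral_smul_const, smul_smul, ← setIntegral_D_neg]
        simp only [sub_neg_eq_add]; rfl

/-- Translation by an element of `D k ⊆ D j` does not change the integral over `D j`; after Fubini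
the average over `D k` is therefore that of a constant. -/
lemma avg_avg_of_le {S : Set G} {u : G → F} (hu : IsTestMap S u) {j k : ℤ} (h : j ≤ k) (x : G) :
    H.avg μ j (H.avg μ k u) x = H.avg μ j u x := by
  have cu := hu.1.continuous
  have : IsFiniteMeasure (μ.restrict (H.D j : Set G)) :=
    ⟨by simpa using (H.isCompact_D j).measure_lt_top⟩
  have : IsFiniteMeasure (μ.restrict (H.D k : Set G)) :=
    ⟨by simpa using (H.isCompact_D k).measure_lt_top⟩
  obtain ⟨C, -, hC⟩ := hu.exists_bound
  have i1 : Integrable (Function.uncurry fun z t => u (x + z + t))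
      ((μ.restrict (H.D j : Set G)).prod (μ.restrict (H.D k))) := by
    refine (integrable_const C).mono' ?_ (Eventually.of_forall fun p => hC _)
    exact (by simp only [Function.uncurry_def]; fun_prop :
      Continuous (Function.uncurry fun z t => u (x + z + t))).aestronglyMeasurable
  have h1 : ∀ t ∈ (H.D k : Set G), ∫ z in (H.D j : Set G), u (x + z + t) ∂μ =
      ∫ z in (H.D j : Set G), u (x + z) ∂μ := fun t ht => by
    rw [← setIntegral_D_add_right (fun z => u (x + z)) (D_mono h ht)]
    simp only [add_assoc]
  calc H.avg μ j (H.avg μ k u) x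
      = H.wt μ j • H.wt μ k • ∫ z in (H.D j : Set G), ∫ t in (H.D k : Set G),
          u (x + z + t) ∂μ ∂μ := by
        rw [← integral_smul]; rfl
    _ = H.wt μ j • H.wt μ k • ∫ t in (H.D k : Set G), ∫ z in (H.D j : Set G),
          u (x + z + t) ∂μ ∂μ := by
        rw [integral_integral_swap i1]
    _ = H.avg μ j u x := by
        rw [setIntegral_congr_fun (H.measurableSet_D k) h1, setIntegral_const, smul_smul (H.wt μ k),
          wt_mul_measure, one_smul]; rfl

variable (H) (μ) in
/-- The hierarchical Laplacian. -/
noncomputable def lap (u : G → F) (x : G) : F :=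
  ∑' j : ℤ, (H.lam (j + 1) - H.lam j) • (u x - H.avg μ j u x)

lemma dlam_nonneg (j : ℤ) : 0 ≤ H.lam (j + 1) - H.lam j := sub_nonneg.2 (H.lam_mono (by omega))

lemma lam_nonneg (j : ℤ) : 0 ≤ H.lam j :=
  le_of_tendsto H.lam_atBot ((eventually_le_atBot j).mono fun _ h => H.lam_mono h)

lemma hasSum_lam (i : ℤ) :
    HasSum (fun j => if j < i then H.lam (j + 1) - H.lam j else 0) (H.lam i) := by
  simpa using hasSum_telescope_lt H.lam_mono H.lam_atBot i

/-- For `j ≥ J` averaging reproduces `u`, so only `j < J` contributes, and these weights add up to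
`lam J`. -/
lemma norm_lap_term_le {J : ℤ} {u : G → F} (hu : H.Inv J u) {C : ℝ} (hC : ∀ x, ‖u x‖ ≤ C)
    (x : G) (j : ℤ) :
    ‖(H.lam (j + 1) - H.lam j) • (u x - H.avg μ j u x)‖ ≤
      (if j < J then H.lam (j + 1) - H.lam j else 0) * (2 * C) := by
  split_ifs with h
  · rw [norm_smul, Real.norm_of_nonneg (dlam_nonneg j)]
    refine mul_le_mul_of_nonneg_left ((norm_sub_le _ _).trans ?_) (dlam_nonneg j)
    linarith [hC x, norm_avg_le (H := H) (μ := μ) (j := j) hC x]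
  · rw [avg_of_inv (hu.mono (not_lt.1 h))]
    simp

lemma summable_lap {S : Set G} {u : G → F} (hu : IsTestMap S u) (x : G) :
    Summable fun j : ℤ => (H.lam (j + 1) - H.lam j) • (u x - H.avg μ j u x) := by
  obtain ⟨J, hJ⟩ := exists_inv (H := H) hu
  obtain ⟨C, -, hC⟩ := hu.exists_bound
  exact .of_norm_bounded ((hasSum_lam J).summable.mul_right _) (norm_lap_term_le hJ hC x)

lemma norm_lap_le {J : ℤ} {u : G → F} (hu : H.Inv J u) {C : ℝ} (hC : ∀ x, ‖u x‖ ≤ C) (x : G) :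
    ‖H.lap μ u x‖ ≤ H.lam J * (2 * C) :=
  tsum_of_norm_bounded ((hasSum_lam J).mul_right _) (norm_lap_term_le hu hC x)

lemma lap_add {S T : Set G} {u v : G → F} (hu : IsTestMap S u) (hv : IsTestMap T v) (x : G) :
    H.lap μ (fun y => u y + v y) x = H.lap μ u x + H.lap μ v x := by
  simp only [lap]
  rw [← (summable_lap hu x).tsum_add (summable_lap hv x)]
  congr 1; ext j
  rw [avg_add hu.1.continuous hv.1.continuous, ← smul_add]
  congr 1; abel

lemma lap_sub {S T : Set G} {u v : G → F} (hu : IsTestMap S u) (hv : IsTestMap T v) (x : G) :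
    H.lap μ (fun y => u y - v y) x = H.lap μ u x - H.lap μ v x := by
  simp only [lap]
  rw [← (summable_lap hu x).tsum_sub (summable_lap hv x)]
  congr 1; ext j
  rw [avg_sub hu.1.continuous hv.1.continuous, ← smul_sub]
  congr 1; abel

lemma lap_smul (c : ℝ) (u : G → F) (x : G) :
    H.lap μ (fun y => c • u y) x = c • H.lap μ u x := by
  simp only [lap]
  rw [← tsum_const_smul'']
  congr 1; ext j
  have : H.avg μ j (fun y => c • u y) x = c • H.avg μ j u x := by
    simp only [avg]
    rw [integral_smul, smul_comm]
  rw [this, ← smul_sub, smul_comm]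

lemma Inv.lap {J : ℤ} {u : G → F} (hu : H.Inv J u) : H.Inv J (H.lap μ u) := by
  intro x d hd
  simp only [Hierarchy.lap]
  congr 1; ext j
  rw [hu x d hd, (hu.avg j) x d hd]

/-- Differences of consecutive averages are eigenfunctions. -/
lemma lap_avg_sub_avg {S : Set G} {u : G → F} (hu : IsTestMap S u) (k : ℤ) (x : G) :
    H.lap μ (fun y => H.avg μ (k + 1) u y - H.avg μ k u y) x =
      H.lam (k + 1) • (H.avg μ (k + 1) u x - H.avg μ k u x) := by
  have c1 := (inv_avg_self (H := H) (μ := μ) (k + 1) u).isLocallyConstant.continuous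
  have c2 := (inv_avg_self (H := H) (μ := μ) k u).isLocallyConstant.continuous
  rw [lap, ← ((hasSum_lam (k + 1)).smul_const _).tsum_eq]
  congr 1; ext j
  rw [avg_sub c1 c2]
  -- For `j ≤ k` both averages collapse to `avg j u` and cancel; for `j > k` averaging fixes the
  -- function. The surviving weights add up to `lam (k + 1)`.
  split_ifs with h
  · rw [avg_avg_of_le hu (by omega), avg_avg_of_le hu (by omega)]
    simp
  · rw [avg_of_inv ((inv_avg_self (k + 1) u).mono (by omega)),
      avg_of_inv ((inv_avg_self k u).mono (by omega))]
    simp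

lemma integrable_lap_term {S : Set G} {u : G → F} (hu : IsTestMap S u) (j : ℤ) :
    Integrable (H.avg μ j u) μ :=
  integrable_test (isTestMap_avg (hu.mono (Set.subset_univ _)) (j := j) (by simp))

lemma integral_norm_avg_le {S : Set G} {u : G → F} (hu : IsTestMap S u) (j : ℤ) :
    ∫ x, ‖H.avg μ j u x‖ ∂μ ≤ ∫ x, ‖u x‖ ∂μ := by
  have hn : IsTestMap S fun x => ‖u x‖ := hu.comp_zero norm norm_zero
  have h0 : IsTestMap Set.univ (H.avg μ j fun x => ‖u x‖) :=
    isTestMap_avg (hn.mono (Set.subset_univ _)) (by simp)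
  have hle : ∀ x, ‖H.avg μ j u x‖ ≤ H.avg μ j (fun x => ‖u x‖) x := fun x => by
    simp only [avg]
    rw [norm_smul, Real.norm_of_nonneg (wt_pos (H := H) (μ := μ) j).le, smul_eq_mul]
    exact mul_le_mul_of_nonneg_left (norm_integral_le_integral_norm _) (wt_pos j).le
  refine (integral_mono (integrable_lap_term hu j).norm (integrable_test h0) hle).trans ?_
  -- the integral of an average is computed by swapping the integrals
  have i1 : Integrable (Function.uncurry fun z x => ‖u (x + z)‖)
      ((μ.restrict (H.D j : Set G)).prod μ) := by
    have : IsFiniteMeasure (μ.restrict (H.D j : Set G)) :=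
      ⟨by simpa using (H.isCompact_D j).measure_lt_top⟩
    have cu := hu.1.continuous
    rw [integrable_prod_iff (by
      simp only [Function.uncurry_def]
      exact (by fun_prop : Continuous fun p : G × G => ‖u (p.2 + p.1)‖).aestronglyMeasurable)]
    refine ⟨Eventually.of_forall fun z =>
      (integrable_test (μ := μ) hn).comp_add_right z, ?_⟩
    simp only [Function.uncurry_apply_pair, norm_norm]
    have : ∀ z, ∫ x, ‖u (x + z)‖ ∂μ = ∫ x, ‖u x‖ ∂μ := fun z =>
      integral_add_right_eq_self (fun x => ‖u x‖) z
    simp only [this]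
    exact integrable_const _
  simp only [avg]
  rw [integral_smul, ← integral_integral_swap i1]
  have : ∀ z, ∫ x, ‖u (x + z)‖ ∂μ = ∫ x, ‖u x‖ ∂μ := fun z =>
    integral_add_right_eq_self (fun x => ‖u x‖) z
  simp only [this]
  rw [setIntegral_const, smul_smul, wt_mul_measure, one_smul]

/-- Averages contract the `L¹` norm and the weights of the nonzero terms are summable; this
justifies integrating the series term by term. -/
lemma summable_integral_norm_lap {S : Set G} {u : G → F} (hu : IsTestMap S u) :
    Summable fun j : ℤ => ∫ x, ‖(H.lam (j + 1) - H.lam j) • (u x - H.avg μ j u x)‖ ∂μ := by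
  obtain ⟨J, hJ⟩ := exists_inv (H := H) hu
  refine .of_nonneg_of_le (fun j => integral_nonneg fun x => norm_nonneg _) (fun j => ?_)
    ((hasSum_lam (H := H) J).summable.mul_right (2 * ∫ x, ‖u x‖ ∂μ))
  split_ifs with h
  · simp_rw [norm_smul, Real.norm_of_nonneg (dlam_nonneg (H := H) j)]
    rw [integral_const_mul]
    refine mul_le_mul_of_nonneg_left ?_ (dlam_nonneg j)
    have h1 := (integrable_test (μ := μ) hu)
    have h2 := (integrable_lap_term (H := H) (μ := μ) hu j)
    calc ∫ x, ‖u x - H.avg μ j u x‖ ∂μ ≤ ∫ x, (‖u x‖ + ‖H.avg μ j u x‖) ∂μ :=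
          integral_mono (h1.sub h2).norm (h1.norm.add h2.norm) fun x => norm_sub_le _ _
      _ ≤ _ := by
          rw [integral_add h1.norm h2.norm]
          linarith [integral_norm_avg_le (H := H) (μ := μ) hu j]
  · simp [avg_of_inv (hJ.mono (not_lt.1 h))]

lemma integrable_lap_summand {S : Set G} {v : G → F} (hv : IsTestMap S v) (j : ℤ) :
    Integrable (fun x => (H.lam (j + 1) - H.lam j) • (v x - H.avg μ j v x)) μ :=
  ((integrable_test hv).sub (integrable_lap_term hv j)).smul _

lemma integrable_lap {S : Set G} {u : G → F} (hu : IsTestMap S u) : Integrable (H.lap μ u) μ := by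
  obtain ⟨J, hJ⟩ := exists_inv (H := H) hu
  refine ⟨hJ.lap.isLocallyConstant.continuous.aestronglyMeasurable, ?_⟩
  have h1 : ∀ x, ‖H.lap μ u x‖ₑ ≤
      ∑' j : ℤ, ‖(H.lam (j + 1) - H.lam j) • (u x - H.avg μ j u x)‖ₑ := fun x =>
    enorm_tsum_le_tsum_enorm
  have h2 : ∀ j : ℤ, ∫⁻ x, ‖(H.lam (j + 1) - H.lam j) • (u x - H.avg μ j u x)‖ₑ ∂μ =
      ENNReal.ofReal (∫ x, ‖(H.lam (j + 1) - H.lam j) • (u x - H.avg μ j u x)‖ ∂μ) := fun j =>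
    (ofReal_integral_norm_eq_lintegral_enorm (integrable_lap_summand hu j)).symm
  have h3 : ∫⁻ x, ∑' j : ℤ, ‖(H.lam (j + 1) - H.lam j) • (u x - H.avg μ j u x)‖ₑ ∂μ < ⊤ := by
    rw [lintegral_tsum fun j => (integrable_lap_summand hu j).1.enorm, tsum_congr h2]
    exact (summable_integral_norm_lap hu).tsum_ofReal_lt_top
  exact (lintegral_mono h1).trans_lt h3

lemma integrable_smul_of_bound {u : G → ℝ} {w : G → F} (hu : AEStronglyMeasurable u μ) {C : ℝ}
    (hC : ∀ x, ‖u x‖ ≤ C) (hw : Integrable w μ) : Integrable (fun x => u x • w x) μ := by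
  refine (hw.norm.const_mul C).mono' (hu.smul hw.1) (Eventually.of_forall fun x => ?_)
  rw [norm_smul]
  exact mul_le_mul_of_nonneg_right (hC x) (norm_nonneg _)

lemma integrable_smul_of_bound' {u : G → ℝ} {w : G → F} (hw : AEStronglyMeasurable w μ) {C : ℝ}
    (hC : ∀ x, ‖w x‖ ≤ C) (hu : Integrable u μ) : Integrable (fun x => u x • w x) μ := by
  refine (hu.norm.mul_const C).mono' (hu.1.smul hw) (Eventually.of_forall fun x => ?_)
  rw [norm_smul]
  exact mul_le_mul_of_nonneg_left (hC x) (norm_nonneg _)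

lemma hasSum_integral_smul_lap {S T : Set G} {u : G → ℝ} {v : G → F} (hu : IsTestMap S u)
    (hv : IsTestMap T v) :
    HasSum (fun j : ℤ => ∫ x, u x • (H.lam (j + 1) - H.lam j) • (v x - H.avg μ j v x) ∂μ)
      (∫ x, u x • H.lap μ v x ∂μ) := by
  obtain ⟨C, hC0, hC⟩ := hu.exists_bound
  have iu := (integrable_test (μ := μ) hu).1
  have s1 := hasSum_integral_of_summable_integral_norm (μ := μ)
    (F := fun j : ℤ => fun x => u x • (H.lam (j + 1) - H.lam j) • (v x - H.avg μ j v x))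
    (fun j => integrable_smul_of_bound iu hC (integrable_lap_summand hv j)) (by
      refine .of_nonneg_of_le (fun j => integral_nonneg fun x => norm_nonneg _) (fun j => ?_)
        ((summable_integral_norm_lap (H := H) (μ := μ) hv).mul_left C)
      rw [← integral_const_mul]
      refine integral_mono (integrable_smul_of_bound iu hC (integrable_lap_summand hv j)).norm
        ((integrable_lap_summand hv j).norm.const_mul C) fun x => ?_
      simp only [norm_smul (u x)]
      exact mul_le_mul_of_nonneg_right (hC x) (norm_nonneg _))
  have e1 : ∀ x, ∑' j : ℤ, u x • (H.lam (j + 1) - H.lam j) • (v x - H.avg μ j v x) =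
      u x • H.lap μ v x := fun x => by rw [lap, tsum_const_smul'']
  simpa only [e1] using s1

lemma hasSum_integral_lap_smul {S T : Set G} {u : G → ℝ} {v : G → F} (hu : IsTestMap S u)
    (hv : IsTestMap T v) :
    HasSum (fun j : ℤ => ∫ x, ((H.lam (j + 1) - H.lam j) • (u x - H.avg μ j u x)) • v x ∂μ)
      (∫ x, H.lap μ u x • v x ∂μ) := by
  obtain ⟨C, hC0, hC⟩ := hv.exists_bound
  have iv := (integrable_test (μ := μ) hv).1
  have s2 := hasSum_integral_of_summable_integral_norm (μ := μ)
    (F := fun j : ℤ => fun x => ((H.lam (j + 1) - H.lam j) • (u x - H.avg μ j u x)) • v x)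
    (fun j => integrable_smul_of_bound' iv hC (integrable_lap_summand hu j)) (by
      refine .of_nonneg_of_le (fun j => integral_nonneg fun x => norm_nonneg _) (fun j => ?_)
        ((summable_integral_norm_lap (H := H) (μ := μ) hu).mul_right C)
      rw [← integral_mul_const]
      refine integral_mono (integrable_smul_of_bound' iv hC (integrable_lap_summand hu j)).norm
        ((integrable_lap_summand hu j).norm.mul_const C) fun x => ?_
      simp only [norm_smul _ (v x)]
      exact mul_le_mul_of_nonneg_left (hC x) (norm_nonneg _))
  have e2 : ∀ x, ∑' j : ℤ, ((H.lam (j + 1) - H.lam j) • (u x - H.avg μ j u x)) • v x =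
      H.lap μ u x • v x := fun x => by rw [lap, (summable_lap hu x).tsum_smul_const]
  simpa only [e2] using s2

/-- The hierarchical Laplacian is symmetric on test functions. -/
lemma integral_smul_lap {S T : Set G} {u : G → ℝ} {v : G → F} (hu : IsTestMap S u)
    (hv : IsTestMap T v) : ∫ x, u x • H.lap μ v x ∂μ = ∫ x, H.lap μ u x • v x ∂μ := by
  obtain ⟨C, hC0, hC⟩ := hu.exists_bound
  obtain ⟨C', hC0', hC'⟩ := hv.exists_bound
  have iu := (integrable_test (μ := μ) hu)
  have iv := (integrable_test (μ := μ) hv)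
  rw [← (hasSum_integral_smul_lap hu hv).tsum_eq, ← (hasSum_integral_lap_smul hu hv).tsum_eq]
  congr 1; ext j
  have a1 : ∀ x, u x • (H.lam (j + 1) - H.lam j) • (v x - H.avg μ j v x) =
      (H.lam (j + 1) - H.lam j) • (u x • v x - u x • H.avg μ j v x) := fun x => by
    rw [smul_comm, smul_sub (u x)]
  have a2 : ∀ x, ((H.lam (j + 1) - H.lam j) • (u x - H.avg μ j u x)) • v x =
      (H.lam (j + 1) - H.lam j) • (u x • v x - H.avg μ j u x • v x) := fun x => by
    rw [smul_assoc, sub_smul (u x)]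
  simp_rw [a1, a2]
  rw [integral_smul, integral_smul,
    integral_sub (integrable_smul_of_bound iu.1 hC iv)
      (integrable_smul_of_bound iu.1 hC (integrable_lap_term hv j)),
    integral_sub (integrable_smul_of_bound iu.1 hC iv)
      (integrable_smul_of_bound' iv.1 hC' (integrable_lap_term hu j)), integral_smul_avg hu hv]

/-- The maximum principle for `lap + m ^ 2`. -/
lemma neg_le_of_lap_ge {S T : Set G} {u : G → ℝ} (hu : IsTestMap T u) {m c : ℝ} (hm : 0 < m)
    (h1 : ∀ x ∈ S, -(c * m ^ 2) ≤ H.lap μ u x + m ^ 2 * u x)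
    (h2 : ∀ x, x ∉ S → -c ≤ u x) (x : G) : -c ≤ u x := by
  obtain ⟨x₀, hx₀⟩ := hu.1.continuous.exists_forall_le_of_hasCompactSupport hu.2.1
  refine le_trans ?_ (hx₀ x)
  by_contra! h
  have hS : x₀ ∈ S := by
    by_contra hS
    exact absurd (h2 x₀ hS) (not_le.2 h)
  -- At the global minimum `x₀` every average is at least `u x₀`, so each term of the series is
  -- nonpositive.
  have hl : H.lap μ u x₀ ≤ 0 := by
    refine tsum_nonpos fun j => ?_
    refine smul_nonpos_of_nonneg_of_nonpos (dlam_nonneg j) (sub_nonpos.2 ?_)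
    have hp := H.measure_D_pos μ j
    rw [avg, wt, smul_eq_mul, le_inv_mul_iff₀ hp]
    have : ∫ z in (H.D j : Set G), u x₀ ∂μ ≤ ∫ z in (H.D j : Set G), u (x₀ + z) ∂μ :=
      setIntegral_mono_on (integrableOn_const (H.isCompact_D j).measure_ne_top)
        (integrableOn_translate hu.1.continuous x₀ j) (H.measurableSet_D j) fun z _ => hx₀ _
    simpa using this
  have := h1 x₀ hS
  nlinarith [pow_pos hm 2]

end Hierarchy
end PadicElliptic

/-! ### Averaged Green functions and the Dirichlet problem. -/

namespace PadicElliptic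
namespace Hierarchy

variable {G : Type*} [NormedAddCommGroup G] [ProperSpace G] {H : Hierarchy G}
  [MeasurableSpace G] [BorelSpace G] {μ : Measure G} [μ.IsAddHaarMeasure] {m : ℝ}

variable (H m) in
/-- The value of the resolvent on the `j`-th eigenspace. -/
noncomputable def res (j : ℤ) : ℝ := (H.lam j + m ^ 2)⁻¹

variable (H m) in
/-- The coefficients of the resolvent with respect to the averages over the cosets of `D j`. -/
noncomputable def coef (j : ℤ) : ℝ := H.res m j - H.res m (j + 1)

lemma lam_add_pos (hm : 0 < m) (j : ℤ) : 0 < H.lam j + m ^ 2 :=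
  add_pos_of_nonneg_of_pos (lam_nonneg j) (pow_pos hm 2)

lemma res_pos (hm : 0 < m) (j : ℤ) : 0 < H.res m j := inv_pos.2 (lam_add_pos hm j)

lemma res_anti (hm : 0 < m) : Antitone (H.res m) := fun i _ h =>
  inv_anti₀ (lam_add_pos hm i) (add_le_add_left (H.lam_mono h) _)

lemma tendsto_res_atTop : Tendsto (H.res m) atTop (𝓝 0) :=
  tendsto_inv_atTop_zero.comp (tendsto_atTop_add_const_right _ _ H.lam_atTop)

lemma tendsto_res_atBot (hm : 0 < m) : Tendsto (H.res m) atBot (𝓝 (m ^ 2)⁻¹) := by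
  have : Tendsto (fun j => H.lam j + m ^ 2) atBot (𝓝 (0 + m ^ 2)) :=
    H.lam_atBot.add tendsto_const_nhds
  rw [zero_add] at this
  exact this.inv₀ (pow_pos hm 2).ne'

lemma coef_nonneg (hm : 0 < m) (j : ℤ) : 0 ≤ H.coef m j := sub_nonneg.2 (res_anti hm (by omega))

lemma hasSum_coef_lt (hm : 0 < m) (J : ℤ) :
    HasSum (fun j => if j < J then H.coef m j else 0) ((m ^ 2)⁻¹ - H.res m J) := by
  have h := hasSum_telescope_lt (f := fun j => -H.res m j) (fun _ _ h => neg_le_neg (res_anti hm h))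
    (tendsto_res_atBot hm).neg J
  convert h using 1
  · ext j
    simp only [coef]
    congr 1
    ring
  · ring

lemma hasSum_coef_ge (hm : 0 < m) (J : ℤ) :
    HasSum (fun j => if J ≤ j then H.coef m j else 0) (H.res m J) := by
  simpa [coef] using hasSum_telescope_ge (res_anti (H := H) hm) tendsto_res_atTop J

lemma hasSum_coef (hm : 0 < m) : HasSum (H.coef m) (m ^ 2)⁻¹ := by
  have h := (hasSum_coef_lt (H := H) hm 0).add (hasSum_coef_ge (H := H) hm 0)
  rw [sub_add_cancel] at h
  refine h.congr_fun ?_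
  intro j
  by_cases hj : j < 0
  · simp [hj]
  · simp [hj, not_lt.1 hj]

variable (H μ) in
open Classical in
/-- The normalized indicator function of `D j`. -/
noncomputable def bump (j : ℤ) (x : G) : ℝ := if x ∈ H.D j then H.wt μ j else 0

lemma bump_neg (j : ℤ) (x : G) : H.bump μ j (-x) = H.bump μ j x := by
  classical exact if_congr neg_mem_iff rfl rfl

lemma bump_of_mem {j : ℤ} {x : G} (h : x ∈ H.D j) : H.bump μ j x = H.wt μ j := if_pos h

lemma bump_of_notMem {j : ℤ} {x : G} (h : x ∉ H.D j) : H.bump μ j x = 0 := if_neg h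

lemma inv_bump (j : ℤ) : H.Inv j (H.bump μ j) := fun x d hd => by
  classical exact if_congr ((H.D j).add_mem_cancel_right hd) rfl rfl

lemma Inv.comp_sub_left {F : Type*} [NormedAddCommGroup F] {j : ℤ} {u : G → F} (hu : H.Inv j u)
    (x : G) : H.Inv j fun y => u (x - y) := fun y d hd => by
  simp only [sub_add_eq_sub_sub, sub_eq_add_neg _ d]
  exact hu _ _ ((H.D j).neg_mem hd)

lemma isTestMap_of_inv {F : Type*} [NormedAddCommGroup F] {j : ℤ} {u : G → F} (hu : H.Inv j u)
    {S : Set G} (hS : IsCompact S) (h : ∀ x, x ∉ S → u x = 0) : IsTestMap S u := by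
  refine ⟨hu.isLocallyConstant, HasCompactSupport.intro hS h, fun x hx => ?_⟩
  by_contra h'
  exact hx (h x h')

lemma isTestMap_bump (j : ℤ) (x : G) :
    IsTestMap {y | x - y ∈ H.D j} fun y => H.bump μ j (x - y) := by
  refine isTestMap_of_inv ((inv_bump j).comp_sub_left x) ?_ fun y hy => bump_of_notMem hy
  have : {y | x - y ∈ H.D j} = (fun d => x - d) '' (H.D j : Set G) := by
    ext y
    constructor
    · exact fun h => ⟨x - y, h, by simp⟩
    · rintro ⟨d, hd, rfl⟩
      simpa using hd
  rw [this]
  exact (H.isCompact_D j).image (by fun_prop)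

lemma bump_nonneg (j : ℤ) (x : G) : 0 ≤ H.bump μ j x := by
  unfold bump
  split_ifs
  exacts [(wt_pos j).le, le_rfl]

lemma bump_le (j : ℤ) (x : G) : H.bump μ j x ≤ H.wt μ j := by
  unfold bump
  split_ifs
  exacts [le_rfl, (wt_pos j).le]

lemma integral_bump (j : ℤ) : ∫ x, H.bump μ j x ∂μ = 1 := by
  have : H.bump μ j = (H.D j : Set G).indicator fun _ => H.wt μ j := by
    ext x
    by_cases hx : x ∈ H.D j
    · rw [bump_of_mem hx, Set.indicator_of_mem (by exact hx)]
    · rw [bump_of_notMem hx, Set.indicator_of_notMem (by exact hx)]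
  rw [this, integral_indicator (H.measurableSet_D j), setIntegral_const, smul_eq_mul, mul_comm,
    wt_mul_measure]

lemma integrable_bump (j : ℤ) : Integrable (H.bump μ j) μ := by
  have h := (integrable_test (μ := μ) (isTestMap_bump (H := H) (μ := μ) j 0))
  simpa [bump_neg] using h

lemma integral_bump_smul {F : Type*} [NormedAddCommGroup F] [NormedSpace ℝ F] [CompleteSpace F]
    (j : ℤ) (v : G → F) (x : G) : ∫ y, H.bump μ j (x - y) • v y ∂μ = H.avg μ j v x := by
  rw [← integral_add_left_eq_self (fun y => H.bump μ j (x - y) • v y) x, avg, ← integral_smul,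
    ← integral_indicator (H.measurableSet_D j)]
  congr 1; ext z
  have e : x - (x + z) = -z := by abel
  rw [e, bump_neg]
  by_cases hz : z ∈ H.D j
  · rw [bump_of_mem hz, Set.indicator_of_mem (by exact hz)]
  · rw [bump_of_notMem hz, Set.indicator_of_notMem (by exact hz), zero_smul]

lemma avg_bump {j k : ℤ} (h : j ≤ k) (x y : G) :
    H.avg μ j (fun y => H.bump μ k (x - y)) y = H.bump μ j (x - y) := by
  by_cases hxy : x - y ∈ H.D j
  · have h1 : ∀ z, H.bump μ k (x - (y + z)) = H.bump μ k (z + -(x - y)) := fun z => by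
      rw [← bump_neg]; congr 1; abel
    rw [bump_of_mem hxy, avg]
    simp only [h1]
    rw [setIntegral_D_add_right (H.bump μ k) ((H.D j).neg_mem hxy),
      setIntegral_eq_integral_of_forall_compl_eq_zero, integral_bump, smul_eq_mul, mul_one]
    exact fun z hz => bump_of_notMem fun h' => hz (D_mono h h')
  · rw [bump_of_notMem hxy]
    refine avg_of_const fun d hd => bump_of_notMem fun h' => hxy ?_
    have := (H.D j).add_mem (D_mono h h') hd
    simpa [sub_add_eq_sub_sub] using this

lemma lap_bump_sub_bump (k : ℤ) (x y : G) :
    H.lap μ (fun y => H.bump μ (k + 1) (x - y) - H.bump μ k (x - y)) y =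
      H.lam (k + 1) * (H.bump μ (k + 1) (x - y) - H.bump μ k (x - y)) := by
  have h := lap_avg_sub_avg (H := H) (μ := μ) (isTestMap_bump (H := H) (μ := μ) (k + 1) x) k y
  simpa only [avg_bump le_rfl, avg_bump (show k ≤ k + 1 by omega), smul_eq_mul] using h

variable (H μ m) in
/-- The average of the Green function over the cosets of `D J`. -/
noncomputable def eker (J : ℤ) (x : G) : ℝ :=
  -- For `j ≥ J` the bump `j` averages to the bump `J`; the coefficients of these terms telescope to
  -- `res J`.
  ∑' j, (if j < J then H.coef m j else 0) * H.bump μ j x + H.res m J * H.bump μ J x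

lemma eker_term_nonneg (hm : 0 < m) (J : ℤ) (x : G) (j : ℤ) :
    0 ≤ (if j < J then H.coef m j else 0) * H.bump μ j x := by
  refine mul_nonneg ?_ (bump_nonneg j x)
  split_ifs
  exacts [coef_nonneg hm j, le_rfl]

lemma eker_term_le (hm : 0 < m) (J : ℤ) (x : G) (j : ℤ) :
    (if j < J then H.coef m j else 0) * H.bump μ j x ≤
      (if j < J then H.coef m j else 0) * H.wt μ J := by
  split_ifs with h
  · exact mul_le_mul_of_nonneg_left ((bump_le j x).trans (wt_mono h.le)) (coef_nonneg hm j)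
  · simp

lemma summable_eker (hm : 0 < m) (J : ℤ) (x : G) :
    Summable fun j => (if j < J then H.coef m j else 0) * H.bump μ j x :=
  .of_nonneg_of_le (eker_term_nonneg hm J x) (eker_term_le hm J x)
    ((hasSum_coef_lt hm J).summable.mul_right _)

lemma eker_nonneg (hm : 0 < m) (J : ℤ) (x : G) : 0 ≤ H.eker μ m J x :=
  add_nonneg (tsum_nonneg (eker_term_nonneg hm J x)) (mul_nonneg (res_pos hm J).le (bump_nonneg J x))

lemma eker_le (hm : 0 < m) (J : ℤ) (x : G) : H.eker μ m J x ≤ (m ^ 2)⁻¹ * H.wt μ J := by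
  have h1 := hasSum_le (eker_term_le (H := H) (μ := μ) hm J x) (summable_eker hm J x).hasSum
    ((hasSum_coef_lt hm J).mul_right _)
  have h2 := mul_le_mul_of_nonneg_left (bump_le (H := H) (μ := μ) J x) (res_pos (H := H) hm J).le
  simp only [eker]
  linarith

lemma inv_eker (J : ℤ) : H.Inv J (H.eker μ m J) := fun x d hd => by
  simp only [eker]
  rw [inv_bump J x d hd]
  congr 2; ext j
  split_ifs with h
  · rw [(inv_bump j).mono h.le x d hd]
  · simp

lemma eker_succ (hm : 0 < m) (J : ℤ) (x : G) : H.eker μ m (J + 1) x =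
    H.eker μ m J x + H.res m (J + 1) * (H.bump μ (J + 1) x - H.bump μ J x) := by
  have h1 := (summable_eker (H := H) (μ := μ) hm J x).hasSum.add
    (hasSum_ite_eq J (H.coef m J * H.bump μ J x))
  have h2 : ∑' j, (if j < J + 1 then H.coef m j else 0) * H.bump μ j x =
      ∑' j, (if j < J then H.coef m j else 0) * H.bump μ j x + H.coef m J * H.bump μ J x := by
    rw [← h1.tsum_eq]
    congr 1; ext j
    rcases lt_trichotomy j J with h | rfl | h
    · simp [h, h.ne, show j < J + 1 by omega]
    · simp
    · simp [h.not_gt, h.ne', show ¬ j < J + 1 by omega]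
  simp only [eker]
  rw [h2, coef]
  ring

/-- The difference is the sum over `i ≤ k < J` of `res (k + 1) (bump (k + 1) - bump k)`. Each term
is an eigenfunction of `lap` for `lam (k + 1)`, so `lap + m ^ 2` cancels `res (k + 1)` and the bumps
telescope. Differences are used since they are compactly supported, which is not guaranteed for
`eker`. -/
lemma isTestMap_eker_sub {i J : ℤ} (hm : 0 < m) (h : i ≤ J) (x : G) :
    IsTestMap {y | x - y ∈ H.D i} (fun y => H.eker μ m J (x - y) - H.eker μ m i (x - y)) ∧
      ∀ y, H.lap μ (fun y => H.eker μ m J (x - y) - H.eker μ m i (x - y)) y +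
        m ^ 2 * (H.eker μ m J (x - y) - H.eker μ m i (x - y)) =
        H.bump μ J (x - y) - H.bump μ i (x - y) := by
  induction J, h using Int.leInduction with
  | base =>
    simp only [sub_self, mul_zero, add_zero]
    refine ⟨⟨IsLocallyConstant.const 0, HasCompactSupport.zero, by simp⟩, fun y => ?_⟩
    simpa using lap_smul (H := H) (μ := μ) 0 (fun _ : G => (0 : ℝ)) y
  | succ J hJ ih =>
    obtain ⟨h1, h2⟩ := ih
    have e : (fun y => H.eker μ m (J + 1) (x - y) - H.eker μ m i (x - y)) = fun y =>
        (H.eker μ m J (x - y) - H.eker μ m i (x - y)) +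
          H.res m (J + 1) • (H.bump μ (J + 1) (x - y) - H.bump μ J (x - y)) := by
      ext y
      rw [eker_succ hm, smul_eq_mul]
      ring
    have hsub : ∀ {k}, i ≤ k → {y | x - y ∈ H.D k} ⊆ {y | x - y ∈ H.D i} := fun hk y hy =>
      D_mono (H := H) hk (x := x - y) hy
    have hb : IsTestMap {y | x - y ∈ H.D i}
        fun y => H.bump μ (J + 1) (x - y) - H.bump μ J (x - y) :=
      ((isTestMap_bump (J + 1) x).mono (hsub (by omega))).sub ((isTestMap_bump J x).mono (hsub hJ))
    have hb' := hb.comp_zero (fun t : ℝ => H.res m (J + 1) • t) (smul_zero _)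
    refine ⟨by rw [e]; exact h1.add hb', fun y => ?_⟩
    rw [e, lap_add h1 hb', lap_smul, lap_bump_sub_bump, eker_succ hm]
    have h3 := h2 y
    have h4 : H.res m (J + 1) * (H.lam (J + 1) + m ^ 2) = 1 :=
      inv_mul_cancel₀ (lam_add_pos hm _).ne'
    simp only [smul_eq_mul]
    linear_combination h3 + (H.bump μ (J + 1) (x - y) - H.bump μ J (x - y)) * h4

/-! ### Uniqueness and existence for the Dirichlet problem -/

lemma nonneg_of_lap_nonneg {S T : Set G} {u : G → ℝ} (hu : IsTestMap T u) (hm : 0 < m)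
    (h1 : ∀ x ∈ S, 0 ≤ H.lap μ u x + m ^ 2 * u x) (h2 : ∀ x, x ∉ S → 0 ≤ u x) (x : G) :
    0 ≤ u x := by
  simpa using neg_le_of_lap_ge (H := H) (μ := μ) (S := S) (c := 0) hu hm (by simpa using h1)
    (by simpa using h2) x

lemma le_of_lap_le {S T : Set G} {u v : G → ℝ} (hu : IsTestMap T u) (hv : IsTestMap T v)
    (hm : 0 < m)
    (h1 : ∀ x ∈ S, H.lap μ u x + m ^ 2 * u x ≤ H.lap μ v x + m ^ 2 * v x)
    (h2 : ∀ x, x ∉ S → u x ≤ v x) (x : G) : u x ≤ v x := by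
  have := nonneg_of_lap_nonneg (H := H) (μ := μ) (S := S) (hv.sub hu) hm (fun x hx => by
    rw [lap_sub hv hu]
    linarith [h1 x hx]) (fun x hx => sub_nonneg.2 (h2 x hx)) x
  linarith

lemma eq_of_lap_eq {S : Set G} {u v : G → ℝ} (hu : IsTestMap S u) (hv : IsTestMap S v)
    (hm : 0 < m)
    (h1 : ∀ x ∈ S, H.lap μ u x + m ^ 2 * u x = H.lap μ v x + m ^ 2 * v x) : u = v := by
  ext x
  refine le_antisymm (le_of_lap_le hu hv hm (fun x hx => (h1 x hx).le) (fun x hx => ?_) x)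
    (le_of_lap_le hv hu hm (fun x hx => (h1 x hx).ge) (fun x hx => ?_) x)
  all_goals rw [hu.eq_zero hx, hv.eq_zero hx]

lemma inv_indicator {F : Type*} [NormedAddCommGroup F] {J : ℤ} {S : Set G}
    (hS : ∀ x ∈ S, ∀ d ∈ H.D J, x + d ∈ S) {u : G → F} (hu : H.Inv J u) :
    H.Inv J (S.indicator u) := fun x d hd => by
  by_cases hx : x ∈ S
  · rw [Set.indicator_of_mem hx, Set.indicator_of_mem (hS x hx d hd), hu x d hd]
  · rw [Set.indicator_of_notMem hx, Set.indicator_of_notMem]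
    intro h
    have := hS _ h (-d) ((H.D J).neg_mem hd)
    exact hx (by simpa using this)

variable (H) in
/-- The space of `D J`-invariant functions that vanish outside `S`. -/
def invSubmodule (J : ℤ) (S : Set G) : Submodule ℝ (G → ℝ) where
  carrier := {u | H.Inv J u ∧ ∀ x, x ∉ S → u x = 0}
  add_mem' := fun {u v} hu hv => ⟨fun x d hd => by simp [hu.1 x d hd, hv.1 x d hd],
    fun x hx => by simp [hu.2 x hx, hv.2 x hx]⟩
  zero_mem' := ⟨fun x d hd => rfl, fun x hx => rfl⟩
  smul_mem' := fun c u hu => ⟨fun x d hd => by simp [hu.1 x d hd], fun x hx => by simp [hu.2 x hx]⟩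

/-- Finitely many cosets of `D J` cover `S`, and the values at their representatives determine the
function. -/
lemma finiteDimensional_invSubmodule {J : ℤ} {S : Set G} (hS : IsCompact S) :
    FiniteDimensional ℝ (H.invSubmodule J S) := by
  obtain ⟨t, -, ht⟩ := hS.elim_nhds_subcover (fun x => {y | y - x ∈ H.D J})
    fun x _ => coset_mem_nhds J x
  let f : H.invSubmodule J S →ₗ[ℝ] (t → ℝ) :=
    { toFun := fun u i => u.1 i
      map_add' := fun u v => rfl
      map_smul' := fun c u => rfl }
  refine FiniteDimensional.of_injective f ((injective_iff_map_eq_zero f).2 fun u hu => ?_)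
  ext x
  by_cases hx : x ∈ S
  · obtain ⟨i, hi, hxi⟩ := Set.mem_iUnion₂.1 (ht hx)
    rw [u.2.1.eq_of_sub_mem hxi]
    exact congrFun hu ⟨i, hi⟩
  · exact u.2.2 x hx

/-- Solvability of the Dirichlet problem. -/
lemma exists_lap_eq {J : ℤ} {S : Set G} (hS : IsCompact S)
    (hJ : ∀ x ∈ S, ∀ d ∈ H.D J, x + d ∈ S) (hm : 0 < m) {f : G → ℝ} (hf : H.Inv J f) :
    ∃ u, IsTestMap S u ∧ H.Inv J u ∧ ∀ x ∈ S, H.lap μ u x + m ^ 2 * u x = f x := by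
  have ht : ∀ u : H.invSubmodule J S, IsTestMap S u.1 := fun u =>
    isTestMap_of_inv u.2.1 hS u.2.2
  have hmem : ∀ {v : G → ℝ}, H.Inv J v → S.indicator v ∈ H.invSubmodule J S := fun hv =>
    ⟨inv_indicator hJ hv, fun x hx => Set.indicator_of_notMem hx _⟩
  have hinv : ∀ u : H.invSubmodule J S, H.Inv J fun x => H.lap μ u.1 x + m ^ 2 * u.1 x :=
    fun u x d hd => by simp only [u.2.1.lap x d hd, u.2.1 x d hd]
  -- `lap` is nonlocal and does not preserve vanishing off `S`; the indicator cuts its values back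
  -- to `S`.
  let T : H.invSubmodule J S →ₗ[ℝ] H.invSubmodule J S :=
    { toFun := fun u => ⟨S.indicator fun x => H.lap μ u.1 x + m ^ 2 * u.1 x, hmem (hinv u)⟩
      map_add' := fun u v => by
        ext x
        by_cases hx : x ∈ S
        · have := lap_add (H := H) (μ := μ) (ht u) (ht v) x
          simp only [Submodule.coe_add, Pi.add_apply, Set.indicator_of_mem hx]
          rw [show (u.1 + v.1 : G → ℝ) = fun y => u.1 y + v.1 y from rfl, this]
          ring
        · simp [Set.indicator_of_notMem hx]
      map_smul' := fun c u => by
        ext x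
        by_cases hx : x ∈ S
        · have := lap_smul (H := H) (μ := μ) c u.1 x
          simp only [Submodule.coe_smul, Pi.smul_apply, Set.indicator_of_mem hx, RingHom.id_apply]
          rw [show (c • u.1 : G → ℝ) = fun y => c • u.1 y from rfl, this]
          simp only [smul_eq_mul]
          ring
        · simp [Set.indicator_of_notMem hx] }
  have hT : ∀ u : H.invSubmodule J S, ∀ x ∈ S, (T u).1 x = H.lap μ u.1 x + m ^ 2 * u.1 x :=
    fun u x hx => Set.indicator_of_mem hx fun x => H.lap μ u.1 x + m ^ 2 * u.1 x
  have := finiteDimensional_invSubmodule (H := H) (J := J) hS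
  -- The maximum principle gives injectivity; in finite dimension surjectivity follows.
  have hinj : Function.Injective T := fun u v huv => by
    refine Subtype.ext (eq_of_lap_eq (H := H) (μ := μ) (ht u) (ht v) hm fun x hx => ?_)
    rw [← hT u x hx, ← hT v x hx, huv]
  obtain ⟨u, hu⟩ := LinearMap.injective_iff_surjective.1 hinj ⟨_, hmem hf⟩
  refine ⟨u.1, ht u, u.2.1, fun x hx => ?_⟩
  rw [← hT u x hx, hu]
  exact Set.indicator_of_mem hx _

variable (H μ m) in
open Classical in
/-- The solution of the Dirichlet problem on `S` with right-hand side `f`. -/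
noncomputable def dirichlet (S : Set G) (J : ℤ) (f : G → ℝ) : G → ℝ :=
  if h : ∃ u, IsTestMap S u ∧ H.Inv J u ∧ ∀ x ∈ S, H.lap μ u x + m ^ 2 * u x = f x then h.choose
  else 0

variable (H μ m) in
/-- The Green function of `S`, averaged over the cosets of `D J`. -/
noncomputable def gam (S : Set G) (J : ℤ) (x : G) : G → ℝ :=
  H.dirichlet μ m S J fun y => H.bump μ J (x - y)

lemma gam_congr {S : Set G} {J : ℤ} {x x' : G} (h : x - x' ∈ H.D J) :
    H.gam μ m S J x = H.gam μ m S J x' := by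
  unfold gam
  congr 1; ext y
  refine (inv_bump J).eq_of_sub_mem ?_
  simpa using h

section Gam

variable {S : Set G} {J : ℤ} (hS : IsCompact S) (hJ : ∀ x ∈ S, ∀ d ∈ H.D J, x + d ∈ S) (hm : 0 < m)

include hS hJ hm

lemma gam_spec (x : G) : IsTestMap S (H.gam μ m S J x) ∧ H.Inv J (H.gam μ m S J x) ∧
    ∀ y ∈ S, H.lap μ (H.gam μ m S J x) y + m ^ 2 * H.gam μ m S J x y = H.bump μ J (x - y) := by
  have h := exists_lap_eq (H := H) (μ := μ) hS hJ hm
    ((inv_bump (H := H) (μ := μ) J).comp_sub_left x)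
  have e : H.gam μ m S J x = h.choose := dif_pos h
  rw [e]
  exact h.choose_spec

lemma gam_nonneg (x y : G) : 0 ≤ H.gam μ m S J x y := by
  obtain ⟨h1, h2, h3⟩ := gam_spec (μ := μ) hS hJ hm x
  refine nonneg_of_lap_nonneg (H := H) (μ := μ) (S := S) h1 hm (fun y hy => ?_) (fun y hy => ?_) y
  · rw [h3 y hy]
    exact bump_nonneg _ _
  · rw [h1.eq_zero hy]

/-- The comparison of `gam` with `eker J` goes through the test functions `eker J - eker i`, with `i
→ -∞`. The error `wt i / m ^ 2` serves twice: it bounds `eker i` off `S`, and times `m ^ 2` it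
bounds the defect `bump i` of the equation on `S`. -/
lemma gam_le [NoncompactSpace G] (x y : G) : H.gam μ m S J x y ≤ H.eker μ m J (x - y) := by
  obtain ⟨h1, h2, h3⟩ := gam_spec (μ := μ) hS hJ hm x
  have key : ∀ i ≤ J, -((m ^ 2)⁻¹ * H.wt μ i) ≤ H.eker μ m J (x - y) - H.eker μ m i (x - y) -
      H.gam μ m S J x y := fun i hi => by
    obtain ⟨h4, h5⟩ := isTestMap_eker_sub (H := H) (μ := μ) hm hi x
    refine neg_le_of_lap_ge (H := H) (μ := μ) (S := S) ((h4.mono (Set.subset_univ _)).sub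
      (h1.mono (Set.subset_univ _))) hm (fun z hz => ?_) (fun z hz => ?_) y
    · rw [lap_sub h4 h1]
      have e1 := h5 z
      have e2 := h3 z hz
      have e3 := bump_le (H := H) (μ := μ) i (x - z)
      have e4 : (m ^ 2)⁻¹ * H.wt μ i * m ^ 2 = H.wt μ i := by
        field_simp
      rw [e4]
      linarith
    · rw [h1.eq_zero hz]
      linarith [eker_nonneg (H := H) (μ := μ) hm J (x - z), eker_le (H := H) (μ := μ) hm i (x - z)]
  have hl : Tendsto (fun i => -((m ^ 2)⁻¹ * H.wt μ i)) atBot (𝓝 0) := by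
    simpa using (tendsto_wt (H := H) (μ := μ)).const_mul ((m ^ 2)⁻¹) |>.neg
  have := le_of_tendsto hl ((eventually_le_atBot J).mono fun i hi =>
    (key i hi).trans (sub_le_sub_right (sub_le_self _ (eker_nonneg hm i (x - y))) _))
  linarith

lemma gam_mono {T : Set G} (hT : IsCompact T) (hJT : ∀ x ∈ T, ∀ d ∈ H.D J, x + d ∈ T)
    (hST : S ⊆ T) (x y : G) : H.gam μ m S J x y ≤ H.gam μ m T J x y := by
  obtain ⟨h1, h2, h3⟩ := gam_spec (μ := μ) hS hJ hm x
  obtain ⟨h1', h2', h3'⟩ := gam_spec (μ := μ) hT hJT hm x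
  refine le_of_lap_le (H := H) (μ := μ) (S := S) (h1.mono hST) h1' hm (fun z hz => ?_)
    (fun z hz => ?_) y
  · rw [h3 z hz, h3' z (hST hz)]
  · rw [h1.eq_zero hz]
    exact gam_nonneg hT hJT hm x z

/-- Both sides solve the same Dirichlet problem. The increment of `eker` vanishes off `x + D J`,
which lies in `S` because `x ∈ S`; so it is an admissible correction. -/
lemma gam_succ {x : G} (hx : x ∈ S) (y : G) : H.gam μ m S (J + 1) x y =
    H.gam μ m S J x y + (H.eker μ m (J + 1) (x - y) - H.eker μ m J (x - y)) := by
  obtain ⟨h1, h2, h3⟩ := gam_spec (μ := μ) hS hJ hm x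
  obtain ⟨h1', h2', h3'⟩ := gam_spec (μ := μ) hS (J := J + 1)
    (fun x hx d hd => hJ x hx d (D_mono (by omega) hd)) hm x
  obtain ⟨h4, h5⟩ := isTestMap_eker_sub (H := H) (μ := μ) hm (show J ≤ J + 1 by omega) x
  have h4' := h4.mono (T := S) fun z hz => by
    simpa using hJ x hx (-(x - z)) ((H.D J).neg_mem hz)
  refine congrFun (eq_of_lap_eq (H := H) (μ := μ) h1' (h1.add h4') hm fun z hz => ?_) y
  rw [lap_add h1 h4']
  linarith [h3 z hz, h3' z hz, h5 z]

lemma gam_sub_eker {J' : ℤ} (h : J ≤ J') {x : G} (hx : x ∈ S) (y : G) :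
    H.gam μ m S J' x y - H.eker μ m J' (x - y) = H.gam μ m S J x y - H.eker μ m J (x - y) := by
  induction J', h using Int.leInduction with
  | base => rfl
  | succ k hk ih =>
    rw [gam_succ hS (fun x hx d hd => hJ x hx d (D_mono hk hd)) hm hx y, ← ih]
    ring

/-- Symmetry moves `lap` onto `gam`. Off `S`, where `gam` need not satisfy its equation, `φ`
vanishes; on `S` what remains is the average of `φ` over `x + D J`. -/
lemma integral_gam_smul {F : Type*} [NormedAddCommGroup F] [NormedSpace ℝ F] [CompleteSpace F]
    {φ : G → F} (hφ : IsTestMap S φ) (hφJ : H.Inv J φ) (x : G) :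
    ∫ y, H.gam μ m S J x y • (H.lap μ φ y + m ^ 2 • φ y) ∂μ = φ x := by
  obtain ⟨h1, h2, h3⟩ := gam_spec (μ := μ) hS hJ hm x
  obtain ⟨C, -, hC⟩ := h1.exists_bound
  obtain ⟨C', -, hC'⟩ := hφ.exists_bound
  have iu := (integrable_test (μ := μ) h1)
  have iv := (integrable_test (μ := μ) hφ)
  have e1 : ∀ y, H.gam μ m S J x y • (H.lap μ φ y + m ^ 2 • φ y) =
      H.gam μ m S J x y • H.lap μ φ y + m ^ 2 • H.gam μ m S J x y • φ y := fun y => by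
    rw [smul_add, smul_comm (m ^ 2)]
  have e2 : ∀ y, H.lap μ (H.gam μ m S J x) y • φ y + m ^ 2 • H.gam μ m S J x y • φ y =
      H.bump μ J (x - y) • φ y := fun y => by
    by_cases hy : y ∈ S
    · rw [← h3 y hy, add_smul, mul_smul]
    · simp [hφ.eq_zero hy]
  have i3 := (integrable_smul_of_bound iu.1 hC iv).smul (m ^ 2)
  have i4 := integrable_smul_of_bound' (μ := μ) iv.1 hC' (integrable_lap (H := H) h1)
  simp only [Pi.smul_def] at i3
  simp only [e1]
  rw [integral_add (integrable_smul_of_bound iu.1 hC (integrable_lap hφ)) i3,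
    integral_smul_lap h1 hφ, ← integral_add i4 i3]
  simp only [e2]
  rw [integral_bump_smul, avg_of_inv hφJ]

end Gam

end Hierarchy
end PadicElliptic

/-! ### The Green function of the group and its Dirichlet correction. -/

namespace PadicElliptic
namespace Hierarchy

variable {G : Type*} [NormedAddCommGroup G] [ProperSpace G] {H : Hierarchy G}
  [MeasurableSpace G] [BorelSpace G] {μ : Measure G} [μ.IsAddHaarMeasure] {m : ℝ}

lemma measurable_bump (j : ℤ) : Measurable (H.bump μ j) :=
  (inv_bump j).isLocallyConstant.continuous.measurable

lemma measurable_tsum_bump {c : ℤ → ℝ} (hc : ∀ j, 0 ≤ c j) :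
    Measurable fun x => ∑' j, c j * H.bump μ j x := by
  have h : (fun x => ∑' j, c j * H.bump μ j x) =
      fun x => (∑' j, ENNReal.ofReal (c j * H.bump μ j x)).toReal := by
    ext x
    rw [ENNReal.tsum_toReal_eq fun j => ENNReal.ofReal_ne_top]
    congr 1; ext j
    rw [ENNReal.toReal_ofReal (mul_nonneg (hc j) (bump_nonneg j x))]
  rw [h]
  exact (Measurable.tsum fun j =>
    ((measurable_bump j).const_mul (c j)).ennreal_ofReal).ennreal_toReal

lemma integral_norm_mul_bump {c : ℤ → ℝ} (hc : ∀ j, 0 ≤ c j) (j : ℤ) :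
    ∫ x, ‖c j * H.bump μ j x‖ ∂μ = c j := by
  have : ∀ x, ‖c j * H.bump μ j x‖ = c j * H.bump μ j x := fun x =>
    Real.norm_of_nonneg (mul_nonneg (hc j) (bump_nonneg j x))
  simp only [this]
  rw [integral_const_mul, integral_bump, mul_one]

lemma integrable_tsum_bump {c : ℤ → ℝ} (hc : ∀ j, 0 ≤ c j) (hs : Summable c) :
    Integrable (fun x => ∑' j, c j * H.bump μ j x) μ := by
  refine ⟨(measurable_tsum_bump hc).aestronglyMeasurable, ?_⟩
  have h2 : ∀ j : ℤ, ∫⁻ x, ‖c j * H.bump μ j x‖ₑ ∂μ = ENNReal.ofReal (c j) := fun j => by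
    rw [← ofReal_integral_norm_eq_lintegral_enorm ((integrable_bump j).const_mul (c j)),
      integral_norm_mul_bump hc]
  have h3 : ∫⁻ x, ∑' j : ℤ, ‖c j * H.bump μ j x‖ₑ ∂μ < ⊤ := by
    rw [lintegral_tsum fun j => ((integrable_bump j).const_mul (c j)).1.enorm, tsum_congr h2]
    exact hs.tsum_ofReal_lt_top
  exact (lintegral_mono fun x => enorm_tsum_le_tsum_enorm).trans_lt h3

lemma integral_tsum_bump {c : ℤ → ℝ} (hc : ∀ j, 0 ≤ c j) (hs : Summable c) :
    ∫ x, ∑' j, c j * H.bump μ j x ∂μ = ∑' j, c j := by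
  rw [← integral_tsum_of_summable_integral_norm
    (fun j => (integrable_bump j).const_mul (c j)) (by simpa only [integral_norm_mul_bump hc])]
  congr 1; ext j
  rw [integral_const_mul, integral_bump, mul_one]

variable (H μ m) in
/-- The Green function of the whole group. -/
noncomputable def green (x : G) : ℝ := ∑' j, H.coef m j * H.bump μ j x

lemma green_nonneg (hm : 0 < m) (x : G) : 0 ≤ H.green μ m x :=
  tsum_nonneg fun j => mul_nonneg (coef_nonneg hm j) (bump_nonneg j x)

lemma measurable_green (hm : 0 < m) : Measurable (H.green μ m) :=
  measurable_tsum_bump (coef_nonneg hm)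

lemma integrable_green (hm : 0 < m) : Integrable (H.green μ m) μ :=
  integrable_tsum_bump (coef_nonneg hm) (hasSum_coef hm).summable

lemma integral_green (hm : 0 < m) : ∫ x, H.green μ m x ∂μ = (m ^ 2)⁻¹ :=
  (integral_tsum_bump (coef_nonneg hm) (hasSum_coef hm).summable).trans (hasSum_coef hm).tsum_eq

lemma coef_ite_nonneg (hm : 0 < m) (J j : ℤ) : 0 ≤ if j < J then H.coef m j else 0 := by
  split_ifs
  exacts [coef_nonneg hm j, le_rfl]

lemma integrable_eker (hm : 0 < m) (J : ℤ) : Integrable (H.eker μ m J) μ :=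
  (integrable_tsum_bump (coef_ite_nonneg hm J) (hasSum_coef_lt hm J).summable).add
    ((integrable_bump J).const_mul _)

lemma integral_eker (hm : 0 < m) (J : ℤ) : ∫ x, H.eker μ m J x ∂μ = (m ^ 2)⁻¹ := by
  have := integral_add (integrable_tsum_bump (H := H) (μ := μ) (coef_ite_nonneg hm J)
    (hasSum_coef_lt (H := H) hm J).summable) ((integrable_bump (H := H) (μ := μ) J).const_mul (H.res m J))
  simp only [eker]
  rw [this, integral_tsum_bump (coef_ite_nonneg hm J) (hasSum_coef_lt hm J).summable,
    (hasSum_coef_lt hm J).tsum_eq, integral_const_mul, integral_bump]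
  ring

lemma green_eq_eker {J : ℤ} {x : G} (hx : x ∉ H.D J) : H.green μ m x = H.eker μ m J x := by
  rw [green, eker, bump_of_notMem hx, mul_zero, add_zero]
  congr 1; ext j
  split_ifs with h
  · rfl
  · rw [bump_of_notMem fun h' => hx (D_mono (not_lt.1 h) h')]
    simp

/-- At `0` the average replaces each `wt j` with `j ≥ J` by the smaller `wt J`. The summability `hs`
is essential, since `tsum` of a divergent series is `0`. -/
lemma eker_zero_le_green (hm : 0 < m) (hs : Summable fun j => H.coef m j * H.wt μ j) (J : ℤ) :
    H.eker μ m J 0 ≤ H.green μ m 0 := by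
  have e : ∀ j, H.bump μ j 0 = H.wt μ j := fun j => bump_of_mem (H.D j).zero_mem
  have h1 := (summable_eker (H := H) (μ := μ) hm J 0).hasSum.add
    ((hasSum_coef_ge (H := H) hm J).mul_right (H.wt μ J))
  have h2 := hasSum_le (fun j => ?_) h1 (by simpa only [e] using hs.hasSum)
  · simpa only [green, eker, e] using h2
  · rw [e]
    by_cases h : j < J
    · simp [h, not_le.2 h]
    · simp only [h, not_lt.1 h, if_true, if_false, zero_mul, zero_add]
      exact mul_le_mul_of_nonneg_left (wt_mono (not_lt.1 h)) (coef_nonneg hm j)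

variable {F : Type*} [NormedAddCommGroup F] [NormedSpace ℝ F] [CompleteSpace F]

/-- Against `D J`-invariant functions the Green function acts like its average. -/
lemma integral_green_sub_eker (hm : 0 < m) {J : ℤ} {f : G → F} (hf : H.Inv J f) (x : G) :
    ∫ y, (H.green μ m (x - y) - H.eker μ m J (x - y)) • f y ∂μ = 0 := by
  -- The difference lives on `x + D J`, where `f` is constant; and both kernels have total mass `1 /
  -- m ^ 2`.
  have e : ∀ y, (H.green μ m (x - y) - H.eker μ m J (x - y)) • f y =
      (H.green μ m (x - y) - H.eker μ m J (x - y)) • f x := fun y => by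
    by_cases h : x - y ∈ H.D J
    · rw [hf.eq_of_sub_mem h]
    · rw [green_eq_eker h, sub_self, zero_smul, zero_smul]
  simp only [e]
  rw [integral_smul_const, integral_sub_left_eq_self (fun y => H.green μ m y - H.eker μ m J y) μ x,
    integral_sub (integrable_green hm) (integrable_eker hm J), integral_green hm, integral_eker hm,
    sub_self, zero_smul]

lemma integrable_lap_add {S : Set G} {φ : G → F} (hφ : IsTestMap S φ) :
    Integrable (fun y => H.lap μ φ y + m ^ 2 • φ y) μ :=
  (integrable_lap hφ).add ((integrable_test hφ).smul _)

lemma inv_lap_add {J : ℤ} {φ : G → F} (hφ : H.Inv J φ) :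
    H.Inv J fun y => H.lap μ φ y + m ^ 2 • φ y := fun x d hd => by
  simp only [hφ.lap x d hd, hφ x d hd]

lemma measurable_eker (J : ℤ) : Measurable (H.eker μ m J) :=
  (inv_eker J).isLocallyConstant.continuous.measurable

lemma integrable_eker_smul (hm : 0 < m) (J : ℤ) {f : G → F} (hf : Integrable f μ) (x : G) :
    Integrable (fun y => H.eker μ m J (x - y) • f y) μ := by
  refine integrable_smul_of_bound (C := (m ^ 2)⁻¹ * H.wt μ J)
    ((measurable_eker J).comp (by fun_prop)).aestronglyMeasurable (fun y => ?_) hf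
  rw [Real.norm_of_nonneg (eker_nonneg hm J _)]
  exact eker_le hm J _

/-- Symmetry of `lap` is available only for the compactly supported `eker J - eker i`; it yields `φ
x - avg i φ x`. The leftover terms with `eker i` and `avg i` are `O(wt i)` and vanish as `i → -∞`.
-/
lemma integral_eker_smul [NoncompactSpace G] (hm : 0 < m) {S : Set G} {J : ℤ} {φ : G → F}
    (hφ : IsTestMap S φ) (hJ : H.Inv J φ) (x : G) :
    ∫ y, H.eker μ m J (x - y) • (H.lap μ φ y + m ^ 2 • φ y) ∂μ = φ x := by
  set f := fun y => H.lap μ φ y + m ^ 2 • φ y with hf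
  have hfi : Integrable f μ := integrable_lap_add hφ
  have iv := (integrable_test (μ := μ) hφ)
  obtain ⟨C', -, hC'⟩ := hφ.exists_bound
  have key : ∀ i ≤ J, ∫ y, H.eker μ m J (x - y) • f y ∂μ - ∫ y, H.eker μ m i (x - y) • f y ∂μ =
      φ x - H.avg μ i φ x := fun i hi => by
    obtain ⟨h1, h2⟩ := isTestMap_eker_sub (H := H) (μ := μ) hm hi x
    obtain ⟨C, -, hC⟩ := h1.exists_bound
    have iu := (integrable_test (μ := μ) h1)
    have i3 := (integrable_smul_of_bound iu.1 hC iv).smul (m ^ 2)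
    simp only [Pi.smul_def] at i3
    have ib : ∀ j, Integrable (fun y => H.bump μ j (x - y) • φ y) μ := fun j =>
      integrable_smul_of_bound' iv.1 hC' ((integrable_bump j).comp_sub_left x)
    rw [← integral_sub (integrable_eker_smul hm J hfi x) (integrable_eker_smul hm i hfi x)]
    have e1 : ∀ y, H.eker μ m J (x - y) • f y - H.eker μ m i (x - y) • f y =
        (H.eker μ m J (x - y) - H.eker μ m i (x - y)) • H.lap μ φ y +
        m ^ 2 • (H.eker μ m J (x - y) - H.eker μ m i (x - y)) • φ y := fun y => by
      rw [← sub_smul, hf, smul_add, smul_comm (m ^ 2)]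
    simp only [e1]
    rw [integral_add (integrable_smul_of_bound iu.1 hC (integrable_lap hφ)) i3,
      integral_smul_lap h1 hφ,
      ← integral_add (integrable_smul_of_bound' iv.1 hC' (integrable_lap h1)) i3]
    have e2 : ∀ y, H.lap μ (fun y => H.eker μ m J (x - y) - H.eker μ m i (x - y)) y • φ y +
        m ^ 2 • (H.eker μ m J (x - y) - H.eker μ m i (x - y)) • φ y =
        H.bump μ J (x - y) • φ y - H.bump μ i (x - y) • φ y := fun y => by
      rw [← sub_smul, ← h2 y, add_smul, mul_smul]
    simp only [e2]
    rw [integral_sub (ib J) (ib i), integral_bump_smul, integral_bump_smul, avg_of_inv hJ]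
  have bound : ∀ i ≤ J, ‖∫ y, H.eker μ m J (x - y) • f y ∂μ - φ x‖ ≤
      H.wt μ i * ((m ^ 2)⁻¹ * ∫ y, ‖f y‖ ∂μ + ∫ y, ‖φ y‖ ∂μ) := fun i hi => by
    have e : ∫ y, H.eker μ m J (x - y) • f y ∂μ - φ x =
        ∫ y, H.eker μ m i (x - y) • f y ∂μ - H.avg μ i φ x := by
      rw [sub_eq_sub_iff_sub_eq_sub, key i hi]
    rw [e]
    refine (norm_sub_le _ _).trans ?_
    have b1 : ‖∫ y, H.eker μ m i (x - y) • f y ∂μ‖ ≤ (m ^ 2)⁻¹ * H.wt μ i * ∫ y, ‖f y‖ ∂μ := by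
      rw [← integral_const_mul]
      refine norm_integral_le_of_norm_le (hfi.norm.const_mul _) (Eventually.of_forall fun y => ?_)
      rw [norm_smul, Real.norm_of_nonneg (eker_nonneg hm i _)]
      exact mul_le_mul_of_nonneg_right (eker_le hm i _) (norm_nonneg _)
    have b2 := norm_avg_le_integral (H := H) iv i x
    linarith
  have hl := (tendsto_wt (H := H) (μ := μ)).mul_const
    ((m ^ 2)⁻¹ * ∫ y, ‖f y‖ ∂μ + ∫ y, ‖φ y‖ ∂μ)
  rw [zero_mul] at hl
  have := ge_of_tendsto hl ((eventually_le_atBot J).mono bound)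
  exact sub_eq_zero.1 (norm_le_zero_iff.1 this)

lemma integrable_green_smul (hm : 0 < m) {f : G → F} (hf : Continuous f) {C : ℝ}
    (hC : ∀ y, ‖f y‖ ≤ C) (x : G) : Integrable (fun y => H.green μ m (x - y) • f y) μ :=
  integrable_smul_of_bound' hf.aestronglyMeasurable hC ((integrable_green hm).comp_sub_left x)

/-- Convolution with the Green function inverts `lap + m ^ 2`. -/
lemma integral_green_smul [NoncompactSpace G] (hm : 0 < m) {S : Set G} {φ : G → F}
    (hφ : IsTestMap S φ) (x : G) :
    ∫ y, H.green μ m (x - y) • (H.lap μ φ y + m ^ 2 • φ y) ∂μ = φ x := by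
  obtain ⟨J, hJ⟩ := exists_inv (H := H) hφ
  obtain ⟨C, -, hC⟩ := hφ.exists_bound
  have hf := inv_lap_add (μ := μ) (m := m) hJ
  have hb : ∀ y, ‖H.lap μ φ y + m ^ 2 • φ y‖ ≤ H.lam J * (2 * C) + m ^ 2 * C := fun y => by
    refine (norm_add_le _ _).trans (add_le_add (norm_lap_le hJ hC y) ?_)
    rw [norm_smul, Real.norm_of_nonneg (sq_nonneg m)]
    exact mul_le_mul_of_nonneg_left (hC y) (sq_nonneg m)
  have h1 := integral_green_sub_eker (μ := μ) hm hf x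
  simp only [sub_smul] at h1
  rw [integral_sub (integrable_green_smul hm hf.isLocallyConstant.continuous hb x)
    (integrable_eker_smul hm J (integrable_lap_add hφ) x), sub_eq_zero,
    integral_eker_smul hm hφ hJ] at h1
  exact h1

variable (H μ m) in
/-- The correction to the Green function for the Dirichlet problem on `S`. -/
noncomputable def corr (S : Set G) (J : ℤ) (x y : G) : ℝ :=
  H.gam μ m S J x y - H.eker μ m J (x - y)

section Dirichlet

variable {S : Set G} {J : ℤ} (hS : IsCompact S) (hJ : ∀ x ∈ S, ∀ d ∈ H.D J, x + d ∈ S) (hm : 0 < m)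

include hS hJ hm

lemma corr_congr {x x' y y' : G} (hx : x - x' ∈ H.D J) (hy : y - y' ∈ H.D J) :
    H.corr μ m S J x y = H.corr μ m S J x' y' := by
  rw [corr, corr, gam_congr hx, (gam_spec hS hJ hm x').2.1.eq_of_sub_mem hy,
    (inv_eker J).eq_of_sub_mem (show (x - y) - (x' - y') ∈ H.D J from ?_)]
  rw [sub_sub_sub_comm]
  exact (H.D J).sub_mem hx hy

lemma isLocallyConstant_corr : IsLocallyConstant fun z : G × G => H.corr μ m S J z.1 z.2 := by
  rw [IsLocallyConstant.iff_eventually_eq]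
  intro z
  have h1 := continuous_fst.continuousAt.preimage_mem_nhds (coset_mem_nhds (H := H) J z.1)
  have h2 := continuous_snd.continuousAt.preimage_mem_nhds (coset_mem_nhds (H := H) J z.2)
  filter_upwards [h1, h2] with w hw1 hw2
  exact corr_congr hS hJ hm hw1 hw2

/-- The kernel `green + corr` inverts the Dirichlet problem on `S`. -/
lemma integral_green_add_corr [NoncompactSpace G] {φ : G → F} (hφ : IsTestMap S φ) {x : G}
    (hx : x ∈ S) :
    ∫ y in S, (H.green μ m (x - y) + H.corr μ m S J x y) • (H.lap μ φ y + m ^ 2 • φ y) ∂μ =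
      φ x := by
  obtain ⟨J₁, hJ₁⟩ := exists_inv (H := H) hφ
  -- At a scale `k` fine enough for both `S` and `φ` the kernel is `(green - eker k) + gam k`: the
  -- first summand annihilates `D k`-invariant functions, the second inverts the operator.
  set k := max J J₁ with hk
  have hkφ : H.Inv k φ := hJ₁.mono (le_max_right J J₁)
  have hkS : ∀ x ∈ S, ∀ d ∈ H.D k, x + d ∈ S := fun x hx d hd =>
    hJ x hx d (D_mono (le_max_left J J₁) hd)
  have hf := inv_lap_add (μ := μ) (m := m) hkφ
  obtain ⟨h1, -, -⟩ := gam_spec (μ := μ) hS hkS hm x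
  obtain ⟨C, -, hC⟩ := h1.exists_bound
  obtain ⟨C', -, hC'⟩ := hφ.exists_bound
  have hb : ∀ y, ‖H.lap μ φ y + m ^ 2 • φ y‖ ≤ H.lam k * (2 * C') + m ^ 2 * C' := fun y => by
    refine (norm_add_le _ _).trans (add_le_add (norm_lap_le hkφ hC' y) ?_)
    rw [norm_smul, Real.norm_of_nonneg (sq_nonneg m)]
    exact mul_le_mul_of_nonneg_left (hC' y) (sq_nonneg m)
  have e : ∀ y, (H.green μ m (x - y) + H.corr μ m S J x y) • (H.lap μ φ y + m ^ 2 • φ y) =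
      (H.green μ m (x - y) - H.eker μ m k (x - y)) • (H.lap μ φ y + m ^ 2 • φ y) +
      H.gam μ m S k x y • (H.lap μ φ y + m ^ 2 • φ y) := fun y => by
    rw [corr, ← gam_sub_eker hS hJ hm (le_max_left J J₁) hx y, ← add_smul]
    congr 1
    ring
  have i1 := integrable_green_smul (H := H) (μ := μ) hm hf.isLocallyConstant.continuous hb x
  have i2 := integrable_eker_smul (H := H) (μ := μ) hm k (integrable_lap_add (H := H) (m := m) hφ) x
  have i3 : Integrable (fun y => (H.green μ m (x - y) - H.eker μ m k (x - y)) •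
      (H.lap μ φ y + m ^ 2 • φ y)) μ := by
    simp only [sub_smul]
    exact i1.sub i2
  have i4 : Integrable (fun y => H.gam μ m S k x y • (H.lap μ φ y + m ^ 2 • φ y)) μ :=
    integrable_smul_of_bound (integrable_test h1).1 hC (integrable_lap_add hφ)
  rw [setIntegral_eq_integral_of_forall_compl_eq_zero]
  · simp only [e]
    rw [integral_add i3 i4, integral_green_sub_eker hm hf, integral_gam_smul hS hkS hm hφ hkφ,
      zero_add]
  · intro y hy
    -- For `y ∉ S` the point `y` is not in `x + D k ⊆ S`, so `green` and `eker k` agree at `x - y`.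
    rw [e, h1.eq_zero hy, zero_smul, add_zero, green_eq_eker, sub_self, zero_smul]
    intro h
    refine hy ?_
    simpa using hkS x hx (-(x - y)) ((H.D k).neg_mem h)

lemma green_add_corr_le [NoncompactSpace G] (x y : G) :
    H.green μ m (x - y) + H.corr μ m S J x y ≤ H.green μ m (x - y) := by
  have := gam_le (μ := μ) hS hJ hm x y
  rw [corr]
  linarith

/-- Off the diagonal a scale so fine that `x - y` leaves `D k` turns the kernel into `gam k ≥ 0`. On
the diagonal the summability gives `eker J 0 ≤ green 0`, which leaves at least `gam J`. -/
lemma green_add_corr_nonneg {x y : G} (hx : x ∈ S)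
    (h : x ≠ y ∨ Summable fun j => H.coef m j * H.wt μ j) :
    0 ≤ H.green μ m (x - y) + H.corr μ m S J x y := by
  by_cases hxy : x = y
  · have hs := h.resolve_left (not_not.2 hxy)
    rw [corr, hxy, sub_self]
    have := eker_zero_le_green (H := H) (μ := μ) hm hs J
    linarith [gam_nonneg (μ := μ) hS hJ hm y y]
  · obtain ⟨k, hk⟩ := H.exists_subset {x - y}ᶜ
      (isOpen_compl_singleton.mem_nhds (by simpa using (sub_ne_zero.2 hxy).symm))
    have hk' : x - y ∉ H.D (max J k) := fun h' => hk (D_mono (le_max_right J k) h') rfl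
    rw [corr, ← gam_sub_eker hS hJ hm (le_max_left J k) hx y, green_eq_eker hk']
    have := gam_nonneg (μ := μ) hS (J := max J k)
      (fun x hx d hd => hJ x hx d (D_mono (le_max_left J k) hd)) hm x y
    linarith

/-- At the common scale `max J J'` the same `eker` is subtracted on both sides, and `gam_mono`
decides. -/
lemma corr_le_corr {T : Set G} {J' : ℤ} (hT : IsCompact T)
    (hJT : ∀ x ∈ T, ∀ d ∈ H.D J', x + d ∈ T) (hST : S ⊆ T) {x : G} (hx : x ∈ S) (y : G) :
    H.corr μ m S J x y ≤ H.corr μ m T J' x y := by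
  rw [corr, corr, ← gam_sub_eker hS hJ hm (le_max_left J J') hx y,
    ← gam_sub_eker hT hJT hm (le_max_right J J') (hST hx) y]
  exact sub_le_sub_right (gam_mono hS
    (fun x hx d hd => hJ x hx d (D_mono (le_max_left J J') hd)) hm hT
    (fun x hx d hd => hJT x hx d (D_mono (le_max_right J J') hd)) hST x y) _

end Dirichlet

end Hierarchy
end PadicElliptic

/-! ### The Schur test for integral operators on `L²`. -/

namespace PadicElliptic

open scoped ENNReal NNReal

section Schur

variable {X : Type*} [MeasurableSpace X] {ν : Measure X} [SFinite ν] {k : X → X → ℝ}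

/-- Cauchy–Schwarz for the factorization `κ f = κ^(1/2) · (κ^(1/2) f)`. -/
lemma sq_lintegral_mul_le {κ f : X → ℝ≥0∞} (hκ : AEMeasurable κ ν) (hf : AEMeasurable f ν) :
    (∫⁻ y, κ y * f y ∂ν) ^ 2 ≤ (∫⁻ y, κ y ∂ν) * ∫⁻ y, κ y * f y ^ 2 ∂ν := by
  have h := ENNReal.lintegral_mul_le_Lp_mul_Lq ν Real.HolderConjugate.two_two
    (hκ.pow_const (1 / 2 : ℝ)) ((hκ.pow_const (1 / 2 : ℝ)).mul hf)
  have e0 : ∀ t : ℝ≥0∞, t ^ (1 / 2 : ℝ) * t ^ (1 / 2 : ℝ) = t := fun t => by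
    rw [← ENNReal.rpow_add_of_nonneg _ _ (by norm_num) (by norm_num)]
    norm_num
  have e1 : ∀ y, ((fun y => κ y ^ (1 / 2 : ℝ)) * ((fun y => κ y ^ (1 / 2 : ℝ)) * f)) y =
      κ y * f y := fun y => by
    simp only [Pi.mul_apply]
    rw [← mul_assoc, e0]
  have e2 : ∀ y, (κ y ^ (1 / 2 : ℝ)) ^ (2 : ℝ) = κ y := fun y => by
    rw [← ENNReal.rpow_mul]
    norm_num
  have e3 : ∀ y, ((fun y => κ y ^ (1 / 2 : ℝ)) * f) y ^ (2 : ℝ) = κ y * f y ^ 2 := fun y => by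
    simp only [Pi.mul_apply]
    rw [ENNReal.mul_rpow_of_nonneg _ _ (by norm_num), e2]
    norm_num
  simp only [e1, e2, e3] at h
  refine (pow_le_pow_left' h 2).trans_eq ?_
  rw [mul_pow, sq, sq, e0, e0]

/-- The quadratic form of the Schur test. -/
lemma lintegral_sq_lintegral_le (hk : Measurable (Function.uncurry k)) {C : ℝ≥0∞}
    (h1 : ∀ x, ∫⁻ y, ‖k x y‖ₑ ∂ν ≤ C) (h2 : ∀ y, ∫⁻ x, ‖k x y‖ₑ ∂ν ≤ C)
    {f : X → ℂ} (hf : AEStronglyMeasurable f ν) :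
    ∫⁻ x, (∫⁻ y, ‖k x y‖ₑ * ‖f y‖ₑ ∂ν) ^ 2 ∂ν ≤ C ^ 2 * ∫⁻ y, ‖f y‖ₑ ^ 2 ∂ν := by
  have hkx : ∀ x, Measurable fun y => ‖k x y‖ₑ := fun x =>
    (hk.comp (measurable_const.prodMk measurable_id)).enorm
  have hky : ∀ y, Measurable fun x => ‖k x y‖ₑ := fun y =>
    (hk.comp (measurable_id.prodMk measurable_const)).enorm
  calc ∫⁻ x, (∫⁻ y, ‖k x y‖ₑ * ‖f y‖ₑ ∂ν) ^ 2 ∂ν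
      ≤ ∫⁻ x, C * ∫⁻ y, ‖k x y‖ₑ * ‖f y‖ₑ ^ 2 ∂ν ∂ν := lintegral_mono fun x =>
        (sq_lintegral_mul_le (hkx x).aemeasurable hf.enorm).trans (by gcongr; exact h1 x)
    _ = C * ∫⁻ y, ∫⁻ x, ‖k x y‖ₑ * ‖f y‖ₑ ^ 2 ∂ν ∂ν := by
        have hm : AEMeasurable (Function.uncurry fun x y => ‖k x y‖ₑ * ‖f y‖ₑ ^ 2) (ν.prod ν) :=
          hk.enorm.aemeasurable.mul ((hf.comp_snd.enorm).pow_const 2)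
        have hm' : AEMeasurable (fun x => ∫⁻ y, ‖k x y‖ₑ * ‖f y‖ₑ ^ 2 ∂ν) ν :=
          hm.lintegral_prod_right'
        rw [lintegral_const_mul'' _ hm', lintegral_lintegral_swap hm]
    _ ≤ C * ∫⁻ y, C * ‖f y‖ₑ ^ 2 ∂ν := by
        gcongr with y
        rw [lintegral_mul_const _ (hky y)]
        gcongr
        exact h2 y
    _ = C ^ 2 * ∫⁻ y, ‖f y‖ₑ ^ 2 ∂ν := by
        rw [lintegral_const_mul'' _ (hf.enorm.pow_const 2), sq, mul_assoc]

lemma eLpNorm_two_eq {E : Type*} [NormedAddCommGroup E] (f : X → E) :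
    eLpNorm f 2 ν = (∫⁻ y, ‖f y‖ₑ ^ 2 ∂ν) ^ (1 / 2 : ℝ) := by
  rw [eLpNorm_eq_lintegral_rpow_enorm_toReal (by norm_num) (by norm_num)]
  simp

variable (hk : Measurable (Function.uncurry k)) {C : ℝ≥0}
    (h1 : ∀ x, ∫⁻ y, ‖k x y‖ₑ ∂ν ≤ C) (h2 : ∀ y, ∫⁻ x, ‖k x y‖ₑ ∂ν ≤ C)

include hk h1 h2

lemma ae_integrable_kernel_mul {f : X → ℂ} (hf : MemLp f 2 ν) :
    ∀ᵐ x ∂ν, Integrable (fun y => (k x y : ℂ) * f y) ν := by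
  have hlt : ∫⁻ y, ‖f y‖ₑ ^ 2 ∂ν < ⊤ := by
    have := hf.2
    rw [eLpNorm_two_eq] at this
    exact (ENNReal.rpow_lt_top_iff_of_pos (by norm_num)).1 this
  have hm : AEMeasurable (fun x => (∫⁻ y, ‖k x y‖ₑ * ‖f y‖ₑ ∂ν) ^ 2) ν := by
    have : AEMeasurable (Function.uncurry fun x y => ‖k x y‖ₑ * ‖f y‖ₑ) (ν.prod ν) :=
      hk.enorm.aemeasurable.mul hf.1.comp_snd.enorm
    exact this.lintegral_prod_right'.pow_const 2
  have hfin := ae_lt_top' hm ((lintegral_sq_lintegral_le hk h1 h2 hf.1).trans_lt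
    (ENNReal.mul_lt_top (by simp) hlt)).ne
  filter_upwards [hfin] with x hx
  refine ⟨(Complex.measurable_ofReal.comp
    (hk.comp (measurable_const.prodMk measurable_id))).aestronglyMeasurable.mul hf.1, ?_⟩
  have : ∫⁻ y, ‖(k x y : ℂ) * f y‖ₑ ∂ν = ∫⁻ y, ‖k x y‖ₑ * ‖f y‖ₑ ∂ν := by
    congr 1; ext y
    rw [enorm_mul]
    congr 1
    rw [← ofReal_norm, ← ofReal_norm, Complex.norm_real]
  rw [HasFiniteIntegral, this]
  by_contra h
  rw [not_lt_top_iff.1 h] at hx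
  simp at hx

lemma eLpNorm_kernel_integral_le {f : X → ℂ} (hf : MemLp f 2 ν) :
    eLpNorm (fun x => ∫ y, (k x y : ℂ) * f y ∂ν) 2 ν ≤ C * eLpNorm f 2 ν := by
  rw [eLpNorm_two_eq, eLpNorm_two_eq]
  have e : (C : ℝ≥0∞) = ((C : ℝ≥0∞) ^ 2) ^ (1 / 2 : ℝ) := by
    rw [← ENNReal.rpow_natCast, ← ENNReal.rpow_mul]
    norm_num
  rw [e, ← ENNReal.mul_rpow_of_nonneg _ _ (by norm_num)]
  refine ENNReal.rpow_le_rpow ?_ (by norm_num)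
  refine le_trans (lintegral_mono fun x => ?_) (lintegral_sq_lintegral_le hk h1 h2 hf.1)
  refine pow_le_pow_left' ((enorm_integral_le_lintegral_enorm _).trans_eq ?_) 2
  congr 1; ext y
  rw [enorm_mul]
  congr 1
  rw [← ofReal_norm, ← ofReal_norm, Complex.norm_real]

lemma memLp_kernel_integral {f : X → ℂ} (hf : MemLp f 2 ν) :
    MemLp (fun x => ∫ y, (k x y : ℂ) * f y ∂ν) 2 ν := by
  refine ⟨?_, (eLpNorm_kernel_integral_le hk h1 h2 hf).trans_lt
    (ENNReal.mul_lt_top ENNReal.coe_lt_top hf.2)⟩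
  exact AEStronglyMeasurable.integral_prod_right' (f := fun p : X × X => (k p.1 p.2 : ℂ) * f p.2)
    ((Complex.measurable_ofReal.comp hk).aestronglyMeasurable.mul hf.1.comp_snd)

/-- The Schur test. -/
theorem exists_integral_operator : ∃ R : Lp ℂ 2 ν →L[ℂ] Lp ℂ 2 ν,
    ∀ f : Lp ℂ 2 ν, ∀ᵐ x ∂ν, Integrable (fun y => (k x y : ℂ) * f y) ν ∧
      R f x = ∫ y, (k x y : ℂ) * f y ∂ν := by
  have hml := fun f : Lp ℂ 2 ν => memLp_kernel_integral hk h1 h2 (Lp.memLp f)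
  have hin := fun f : Lp ℂ 2 ν => ae_integrable_kernel_mul hk h1 h2 (Lp.memLp f)
  let T : Lp ℂ 2 ν →ₗ[ℂ] Lp ℂ 2 ν :=
    { toFun := fun f => (hml f).toLp
      map_add' := fun f g => by
        refine Lp.ext ?_
        filter_upwards [(hml (f + g)).coeFn_toLp, (hml f).coeFn_toLp, (hml g).coeFn_toLp,
          Lp.coeFn_add (hml f).toLp (hml g).toLp, hin f, hin g] with x e1 e2 e3 e4 i1 i2
        rw [e1, e4, Pi.add_apply, e2, e3, ← integral_add i1 i2]
        refine integral_congr_ae ?_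
        filter_upwards [Lp.coeFn_add f g] with y hy
        rw [hy, Pi.add_apply, mul_add]
      map_smul' := fun c f => by
        refine Lp.ext ?_
        filter_upwards [(hml (c • f)).coeFn_toLp, (hml f).coeFn_toLp,
          Lp.coeFn_smul c (hml f).toLp] with x e1 e2 e4
        rw [RingHom.id_apply, e1, e4, Pi.smul_apply, e2, smul_eq_mul, ← integral_const_mul]
        refine integral_congr_ae ?_
        filter_upwards [Lp.coeFn_smul c f] with y hy
        rw [hy, Pi.smul_apply, smul_eq_mul]
        ring }
  refine ⟨T.mkContinuous C fun f => ?_, fun f => ?_⟩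
  · change ‖(hml f).toLp‖ ≤ C * ‖f‖
    rw [Lp.norm_toLp, Lp.norm_def]
    refine (ENNReal.toReal_mono (ENNReal.mul_ne_top ENNReal.coe_ne_top (Lp.memLp f).2.ne)
      (eLpNorm_kernel_integral_le hk h1 h2 (Lp.memLp f))).trans_eq ?_
    rw [ENNReal.toReal_mul, ENNReal.coe_toReal]
  · filter_upwards [(hml f).coeFn_toLp, hin f] with x e i
    exact ⟨i, e⟩

end Schur

end PadicElliptic

/-! ### Density of test functions and of the range of the operator. -/

namespace PadicElliptic

open scoped ENNReal NNReal Pointwise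
namespace Hierarchy

variable {G : Type*} [NormedAddCommGroup G] [ProperSpace G] {H : Hierarchy G}
  [MeasurableSpace G] [BorelSpace G] {μ : Measure G} [μ.IsAddHaarMeasure] {m : ℝ}
  {F : Type*} [NormedAddCommGroup F] [NormedSpace ℝ F] [CompleteSpace F]

lemma eLpNorm_le_of_compact {Z : Set G} (hZ : IsCompact Z) {h : G → F} {δ : ℝ}
    (h0 : ∀ x, x ∉ Z → h x = 0) (hδ : ∀ x, ‖h x‖ ≤ δ) :
    eLpNorm h 2 μ ≤ μ Z ^ (1 / 2 : ℝ) * ENNReal.ofReal δ := by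
  have e : h = Z.indicator h := by
    ext x
    by_cases hx : x ∈ Z
    · rw [Set.indicator_of_mem hx]
    · rw [Set.indicator_of_notMem hx, h0 x hx]
  rw [e, eLpNorm_indicator_eq_eLpNorm_restrict hZ.measurableSet]
  refine (eLpNorm_le_of_ae_bound (Eventually.of_forall hδ)).trans_eq ?_
  simp

/-- Uniform approximation of continuous compactly supported functions by test functions. -/
lemma exists_testMap_eLpNorm_sub_le {S : Set G} {J : ℤ}
    (hJ : ∀ x ∈ S, ∀ d ∈ H.D J, x + d ∈ S) {g : G → F} (hg : Continuous g)
    (hgc : HasCompactSupport g) (hgS : ∀ x, x ∉ S → g x = 0) {ε : ℝ≥0∞} (hε : ε ≠ 0) :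
    ∃ φ : G → F, IsTestMap S φ ∧ eLpNorm (fun x => g x - φ x) 2 μ ≤ ε := by
  -- `Z` contains the supports of all averages at scales finer than `J`, so `δ` can be chosen before
  -- the scale `k`.
  set Z := tsupport g + (H.D J : Set G) with hZ
  have hZc : IsCompact Z := hgc.isCompact.add (H.isCompact_D J)
  have hZt : μ Z ^ (1 / 2 : ℝ) ≠ ⊤ := ENNReal.rpow_ne_top_of_nonneg (by norm_num) hZc.measure_ne_top
  obtain ⟨δ, hδ, hδε⟩ : ∃ δ : ℝ, 0 < δ ∧ μ Z ^ (1 / 2 : ℝ) * ENNReal.ofReal δ ≤ ε := by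
    have ht : Tendsto (fun δ : ℝ => μ Z ^ (1 / 2 : ℝ) * ENNReal.ofReal δ) (𝓝[>] 0) (𝓝 0) := by
      have h1 : Tendsto (fun δ : ℝ => ENNReal.ofReal δ) (𝓝[>] 0) (𝓝 0) := by
        simpa using (ENNReal.continuous_ofReal.tendsto 0).mono_left nhdsWithin_le_nhds
      simpa using ENNReal.Tendsto.const_mul h1 (Or.inr hZt)
    obtain ⟨δ, h1, h2⟩ := ((ht.eventually (ge_mem_nhds (pos_iff_ne_zero.2 hε))).and
      self_mem_nhdsWithin).exists
    exact ⟨δ, h2, h1⟩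
  have hu := hg.uniformContinuous_of_tendsto_cocompact (hgc.is_zero_at_infty)
  obtain ⟨r, hr, hr'⟩ := Metric.uniformContinuous_iff.1 hu δ hδ
  obtain ⟨k₀, hk₀⟩ := H.exists_subset _ (Metric.ball_mem_nhds (0 : G) hr)
  set k := max J k₀ with hk
  have hkJ : ∀ d ∈ H.D k, d ∈ H.D J := D_mono (le_max_left J k₀)
  have hclose : ∀ x, ∀ d ∈ H.D k, ‖g (x + d) - g x‖ ≤ δ := fun x d hd => by
    rw [← dist_eq_norm]
    refine (hr' ?_).le
    have := hk₀ (D_mono (le_max_right J k₀) hd)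
    simpa using this
  have hgz : ∀ x, x ∉ Z → ∀ d ∈ H.D k, g (x + d) = 0 := fun x hx d hd => by
    by_contra h
    exact hx ⟨x + d, subset_tsupport _ h, -d, (H.D J).neg_mem (hkJ d hd), by simp⟩
  have hφZ : ∀ x, x ∉ Z → H.avg μ k g x = 0 := fun x hx => avg_of_const (hgz x hx)
  refine ⟨H.avg μ k g, ⟨(inv_avg_self k g).isLocallyConstant, HasCompactSupport.intro hZc hφZ, ?_⟩,
    (eLpNorm_le_of_compact hZc (fun x hx => ?_) (fun x => ?_)).trans hδε⟩
  · intro x hx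
    by_contra h
    refine hx (avg_of_const fun d hd => hgS _ fun h' => h ?_)
    simpa using hJ _ h' (-d) ((H.D J).neg_mem (hkJ d hd))
  · rw [hφZ x hx, sub_zero]
    simpa using hgz x hx 0 (H.D k).zero_mem
  · have e : H.avg μ k g x - g x = H.wt μ k • ∫ z in (H.D k : Set G), (g (x + z) - g x) ∂μ := by
      rw [integral_sub (integrableOn_translate hg x k)
        (integrableOn_const (H.isCompact_D k).measure_ne_top), setIntegral_const, smul_sub,
        smul_smul, wt_mul_measure, one_smul, avg]
    rw [norm_sub_rev, e, norm_smul, Real.norm_of_nonneg (wt_pos (H := H) (μ := μ) k).le]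
    have hb : ‖∫ z in (H.D k : Set G), (g (x + z) - g x) ∂μ‖ ≤ δ * μ.real (H.D k) :=
      norm_setIntegral_le_of_norm_le_const (H.isCompact_D k).measure_lt_top fun z hz =>
        hclose x z hz
    calc H.wt μ k * ‖∫ z in (H.D k : Set G), (g (x + z) - g x) ∂μ‖
        ≤ H.wt μ k * (δ * μ.real (H.D k)) := mul_le_mul_of_nonneg_left hb (wt_pos k).le
      _ = δ := by rw [mul_left_comm, wt_mul_measure, mul_one]

/-- Test functions are dense in `L²`. -/
lemma exists_testMap_near {S : Set G} (hSc : IsClosed S) {J : ℤ}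
    (hJ : ∀ x ∈ S, ∀ d ∈ H.D J, x + d ∈ S) {f : G → ℂ} (hf : MemLp f 2 (μ.restrict S))
    {ε : ℝ≥0∞} (hε : ε ≠ 0) :
    ∃ φ : G → ℂ, IsTestMap S φ ∧ eLpNorm (fun x => f x - φ x) 2 (μ.restrict S) ≤ ε := by
  have hSo : IsOpen S := by
    rw [isOpen_iff_mem_nhds]
    intro x hx
    filter_upwards [coset_mem_nhds (H := H) J x] with y hy
    simpa using hJ x hx _ hy
  have hε2 : ε / 2 ≠ 0 := (ENNReal.half_pos hε).ne'
  obtain ⟨g, hgc, hfg, hg, -⟩ := hf.exists_hasCompactSupport_eLpNorm_sub_le (by norm_num) hε2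
  -- `S` is clopen, so its frontier is empty and truncation preserves continuity.
  have hg' : Continuous (S.indicator g) := hg.indicator fun x hx => by
    rw [IsClopen.frontier_eq ⟨hSc, hSo⟩] at hx
    exact hx.elim
  have hgc' : HasCompactSupport (S.indicator g) := hgc.mono fun x hx h => hx (by
    by_cases hxS : x ∈ S
    · rw [Set.indicator_of_mem hxS, h]
    · rw [Set.indicator_of_notMem hxS])
  obtain ⟨φ, hφ, hgφ⟩ := exists_testMap_eLpNorm_sub_le (μ := μ) hJ hg' hgc'
    (fun x hx => Set.indicator_of_notMem hx _) hε2
  refine ⟨φ, hφ, ?_⟩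
  have e : eLpNorm (fun x => f x - φ x) 2 (μ.restrict S) =
      eLpNorm ((f - g) + fun x => S.indicator g x - φ x) 2 (μ.restrict S) := by
    refine eLpNorm_congr_ae ?_
    filter_upwards [ae_restrict_mem hSo.measurableSet] with x hx
    simp [Set.indicator_of_mem hx]
  rw [e, ← ENNReal.add_halves ε]
  refine (eLpNorm_add_le (hf.1.sub hg.aestronglyMeasurable)
    (hg'.sub hφ.1.continuous).aestronglyMeasurable (by norm_num)).trans (add_le_add hfg ?_)
  exact (eLpNorm_mono_measure _ Measure.restrict_le_self).trans hgφ

/-- Interpolation: `‖avg‖₂² ≤ ‖avg‖_∞ ‖avg‖₁ ≤ wt i ‖φ‖₁²`. -/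
lemma tendsto_eLpNorm_avg [NoncompactSpace G] {S : Set G} {φ : G → F} (hφ : IsTestMap S φ) :
    Tendsto (fun i => eLpNorm (H.avg μ i φ) 2 μ) atBot (𝓝 0) := by
  set N := ∫ x, ‖φ x‖ ∂μ with hN
  have hN0 : 0 ≤ N := integral_nonneg fun x => norm_nonneg _
  have hb : ∀ i, eLpNorm (H.avg μ i φ) 2 μ ≤ (ENNReal.ofReal (H.wt μ i * N * N)) ^ (1 / 2 : ℝ) := by
    intro i
    rw [eLpNorm_two_eq]
    refine ENNReal.rpow_le_rpow ?_ (by norm_num)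
    have h0 : 0 ≤ H.wt μ i * N := mul_nonneg (wt_pos i).le hN0
    calc ∫⁻ x, ‖H.avg μ i φ x‖ₑ ^ 2 ∂μ
        ≤ ∫⁻ x, ENNReal.ofReal (H.wt μ i * N) * ‖H.avg μ i φ x‖ₑ ∂μ := lintegral_mono fun x => by
          rw [sq]
          gcongr
          rw [← ofReal_norm]
          exact ENNReal.ofReal_le_ofReal (norm_avg_le_integral (integrable_test hφ) i x)
      _ = ENNReal.ofReal (H.wt μ i * N) * ENNReal.ofReal (∫ x, ‖H.avg μ i φ x‖ ∂μ) := by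
          rw [lintegral_const_mul' _ _ ENNReal.ofReal_ne_top,
            ofReal_integral_norm_eq_lintegral_enorm (integrable_lap_term hφ i)]
      _ ≤ ENNReal.ofReal (H.wt μ i * N * N) := by
          rw [← ENNReal.ofReal_mul h0]
          exact ENNReal.ofReal_le_ofReal (mul_le_mul_of_nonneg_left (integral_norm_avg_le hφ i) h0)
  refine tendsto_of_tendsto_of_tendsto_of_le_of_le tendsto_const_nhds ?_ (fun _ => zero_le) hb
  have h1 : Tendsto (fun i => H.wt μ i * N * N) atBot (𝓝 0) := by
    simpa using ((tendsto_wt (H := H) (μ := μ)).mul_const N).mul_const N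
  have h2 := (ENNReal.continuous_ofReal.tendsto 0).comp h1
  rw [ENNReal.ofReal_zero] at h2
  have h3 := (ENNReal.continuous_rpow_const (y := 1 / 2)).tendsto 0 |>.comp h2
  rw [ENNReal.zero_rpow_of_pos (by norm_num)] at h3
  exact h3

/-- Solution of the equation on the whole group for differences of averages. -/
lemma exists_lap_eq_avg_sub (hm : 0 < m) {φ : G → F} (hφ : IsTestMap Set.univ φ) {i J : ℤ}
    (h : i ≤ J) : ∃ ψ : G → F, IsTestMap Set.univ ψ ∧
      ∀ x, H.lap μ ψ x + m ^ 2 • ψ x = H.avg μ J φ x - H.avg μ i φ x := by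
  induction J, h using Int.leInduction with
  | base =>
    refine ⟨fun _ => 0, ⟨IsLocallyConstant.const 0, HasCompactSupport.zero, by simp⟩, fun x => ?_⟩
    have := lap_smul (H := H) (μ := μ) 0 (fun _ : G => (0 : F)) x
    simp only [zero_smul] at this
    rw [this, smul_zero, add_zero, sub_self]
  | succ J hJ ih =>
    obtain ⟨ψ, hψ, h1⟩ := ih
    have ha : ∀ j, IsTestMap Set.univ (H.avg μ j φ) := fun j => isTestMap_avg hφ (by simp)
    have hd := (ha (J + 1)).sub (ha J)
    -- The new difference of averages is an eigenfunction, so the equation for it is solved by the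
    -- multiple `res (J + 1)`.
    have hb := hd.comp_zero (fun t : F => H.res m (J + 1) • t) (smul_zero _)
    refine ⟨_, hψ.add hb, fun x => ?_⟩
    have h4 : H.res m (J + 1) * H.lam (J + 1) + m ^ 2 * H.res m (J + 1) = 1 := by
      rw [mul_comm (m ^ 2), ← mul_add]
      exact inv_mul_cancel₀ (lam_add_pos hm _).ne'
    rw [lap_add hψ hb, lap_smul, lap_avg_sub_avg hφ, smul_add, add_add_add_comm, h1, smul_smul,
      smul_smul, ← add_smul, h4, one_smul]
    abel

/-- The equation is solvable for a dense set of right-hand sides. -/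
lemma exists_lap_eq_near_univ [NoncompactSpace G] (hm : 0 < m) {φ : G → F}
    (hφ : IsTestMap Set.univ φ) {ε : ℝ≥0∞} (hε : ε ≠ 0) :
    ∃ ψ ρ : G → F, IsTestMap Set.univ ψ ∧ IsTestMap Set.univ ρ ∧
      (∀ x, H.lap μ ψ x + m ^ 2 • ψ x = ρ x) ∧ eLpNorm (fun x => φ x - ρ x) 2 μ ≤ ε := by
  obtain ⟨J, hJ⟩ := exists_inv (H := H) hφ
  -- The equation is solved exactly for `φ - avg i φ`, and a coarse average is small in `L²`.
  obtain ⟨i, hi, hiJ⟩ := (((tendsto_eLpNorm_avg (H := H) (μ := μ) hφ).eventually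
    (ge_mem_nhds (pos_iff_ne_zero.2 hε))).and (eventually_le_atBot J)).exists
  obtain ⟨ψ, hψ, h⟩ := exists_lap_eq_avg_sub (H := H) (μ := μ) hm hφ hiJ
  refine ⟨ψ, _, hψ, hφ.sub (isTestMap_avg (H := H) (μ := μ) hφ (j := i) (by simp)), fun x => ?_, ?_⟩
  · rw [h, avg_of_inv hJ]
  · simpa using hi

lemma lap_clm {F' : Type*} [NormedAddCommGroup F'] [NormedSpace ℝ F'] [CompleteSpace F']
    (L : F →L[ℝ] F') {S : Set G} {u : G → F} (hu : IsTestMap S u) (x : G) :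
    H.lap μ (fun y => L (u y)) x = L (H.lap μ u x) := by
  simp only [lap]
  rw [L.map_tsum (summable_lap hu x)]
  congr 1; ext j
  have : H.avg μ j (fun y => L (u y)) x = L (H.avg μ j u x) := by
    simp only [avg]
    rw [L.integral_comp_comm (integrableOn_translate hu.1.continuous x j), map_smul]
  rw [this, map_smul, map_sub]

/-- Solvability of the complex Dirichlet problem. -/
lemma exists_lap_eq_complex {S : Set G} {J : ℤ} (hS : IsCompact S)
    (hJ : ∀ x ∈ S, ∀ d ∈ H.D J, x + d ∈ S) (hm : 0 < m) {φ : G → ℂ} (hφ : IsTestMap S φ) :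
    ∃ ψ : G → ℂ, IsTestMap S ψ ∧ ∀ x ∈ S, H.lap μ ψ x + m ^ 2 • ψ x = φ x := by
  obtain ⟨J₁, hJ₁⟩ := exists_inv (H := H) hφ
  have hkS : ∀ x ∈ S, ∀ d ∈ H.D (max J J₁), x + d ∈ S := fun x hx d hd =>
    hJ x hx d (D_mono (le_max_left J J₁) hd)
  have hkφ : H.Inv (max J J₁) φ := hJ₁.mono (le_max_right J J₁)
  obtain ⟨u, hu, -, hu'⟩ := exists_lap_eq (H := H) (μ := μ) hS hkS hm (f := fun x => (φ x).re)
    fun x d hd => by simp only [hkφ x d hd]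
  obtain ⟨v, hv, -, hv'⟩ := exists_lap_eq (H := H) (μ := μ) hS hkS hm (f := fun x => (φ x).im)
    fun x d hd => by simp only [hkφ x d hd]
  have tu := hu.comp_zero Complex.ofRealCLM (map_zero _)
  have tv := hv.comp_zero (Complex.I • Complex.ofRealCLM) (map_zero _)
  refine ⟨_, tu.add tv, fun x hx => ?_⟩
  rw [lap_add tu tv, lap_clm Complex.ofRealCLM hu, lap_clm (Complex.I • Complex.ofRealCLM) hv,
    ← Complex.re_add_im (φ x), ← hu' x hx, ← hv' x hx]
  simp
  ring

end Hierarchy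
end PadicElliptic

/-! ### From kernels to resolvents, and the abstract theorem. -/

namespace PadicElliptic

open scoped ENNReal NNReal

variable {K : Type*} [NormedDivisionRing K] [ProperSpace K] {H : Hierarchy K}
  [MeasurableSpace K] [BorelSpace K] {μ : Measure K} [μ.IsAddHaarMeasure] {m : ℝ}
  {χ : AddChar K Circle} {a : K → ℝ}

/-- An integral operator is the resolvent if its kernel inverts `lap + m ^ 2` on test functions
and the equation is solvable for sufficiently many right-hand sides. -/
lemma isResolvent_of_kernel (hA : ∀ φ : K → ℂ, IsTestMap Set.univ φ → pseudoDiff χ μ a φ = H.lap μ φ)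
    {S : Set K} (hS : IsClosed S) {J : ℤ} (hJ : ∀ x ∈ S, ∀ d ∈ H.D J, x + d ∈ S) {k : K → K → ℝ}
    {R : Lp ℂ 2 (μ.restrict S) →L[ℂ] Lp ℂ 2 (μ.restrict S)} (hR : IsIntegralOperator μ S R k)
    (hinv : ∀ φ : K → ℂ, IsTestMap S φ → ∀ x ∈ S,
      ∫ y in S, k x y • (H.lap μ φ y + m ^ 2 • φ y) ∂μ = φ x)
    (hd : ∀ φ : K → ℂ, IsTestMap S φ → ∀ ε : ℝ≥0∞, ε ≠ 0 → ∃ ψ ρ : K → ℂ, IsTestMap S ψ ∧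
      IsTestMap S ρ ∧ (∀ x ∈ S, H.lap μ ψ x + m ^ 2 • ψ x = ρ x) ∧
      eLpNorm (fun x => φ x - ρ x) 2 (μ.restrict S) ≤ ε) :
    IsResolvent χ μ a m S R := by
  -- `R` is a left inverse of `A_S + m ^ 2` on test functions; being a closed condition, this passes
  -- to the closure of the graph.
  have hgraph : ∀ w ∈ restrictedGraph χ μ a S, R (w.2 + ((m : ℂ) ^ 2) • w.1) = w.1 := by
    rintro w ⟨φ, hφ, h1, h2⟩
    have hφ' : IsTestMap S φ := hφ
    rw [hA φ (hφ'.mono (Set.subset_univ _))] at h2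
    refine Lp.ext ?_
    filter_upwards [hR (w.2 + ((m : ℂ) ^ 2) • w.1), ae_restrict_mem hS.measurableSet, h1]
      with x hx hxS e1
    rw [hx.2, e1, ← hinv φ hφ' x hxS]
    refine integral_congr_ae ?_
    filter_upwards [Lp.coeFn_add w.2 (((m : ℂ) ^ 2) • w.1), Lp.coeFn_smul ((m : ℂ) ^ 2) w.1, h1, h2]
      with y f1 f2 f3 f4
    rw [f1, Pi.add_apply, f2, Pi.smul_apply, f3, f4, Complex.real_smul, Complex.real_smul,
      smul_eq_mul]
    push_cast
    ring
  have hclosed : IsClosed {w : Lp ℂ 2 (μ.restrict S) × Lp ℂ 2 (μ.restrict S) |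
      R (w.2 + ((m : ℂ) ^ 2) • w.1) = w.1} := isClosed_eq (by fun_prop) (by fun_prop)
  -- The range of `A_S + m ^ 2` on test functions is dense; by continuity of `R`, every pair `(R f,
  -- f - m ^ 2 R f)` is then in the closed graph.
  have hdense : ∀ f : Lp ℂ 2 (μ.restrict S), f ∈ closure
      ((fun w : Lp ℂ 2 (μ.restrict S) × Lp ℂ 2 (μ.restrict S) => w.2 + ((m : ℂ) ^ 2) • w.1) ''
        restrictedGraph χ μ a S) := by
    intro f
    rw [EMetric.mem_closure_iff]
    intro ε hε
    obtain ⟨δ, hδ0, hδ⟩ := exists_between hε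
    have hδ2 : δ / 2 ≠ 0 := (ENNReal.half_pos hδ0.ne').ne'
    obtain ⟨φ, hφ, hfφ⟩ := Hierarchy.exists_testMap_near hS hJ (Lp.memLp f) hδ2
    obtain ⟨ψ, ρ, hψ, hρ, hψρ, hφρ⟩ := hd φ hφ _ hδ2
    have hml : ∀ {v : K → ℂ}, IsTestMap S v → MemLp v 2 (μ.restrict S) := fun hv =>
      (hv.1.continuous.memLp_of_hasCompactSupport hv.2.1).restrict S
    have hw : MemLp (fun x => ρ x - m ^ 2 • ψ x) 2 (μ.restrict S) :=
      (hml hρ).sub ((hml hψ).const_smul (m ^ 2))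
    refine ⟨_, ⟨((hml hψ).toLp, hw.toLp), ⟨ψ, hψ, (hml hψ).coeFn_toLp, ?_⟩, rfl⟩, ?_⟩
    · rw [hA ψ (hψ.mono (Set.subset_univ _))]
      filter_upwards [hw.coeFn_toLp, ae_restrict_mem hS.measurableSet] with x hx hxS
      rw [hx, ← hψρ x hxS, add_sub_cancel_right]
    · refine lt_of_le_of_lt ?_ hδ
      rw [Lp.edist_def]
      have e : eLpNorm (⇑f - ⇑(hw.toLp + ((m : ℂ) ^ 2) • (hml hψ).toLp)) 2 (μ.restrict S) =
          eLpNorm ((fun x => f x - φ x) + fun x => φ x - ρ x) 2 (μ.restrict S) := by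
        refine eLpNorm_congr_ae ?_
        filter_upwards [Lp.coeFn_add hw.toLp (((m : ℂ) ^ 2) • (hml hψ).toLp),
          Lp.coeFn_smul ((m : ℂ) ^ 2) (hml hψ).toLp, hw.coeFn_toLp, (hml hψ).coeFn_toLp]
          with x e1 e2 e3 e4
        simp only [Pi.sub_apply, Pi.add_apply]
        rw [e1, Pi.add_apply, e2, Pi.smul_apply, e3, e4, Complex.real_smul, smul_eq_mul]
        push_cast
        ring
      rw [e, ← ENNReal.add_halves δ]
      exact (eLpNorm_add_le ((Lp.memLp f).1.sub (hml hφ).1) ((hml hφ).1.sub (hml hρ).1)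
        (by norm_num)).trans (add_le_add hfφ hφρ)
  intro f u
  constructor
  · rintro rfl
    have hc : Continuous fun g : Lp ℂ 2 (μ.restrict S) => (R g, g - ((m : ℂ) ^ 2) • R g) := by
      fun_prop
    refine map_mem_closure (f := fun g => (R g, g - ((m : ℂ) ^ 2) • R g)) hc (hdense f) ?_
    rintro _ ⟨w, hw, rfl⟩
    simp only
    rw [hgraph w hw, add_sub_cancel_right]
    exact hw
  · intro h
    have := hclosed.closure_subset_iff.2 (fun w hw => hgraph w hw) h
    simpa using this

namespace Hierarchy

lemma lintegral_enorm_sub_right_le {k : K → ℝ} (S : Set K) (x : K) :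
    ∫⁻ y in S, ‖k (x - y)‖ₑ ∂μ ≤ ∫⁻ y, ‖k y‖ₑ ∂μ := by
  refine (lintegral_mono' Measure.restrict_le_self le_rfl).trans_eq ?_
  exact lintegral_sub_left_eq_self (fun y => ‖k y‖ₑ) x

lemma lintegral_enorm_sub_left_le {k : K → ℝ} (S : Set K) (y : K) :
    ∫⁻ x in S, ‖k (x - y)‖ₑ ∂μ ≤ ∫⁻ y, ‖k y‖ₑ ∂μ := by
  refine (lintegral_mono' Measure.restrict_le_self le_rfl).trans_eq ?_
  exact lintegral_sub_right_eq_self (fun y => ‖k y‖ₑ) y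

/-- The Schur test for kernels dominated by a convolution kernel. -/
lemma exists_isIntegralOperator {S : Set K} {b : K → ℝ} (hb : Integrable b μ) {k : K → K → ℝ}
    (hk : Measurable (Function.uncurry k)) (hkb : ∀ x y, ‖k x y‖ ≤ ‖b (x - y)‖) :
    ∃ R : Lp ℂ 2 (μ.restrict S) →L[ℂ] Lp ℂ 2 (μ.restrict S), IsIntegralOperator μ S R k := by
  have hfin : ∫⁻ y, ‖b y‖ₑ ∂μ ≠ ⊤ := hb.2.ne
  have hle : ∀ x y, ‖k x y‖ₑ ≤ ‖b (x - y)‖ₑ := fun x y => enorm_le_iff_norm_le.2 (hkb x y)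
  refine exists_integral_operator hk (C := (∫⁻ y, ‖b y‖ₑ ∂μ).toNNReal) (fun x => ?_) (fun y => ?_)
  · rw [ENNReal.coe_toNNReal hfin]
    exact (lintegral_mono fun y => hle x y).trans (lintegral_enorm_sub_right_le S x)
  · rw [ENNReal.coe_toNNReal hfin]
    exact (lintegral_mono fun x => hle x y).trans (lintegral_enorm_sub_left_le S y)

/-- Points are null sets. This allows `E` in place of `green` even when the two are not known to
agree at `0`. -/
lemma _root_.PadicElliptic.IsIntegralOperator.congr_off_diagonal [NoncompactSpace K] {S : Set K}
    {R : Lp ℂ 2 (μ.restrict S) →L[ℂ] Lp ℂ 2 (μ.restrict S)} {k k' : K → K → ℝ}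
    (hR : IsIntegralOperator μ S R k) (h : ∀ x y, x ≠ y → k x y = k' x y) [NullSingletonClass μ] :
    IsIntegralOperator μ S R k' := by
  intro f
  filter_upwards [hR f] with x hx
  have e : (fun y => (k x y : ℂ) * f y) =ᵐ[μ.restrict S] fun y => (k' x y : ℂ) * f y := by
    have : ∀ᵐ y ∂μ.restrict S, y ≠ x := ae_restrict_of_ae (by
      rw [ae_iff]
      simp)
    filter_upwards [this] with y hy
    rw [h x y hy.symm]
  exact ⟨hx.1.congr e, hx.2.trans (integral_congr_ae e)⟩

variable [NoncompactSpace K]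

/-- The abstract form of the theorem, for the hierarchical Laplacian. -/
theorem exists_resolventKernel (hm : 0 < m)
    (hA : ∀ φ : K → ℂ, IsTestMap Set.univ φ → pseudoDiff χ μ a φ = H.lap μ φ)
    [NullSingletonClass μ] {E : K → ℝ} {P : Prop}
    (hP : P → Summable fun j => H.coef m j * H.wt μ j)
    (hE : ∀ x, (x ≠ 0 ∨ P) → E x = H.green μ m x) :
    IsResolventKernel χ μ a m Set.univ (fun x y => E (x - y)) ∧
    ∃ G : Set K → K → K → ℝ,
      (∀ S : Set K, IsCompact S → IsOpen S →
        IsResolventKernel χ μ a m S (G S) ∧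
        (∃ Φ : K → K → ℝ,
          IsLocallyConstant (fun z : S × S => Φ z.1 z.2) ∧
          ∀ x ∈ S, ∀ y ∈ S, G S x y = E (x - y) + Φ x y) ∧
        ∀ x ∈ S, ∀ y ∈ S, (x ≠ y ∨ P) → 0 ≤ G S x y ∧ G S x y ≤ E (x - y)) ∧
      ∀ S T : Set K, IsCompact S → IsOpen S → IsCompact T → IsOpen T → S ⊆ T →
        ∀ x ∈ S, ∀ y ∈ S, (x ≠ y ∨ P) → G S x y ≤ G T x y := by
  have hgm : Measurable fun p : K × K => H.green μ m (p.1 - p.2) :=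
    (measurable_green hm).comp (by fun_prop)
  have hE' : ∀ {x y : K}, (x ≠ y ∨ P) → E (x - y) = H.green μ m (x - y) := fun h =>
    hE _ (h.imp_left sub_ne_zero.2)
  constructor
  · obtain ⟨R, hR⟩ := exists_isIntegralOperator (μ := μ) (S := Set.univ)
      (k := fun x y => H.green μ m (x - y)) (integrable_green hm) hgm fun x y => le_rfl
    refine ⟨R, isResolvent_of_kernel hA isClosed_univ (J := 0) (by simp) hR (fun φ hφ x _ => ?_)
      fun φ hφ ε hε => ?_, hR.congr_off_diagonal fun x y h => (hE' (Or.inl h)).symm⟩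
    · rw [Measure.restrict_univ]
      exact integral_green_smul hm hφ x
    · obtain ⟨ψ, ρ, h1, h2, h3, h4⟩ := exists_lap_eq_near_univ (H := H) (μ := μ) hm hφ hε
      exact ⟨ψ, ρ, h1, h2, fun x _ => h3 x, by rwa [Measure.restrict_univ]⟩
  -- The kernel is needed as a function of every set; where `S` is not compact open, the scale is an
  -- irrelevant `0`.
  · have hex : ∀ S : Set K, ∃ J, IsCompact S → IsOpen S → ∀ x ∈ S, ∀ d ∈ H.D J, x + d ∈ S :=
      fun S => by
        by_cases h : IsCompact S ∧ IsOpen S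
        · obtain ⟨J, hJ⟩ := exists_inv_set (H := H) h.1 h.2
          exact ⟨J, fun _ _ => hJ⟩
        · exact ⟨0, fun h1 h2 => absurd ⟨h1, h2⟩ h⟩
    choose J hJ using hex
    refine ⟨fun S x y => E (x - y) + H.corr μ m S (J S) x y, fun S hS hSo => ⟨?_, ?_, ?_⟩, ?_⟩
    · have hJS := hJ S hS hSo
      obtain ⟨R, hR⟩ := exists_isIntegralOperator (μ := μ) (S := S)
        (k := fun x y => H.green μ m (x - y) + H.corr μ m S (J S) x y)
        -- Since `0 ≤ gam ≤ eker`, the kernel `green + gam - eker` is dominated by the convolution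
        -- kernel `green + eker`.
        ((integrable_green hm).add (integrable_eker hm (J S)))
        (hgm.add (isLocallyConstant_corr hS hJS hm).continuous.measurable) fun x y => by
          have h1 := green_nonneg (H := H) (μ := μ) hm (x - y)
          have h2 := eker_nonneg (H := H) (μ := μ) hm (J S) (x - y)
          have h3 := gam_nonneg (μ := μ) hS hJS hm x y
          have h4 := gam_le (μ := μ) hS hJS hm x y
          simp only [corr, Pi.add_apply, Real.norm_eq_abs]
          rw [abs_of_nonneg (add_nonneg h1 h2), abs_le]
          constructor <;> linarith
      refine ⟨R, isResolvent_of_kernel hA hS.isClosed hJS hR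
        (fun φ hφ x hx => integral_green_add_corr hS hJS hm hφ hx) fun φ hφ ε hε => ?_,
        hR.congr_off_diagonal fun x y h => by simp only [hE' (Or.inl h)]⟩
      obtain ⟨ψ, h1, h2⟩ := exists_lap_eq_complex (H := H) (μ := μ) hS hJS hm hφ
      exact ⟨ψ, φ, h1, hφ, h2, by simp⟩
    · refine ⟨H.corr μ m S (J S), ?_, fun x _ y _ => rfl⟩
      exact (isLocallyConstant_corr hS (hJ S hS hSo) hm).comp_continuous
        (f := fun z : S × S => ((z.1 : K), (z.2 : K))) (by fun_prop)
    · intro x hx y _ h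
      simp only
      rw [hE' h]
      exact ⟨green_add_corr_nonneg hS (hJ S hS hSo) hm hx (h.imp_right hP),
        green_add_corr_le hS (hJ S hS hSo) hm x y⟩
    · intro S T hS hSo hT hTo hST x hx y _ _
      exact add_le_add_right (corr_le_corr hS (hJ S hS hSo) hm hT (hJ T hT hTo) hST hx y) _

end Hierarchy
end PadicElliptic

/-! ### Anisotropic quadratic forms, their lattices and annihilators. -/

namespace PadicElliptic

variable {p : ℕ} [Fact p.Prime]

section QuadraticForm

/-- A zero of `1 - s + c s ^ 2` by Hensel's lemma. -/
lemma exists_root_one_sub_add {c : ℚ_[p]} (hc : ‖c‖ < 1) : ∃ s : ℚ_[p], 1 - s + c * s ^ 2 = 0 := by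
  set c' : ℤ_[p] := ⟨c, hc.le⟩ with hc'
  let F : Polynomial ℤ_[p] := 1 - Polynomial.X + Polynomial.C c' * Polynomial.X ^ 2
  have h1 : F.aeval (1 : ℤ_[p]) = c' := by simp [F]
  have h2 : F.derivative.aeval (1 : ℤ_[p]) = 2 * c' - 1 := by
    simp [F, Polynomial.derivative_pow]
    ring
  have hcn : ‖c'‖ < 1 := hc
  have h3 : ‖2 * c' - 1‖ = 1 := by
    have h4 : ‖2 * c'‖ < 1 := by
      rw [norm_mul]
      exact (mul_le_of_le_one_left (norm_nonneg _) (PadicInt.norm_le_one _)).trans_lt hcn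
    rw [norm_sub_rev, sub_eq_add_neg, IsUltrametricDist.norm_add_eq_max_of_norm_ne_norm]
    · rw [norm_neg, norm_one, max_eq_left h4.le]
    · rw [norm_neg, norm_one]
      exact h4.ne'
  -- At the starting point `1` the polynomial has the value `c`, of norm less than `1`, and its
  -- derivative `2c - 1` is a unit.
  obtain ⟨z, hz, -⟩ := hensels_lemma (F := F) (a := 1) (by rw [h1, h2, h3]; simpa using hcn)
  refine ⟨z, ?_⟩
  have := congrArg (fun t : ℤ_[p] => (t : ℚ_[p])) hz
  simpa [F] using this

variable {V : Type*} [AddCommGroup V] [Module ℚ_[p] V] {h : QuadraticForm ℚ_[p] V}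

/-- The Cauchy–Schwarz inequality for anisotropic forms. -/
lemma norm_polar_sq_le (hh : h.Anisotropic) (x y : V) :
    ‖QuadraticMap.polar h x y‖ ^ 2 ≤ ‖h x‖ * ‖h y‖ := by
  by_contra! hlt
  set B := QuadraticMap.polar h x y with hB
  have hB0 : B ≠ 0 := by
    intro h0
    rw [h0, norm_zero] at hlt
    have := mul_nonneg (norm_nonneg (h x)) (norm_nonneg (h y))
    norm_num at hlt
    linarith
  have hc : ‖h x * h y / B ^ 2‖ < 1 := by
    rw [norm_div, norm_mul, norm_pow, div_lt_one (pow_pos (norm_pos_iff.2 hB0) 2)]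
    exact hlt
  obtain ⟨s, hs⟩ := exists_root_one_sub_add hc
  -- This rescaling turns `h (x + t y)` into `h x (1 - s + c s²)` with `c = h x h y / B²`, where
  -- `‖c‖ < 1` by the assumed failure.
  set t := -(h x / B * s) with ht
  have h0 : h (x + t • y) = 0 := by
    have e : h (x + t • y) = h x + t * t * h y + t * B := by
      rw [QuadraticMap.map_add h, QuadraticMap.map_smul, QuadraticMap.polar_smul_right,
        smul_eq_mul, smul_eq_mul]
    have e2 : h x + t * t * h y + t * B = h x * (1 - s + h x * h y / B ^ 2 * s ^ 2) := by
      rw [ht]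
      field_simp
      ring
    rw [e, e2, hs, mul_zero]
  -- By anisotropy the vectors are proportional; then `B = -2 t h y` and `‖2‖ ≤ 1` contradict the
  -- assumption.
  have hx : x = (-t) • y := by
    rw [neg_smul]
    exact eq_neg_of_add_eq_zero_left (hh _ h0)
  have e1 : h x = t * t * h y := by
    rw [hx, QuadraticMap.map_smul, smul_eq_mul]
    ring
  have e2 : B = -t * (2 * h y) := by
    rw [hB, hx, QuadraticMap.polar_smul_left, QuadraticMap.polar_self]
    simp
  have h2 : ‖(2 : ℚ_[p])‖ ≤ 1 := by simpa using Padic.norm_int_le_one (p := p) 2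
  rw [e1, e2] at hlt
  simp only [norm_mul, norm_neg] at hlt
  have h3 : ‖(2 : ℚ_[p])‖ ^ 2 ≤ 1 := pow_le_one₀ (norm_nonneg _) h2
  nlinarith [mul_nonneg (sq_nonneg ‖t‖) (sq_nonneg ‖h y‖)]

/-- The absolute value of an anisotropic form satisfies the ultrametric inequality. -/
lemma norm_map_add_le_max (hh : h.Anisotropic) (x y : V) : ‖h (x + y)‖ ≤ max ‖h x‖ ‖h y‖ := by
  have hp : ‖QuadraticMap.polar h x y‖ ≤ max ‖h x‖ ‖h y‖ := by
    have h1 := norm_polar_sq_le hh x y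
    have h2 : ‖h x‖ * ‖h y‖ ≤ max ‖h x‖ ‖h y‖ ^ 2 := by
      rw [sq]
      exact mul_le_mul (le_max_left _ _) (le_max_right _ _) (norm_nonneg _)
        ((norm_nonneg _).trans (le_max_left _ _))
    exact le_of_sq_le_sq (h1.trans h2) ((norm_nonneg _).trans (le_max_left _ _))
  rw [QuadraticMap.map_add h]
  refine (IsUltrametricDist.norm_add_le_max _ _).trans (max_le ?_ hp)
  exact IsUltrametricDist.norm_add_le_max _ _

end QuadraticForm

section Norm

variable {V : Type*} [NormedAddCommGroup V] [NormedSpace ℚ_[p] V] [FiniteDimensional ℚ_[p] V]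
  {h : QuadraticForm ℚ_[p] V}

/-- `h x` is half the polar form at `(x, x)`, and linear maps on a finite-dimensional space are
continuous. -/
lemma continuous_quadraticForm (h : QuadraticForm ℚ_[p] V) : Continuous h := by
  let B : V →ₗ[ℚ_[p]] (V →L[ℚ_[p]] ℚ_[p]) :=
    (LinearMap.toContinuousLinearMap : (V →ₗ[ℚ_[p]] ℚ_[p]) ≃ₗ[ℚ_[p]] _).toLinearMap ∘ₗ h.polarBilin
  have hB : Continuous B := B.continuous_of_finiteDimensional
  have e : (h : V → ℚ_[p]) = fun x => 2⁻¹ * B x x := by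
    ext x
    have : B x x = 2 * h x := by simp [B]
    rw [this]
    field_simp
  rw [e]
  exact continuous_const.mul (hB.clm_apply continuous_id)

/-- On the compact shell `1 ≤ ‖x‖ ≤ p` the form has a positive minimum; every nonzero vector is
scaled into the shell, and `h` is homogeneous of degree two. -/
lemma exists_le_norm_quadraticForm [Nontrivial V] (hh : h.Anisotropic) :
    ∃ c, 0 < c ∧ ∀ x, c * ‖x‖ ^ 2 ≤ ‖h x‖ := by
  have := FiniteDimensional.proper ℚ_[p] V
  have hp1 : 1 < (p : ℝ) := by exact_mod_cast (Fact.out : p.Prime).one_lt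
  have hp0 : 0 < (p : ℝ) := by linarith
  have hpn : ‖(p : ℚ_[p])⁻¹‖ = p := by simp
  have hcomp : IsCompact {x : V | 1 ≤ ‖x‖ ∧ ‖x‖ ≤ p} := by
    refine (isCompact_closedBall (0 : V) p).of_isClosed_subset ?_ fun x hx => by
      simpa using hx.2
    exact (isClosed_le continuous_const continuous_norm).inter
      (isClosed_le continuous_norm continuous_const)
  have hshell : ∀ x : V, x ≠ 0 → ∃ t : ℚ_[p], t ≠ 0 ∧ 1 ≤ ‖t • x‖ ∧ ‖t • x‖ ≤ p := fun x hx => by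
    obtain ⟨d, hd0, hd1, hd2, -⟩ := rescale_to_shell (c := (p : ℚ_[p])⁻¹) (by rwa [hpn]) hp0 hx
    refine ⟨d, hd0, ?_, hd1.le⟩
    rwa [hpn, div_self hp0.ne'] at hd2
  obtain ⟨v, hv⟩ := exists_ne (0 : V)
  obtain ⟨t, ht0, ht⟩ := hshell v hv
  obtain ⟨x₀, hx₀, hmin⟩ := hcomp.exists_isMinOn ⟨t • v, ht⟩
    (continuous_quadraticForm h).norm.continuousOn
  have hpos : 0 < ‖h x₀‖ := norm_pos_iff.2 fun h0 => by
    have h1 := hx₀.1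
    rw [hh _ h0, norm_zero] at h1
    linarith
  refine ⟨‖h x₀‖ / p ^ 2, by positivity, fun x => ?_⟩
  by_cases hx : x = 0
  · simp [hx]
  obtain ⟨t, ht0, ht⟩ := hshell x hx
  have h1 : ‖h x₀‖ ≤ ‖h (t • x)‖ := hmin ht
  rw [QuadraticMap.map_smul, smul_eq_mul, norm_mul, norm_mul] at h1
  have h2 := ht.2
  rw [norm_smul] at h2
  have ht' : 0 < ‖t‖ := norm_pos_iff.2 ht0
  have h3 : (‖t‖ * ‖x‖) ^ 2 ≤ (p : ℝ) ^ 2 := pow_le_pow_left₀ (by positivity) h2 2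
  rw [div_mul_eq_mul_div, div_le_iff₀ (by positivity)]
  have h4 : ‖h x₀‖ * ‖x‖ ^ 2 * ‖t‖ ^ 2 ≤ ‖h x‖ * p ^ 2 * ‖t‖ ^ 2 := by
    calc ‖h x₀‖ * ‖x‖ ^ 2 * ‖t‖ ^ 2 = ‖h x₀‖ * (‖t‖ * ‖x‖) ^ 2 := by ring
      _ ≤ (‖t‖ * ‖t‖ * ‖h x‖) * p ^ 2 :=
        mul_le_mul h1 h3 (by positivity) (by positivity)
      _ = _ := by ring
  exact le_of_mul_le_mul_right h4 (by positivity)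

end Norm

section Lattice

variable {K : Type*} [NormedDivisionRing K] [NormedAlgebra ℚ_[p] K] [FiniteDimensional ℚ_[p] K]

-- A normed division ring in which all natural numbers have norm at most `1` is ultrametric, and
-- here these norms are computed in `ℚ_[p]`.
variable (p K) in
include p in
lemma isUltrametricDist_of_normedAlgebra : IsUltrametricDist K := by
  refine IsUltrametricDist.isUltrametricDist_of_forall_norm_natCast_le_one fun n => ?_
  have h1 : (n : K) = algebraMap ℚ_[p] K n := by simp
  rw [h1, norm_algebraMap']
  simpa using Padic.norm_int_le_one (p := p) n

lemma one_lt_cast_prime : 1 < (p : ℝ) := by exact_mod_cast (Fact.out : p.Prime).one_lt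

variable (p K) in
/-- The ball of radius `p ^ k`. -/
def ballSubgroup (k : ℤ) : AddSubgroup K where
  carrier := {x | ‖x‖ ≤ (p : ℝ) ^ k}
  add_mem' {x y} hx hy := by
    have := isUltrametricDist_of_normedAlgebra p K
    exact (IsUltrametricDist.norm_add_le_max x y).trans (max_le hx hy)
  zero_mem' := by
    simp only [Set.mem_ofPred_eq, norm_zero]
    positivity
  neg_mem' {x} hx := by simpa using hx

lemma mem_ballSubgroup {k : ℤ} {x : K} : x ∈ ballSubgroup p K k ↔ ‖x‖ ≤ (p : ℝ) ^ k := Iff.rfl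

lemma coe_ballSubgroup (k : ℤ) :
    (ballSubgroup p K k : Set K) = Metric.closedBall 0 ((p : ℝ) ^ k) := by
  ext x
  simp [mem_ballSubgroup]

lemma isOpen_ballSubgroup (k : ℤ) : IsOpen (ballSubgroup p K k : Set K) := by
  have := isUltrametricDist_of_normedAlgebra p K
  rw [coe_ballSubgroup]
  have := one_lt_cast_prime (p := p)
  exact IsUltrametricDist.isOpen_closedBall _ (by positivity)

lemma isCompact_ballSubgroup (k : ℤ) : IsCompact (ballSubgroup p K k : Set K) := by
  have := FiniteDimensional.proper ℚ_[p] K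
  rw [coe_ballSubgroup]
  exact isCompact_closedBall _ _

lemma exists_le_zpow (r : ℝ) : ∃ k : ℤ, r ≤ (p : ℝ) ^ k := by
  obtain ⟨n, hn⟩ := pow_unbounded_of_one_lt r (one_lt_cast_prime (p := p))
  exact ⟨n, by simpa using hn.le⟩

lemma exists_zpow_le {r : ℝ} (hr : 0 < r) : ∃ k : ℤ, (p : ℝ) ^ k ≤ r := by
  obtain ⟨k, hk⟩ := exists_le_zpow (p := p) r⁻¹
  refine ⟨-k, ?_⟩
  rw [zpow_neg]
  exact inv_le_of_inv_le₀ hr hk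

lemma tendsto_zpow_cast_atTop : Tendsto (fun j : ℤ => (p : ℝ) ^ j) atTop atTop :=
  tendsto_atTop_atTop_of_monotone (fun _ _ h => zpow_le_zpow_right₀ one_lt_cast_prime.le h)
    exists_le_zpow

lemma tendsto_zpow_cast_atBot : Tendsto (fun j : ℤ => (p : ℝ) ^ j) atBot (𝓝 0) := by
  have h := tendsto_inv_atTop_zero.comp
    ((tendsto_zpow_cast_atTop (p := p)).comp tendsto_neg_atBot_atTop)
  simpa [Function.comp_def] using h

lemma exists_ballSubgroup_subset {U : Set K} (hU : U ∈ 𝓝 0) :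
    ∃ k, (ballSubgroup p K k : Set K) ⊆ U := by
  obtain ⟨ε, hε, h⟩ := Metric.nhds_basis_closedBall.mem_iff.1 hU
  obtain ⟨k, hk⟩ := exists_zpow_le (p := p) hε
  exact ⟨k, by rw [coe_ballSubgroup]; exact (Metric.closedBall_subset_closedBall hk).trans h⟩

/-- The sublevel sets of an anisotropic quadratic form. -/
def lattice {h : QuadraticForm ℚ_[p] K} (hh : h.Anisotropic) (j : ℤ) : AddSubgroup K where
  carrier := {x | ‖h x‖ ≤ (p : ℝ) ^ j}
  add_mem' {x y} hx hy := (norm_map_add_le_max hh x y).trans (max_le hx hy)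
  zero_mem' := by
    simp only [Set.mem_ofPred_eq, QuadraticMap.map_zero, norm_zero]
    positivity
  neg_mem' {x} hx := by simpa using hx

variable {h : QuadraticForm ℚ_[p] K} (hh : h.Anisotropic)

lemma mem_lattice {j : ℤ} {x : K} : x ∈ lattice hh j ↔ ‖h x‖ ≤ (p : ℝ) ^ j := Iff.rfl

lemma coe_lattice (j : ℤ) :
    (lattice hh j : Set K) = h ⁻¹' Metric.closedBall 0 ((p : ℝ) ^ j) := by
  ext x
  simp [mem_lattice]

lemma lattice_mono {i j : ℤ} (hij : i ≤ j) : lattice hh i ≤ lattice hh j :=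
  fun _ hx => le_trans (α := ℝ) hx (zpow_le_zpow_right₀ one_lt_cast_prime.le hij)

lemma isOpen_lattice (j : ℤ) : IsOpen (lattice hh j : Set K) := by
  rw [coe_lattice]
  have := one_lt_cast_prime (p := p)
  exact (IsUltrametricDist.isOpen_closedBall _ (by positivity)).preimage (continuous_quadraticForm h)

/-- This and the next three lemmas make lattices and balls cofinal in each other, at `0` and at
infinity. Lattices lie in balls by the lower bound for `‖h‖`, balls lie in lattices by continuity
and compactness. -/
lemma exists_lattice_le (k : ℤ) : ∃ j, lattice hh j ≤ ballSubgroup p K k := by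
  obtain ⟨c, hc, hcx⟩ := exists_le_norm_quadraticForm hh
  have hp := one_lt_cast_prime (p := p)
  obtain ⟨j, hj⟩ := exists_zpow_le (p := p) (r := c * ((p : ℝ) ^ k) ^ 2) (by positivity)
  refine ⟨j, fun x hx => ?_⟩
  have h1 : ‖x‖ ^ 2 ≤ ((p : ℝ) ^ k) ^ 2 :=
    le_of_mul_le_mul_left ((hcx x).trans (le_trans (α := ℝ) hx hj)) hc
  exact le_of_sq_le_sq h1 (by positivity)

lemma exists_lattice_le_ball (j : ℤ) : ∃ k, lattice hh j ≤ ballSubgroup p K k := by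
  obtain ⟨c, hc, hcx⟩ := exists_le_norm_quadraticForm hh
  have hp := one_lt_cast_prime (p := p)
  obtain ⟨k, hk⟩ := exists_le_zpow (p := p) (1 + (p : ℝ) ^ j / c)
  refine ⟨k, fun x hx => ?_⟩
  have h0 : 0 ≤ (p : ℝ) ^ j / c := by positivity
  have h1 : ‖x‖ ^ 2 ≤ (p : ℝ) ^ j / c := by
    rw [le_div_iff₀ hc, mul_comm]
    exact (hcx x).trans hx
  have h2 : ‖x‖ ^ 2 ≤ (1 + (p : ℝ) ^ j / c) ^ 2 := by nlinarith
  exact (le_of_sq_le_sq h2 (by positivity)).trans hk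

lemma exists_ball_le_lattice (j : ℤ) : ∃ k, ballSubgroup p K k ≤ lattice hh j :=
  exists_ballSubgroup_subset ((isOpen_lattice hh j).mem_nhds (lattice hh j).zero_mem)

lemma exists_ball_le (k : ℤ) : ∃ j, ballSubgroup p K k ≤ lattice hh j := by
  obtain ⟨C, hC⟩ := (isCompact_ballSubgroup (p := p) (K := K) k).exists_bound_of_continuousOn
    (continuous_quadraticForm h).continuousOn
  obtain ⟨j, hj⟩ := exists_le_zpow (p := p) C
  exact ⟨j, fun x hx => (hC x hx).trans hj⟩

lemma isCompact_lattice (j : ℤ) : IsCompact (lattice hh j : Set K) := by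
  obtain ⟨k, hk⟩ := exists_lattice_le_ball hh j
  exact (isCompact_ballSubgroup k).of_isClosed_subset
    ((lattice hh j).isClosed_of_isOpen (isOpen_lattice hh j)) hk

/-- The annihilator of a subgroup with respect to the pairing `χ (ξ * x)`. -/
def annihilator (χ : AddChar K Circle) (L : AddSubgroup K) : AddSubgroup K where
  carrier := {x | ∀ ξ ∈ L, χ (ξ * x) = 1}
  add_mem' {x y} hx hy ξ hξ := by rw [mul_add, AddChar.map_add_eq_mul, hx ξ hξ, hy ξ hξ, one_mul]
  zero_mem' ξ _ := by simp
  neg_mem' {x} hx ξ hξ := by rw [mul_neg, AddChar.map_neg_eq_inv, hx ξ hξ, inv_one]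

variable {χ : AddChar K Circle}

lemma annihilator_anti {L M : AddSubgroup K} (hLM : L ≤ M) :
    annihilator χ M ≤ annihilator χ L := fun _ hx ξ hξ => hx ξ (hLM hξ)

lemma annihilator_ballSubgroup (hχ : IsRankZero χ) (k : ℤ) :
    annihilator χ (ballSubgroup p K k) = ballSubgroup p K (-k) := by
  have hp := one_lt_cast_prime (p := p)
  have hpk : 0 < (p : ℝ) ^ k := by positivity
  ext x
  rw [mem_ballSubgroup, zpow_neg]
  constructor
  · intro hx
    by_contra! hlt
    have hx0 : x ≠ 0 := by
      rintro rfl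
      rw [norm_zero] at hlt
      exact absurd hlt (not_lt.2 (by positivity))
    -- The element `p^(-k) x` has norm greater than `1`, so some `z` in the ball of that radius has
    -- `χ z ≠ 1`; then `z x⁻¹` is in the ball of radius `p^k` and violates the hypothesis on `x`.
    have hd : ‖((p : ℚ_[p]) ^ (-k)) • x‖ = (p : ℝ) ^ k * ‖x‖ := by
      rw [norm_smul, norm_zpow]
      simp
    obtain ⟨z, hz, hz'⟩ := hχ.2 (((p : ℚ_[p]) ^ (-k)) • x) (by
      rw [hd]
      rwa [inv_lt_iff_one_lt_mul₀' hpk] at hlt)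
    refine hz' ?_
    have := hx (z * x⁻¹) (by
      rw [mem_ballSubgroup, norm_mul, norm_inv]
      rw [hd] at hz
      rwa [mul_inv_le_iff₀ (norm_pos_iff.2 hx0)])
    rwa [inv_mul_cancel_right₀ hx0] at this
  · intro hx ξ hξ
    refine hχ.1 _ ?_
    rw [norm_mul]
    calc ‖ξ‖ * ‖x‖ ≤ (p : ℝ) ^ k * ((p : ℝ) ^ k)⁻¹ :=
          mul_le_mul hξ hx (norm_nonneg _) hpk.le
      _ = 1 := mul_inv_cancel₀ hpk.ne'

/-- The annihilator of the lattices, with the eigenvalues of the operator. -/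
noncomputable def hierarchy (hχ : IsRankZero χ) {α : ℝ} (hα : 0 < α) : Hierarchy K where
  D j := annihilator χ (lattice hh j)
  antitone_D _ _ hij := annihilator_anti (lattice_mono hh hij)
  isOpen_D j := by
    obtain ⟨k, hk⟩ := exists_lattice_le_ball hh j
    have h1 := annihilator_anti (χ := χ) hk
    rw [annihilator_ballSubgroup hχ] at h1
    exact AddSubgroup.isOpen_mono h1 (isOpen_ballSubgroup _)
  isCompact_D j := by
    obtain ⟨k, hk⟩ := exists_lattice_le_ball hh j
    obtain ⟨l, hl⟩ := exists_ball_le_lattice hh j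
    have h1 := annihilator_anti (χ := χ) hk
    have h2 := annihilator_anti (χ := χ) hl
    rw [annihilator_ballSubgroup hχ] at h1 h2
    exact (isCompact_ballSubgroup _).of_isClosed_subset
      (AddSubgroup.isClosed_of_isOpen _ (AddSubgroup.isOpen_mono h1 (isOpen_ballSubgroup _))) h2
  exists_mem x := by
    obtain ⟨k, hk⟩ := exists_le_zpow (p := p) ‖x‖
    obtain ⟨j, hj⟩ := exists_lattice_le hh (-k)
    have h1 := annihilator_anti (χ := χ) hj
    rw [annihilator_ballSubgroup hχ, neg_neg] at h1
    exact ⟨j, h1 hk⟩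
  exists_subset U hU := by
    obtain ⟨k, hk⟩ := exists_ballSubgroup_subset (p := p) hU
    obtain ⟨j, hj⟩ := exists_ball_le hh (-k)
    have h1 := annihilator_anti (χ := χ) hj
    rw [annihilator_ballSubgroup hχ, neg_neg] at h1
    exact ⟨j, fun x hx => hk (h1 hx)⟩
  lam j := ((p : ℝ) ^ j) ^ α
  lam_mono i j hij := Real.rpow_le_rpow (by positivity)
    (zpow_le_zpow_right₀ one_lt_cast_prime.le hij) hα.le
  lam_atBot := by
    have h1 : Tendsto (fun j : ℤ => (p : ℝ) ^ j) atBot (𝓝 0) :=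
      tendsto_zpow_cast_atBot
    have h2 := ((Real.continuousAt_rpow_const 0 α (Or.inr hα.le)).tendsto).comp h1
    rwa [Real.zero_rpow hα.ne'] at h2
  lam_atTop := by
    have h1 : Tendsto (fun j : ℤ => (p : ℝ) ^ j) atTop atTop :=
      tendsto_zpow_cast_atTop
    exact (tendsto_rpow_atTop hα).comp h1

end Lattice

end PadicElliptic

/-! ### Characters, duality of measures and layer decompositions. -/

namespace PadicElliptic

open scoped ENNReal NNReal Pointwise

variable {p : ℕ} [Fact p.Prime]

section Character

variable {K : Type*} [NormedDivisionRing K] {χ : AddChar K Circle}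

lemma IsRankZero.continuous (hχ : IsRankZero χ) : Continuous χ := by
  refine IsLocallyConstant.continuous ((IsLocallyConstant.iff_eventually_eq _).2 fun x => ?_)
  filter_upwards [Metric.closedBall_mem_nhds x one_pos] with y hy
  have : χ (y - x) = 1 := hχ.1 _ (by rwa [← dist_eq_norm])
  rw [← sub_add_cancel y x, AddChar.map_add_eq_mul, this, one_mul]

variable [MeasurableSpace K] [BorelSpace K] {μ : Measure K} [μ.IsAddHaarMeasure]

open Classical in
/-- Orthogonality of characters on a subgroup. -/
lemma setIntegral_addChar {L : AddSubgroup K} (hL : MeasurableSet (L : Set K))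
    (ψ : AddChar K Circle) :
    ∫ ξ in (L : Set K), (ψ ξ : ℂ) ∂μ = if ∀ ξ ∈ L, ψ ξ = 1 then ((μ.real L : ℝ) : ℂ) else 0 := by
  split_ifs with h
  · have : ∫ ξ in (L : Set K), (ψ ξ : ℂ) ∂μ = ∫ ξ in (L : Set K), (1 : ℂ) ∂μ :=
      setIntegral_congr_fun hL fun ξ hξ => by simp [h ξ hξ]
    rw [this, setIntegral_const]
    simp
  · push Not at h
    obtain ⟨ξ₀, hξ₀, hne⟩ := h
    -- Translation by `ξ₀` leaves the integral unchanged and also multiplies it by `ψ ξ₀ ≠ 1`.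
    have h1 := setIntegral_addSubgroup_add_right (μ := μ) hL (fun ξ => (ψ ξ : ℂ)) hξ₀
    simp only [AddChar.map_add_eq_mul, Circle.coe_mul] at h1
    rw [integral_mul_const] at h1
    have h2 : (ψ ξ₀ : ℂ) - 1 ≠ 0 := fun h => hne (Circle.ext (by simpa using sub_eq_zero.1 h))
    have h3 : (∫ ξ in (L : Set K), (ψ ξ : ℂ) ∂μ) * ((ψ ξ₀ : ℂ) - 1) = 0 := by
      rw [mul_sub, h1, mul_one, sub_self]
    exact (mul_eq_zero.1 h3).resolve_right h2

open Classical in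
lemma setIntegral_char_mul_right {L : AddSubgroup K} (hL : MeasurableSet (L : Set K)) (x : K) :
    ∫ ξ in (L : Set K), (χ (ξ * x) : ℂ) ∂μ =
      if x ∈ annihilator χ L then ((μ.real L : ℝ) : ℂ) else 0 := by
  have h := setIntegral_addChar (μ := μ) hL (χ.compAddMonoidHom (AddMonoidHom.mulRight x))
  refine h.trans ?_
  congr 1

open Classical in
lemma setIntegral_char_mul_left {L : AddSubgroup K} (hL : MeasurableSet (L : Set K)) (ξ : K) :
    ∫ x in (L : Set K), (χ (ξ * x) : ℂ) ∂μ =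
      if ∀ x ∈ L, χ (ξ * x) = 1 then ((μ.real L : ℝ) : ℂ) else 0 :=
  setIntegral_addChar (μ := μ) hL (χ.compAddMonoidHom (AddMonoidHom.mulLeft ξ))

end Character

variable {K : Type*} [NormedDivisionRing K] [NormedAlgebra ℚ_[p] K] [FiniteDimensional ℚ_[p] K]
  {χ : AddChar K Circle}

/-- The mirror image of `annihilator_ballSubgroup`: `K` need not be commutative, so the side on
which the ball acts matters. -/
lemma forall_mem_ball_char_eq_one_iff (hχ : IsRankZero χ) (k : ℤ) (ξ : K) :
    (∀ x ∈ ballSubgroup p K k, χ (ξ * x) = 1) ↔ ξ ∈ ballSubgroup p K (-k) := by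
  have hp := one_lt_cast_prime (p := p)
  have hpk : 0 < (p : ℝ) ^ k := by positivity
  constructor
  · intro hx
    rw [mem_ballSubgroup, zpow_neg]
    by_contra! hlt
    have hx0 : ξ ≠ 0 := by
      rintro rfl
      rw [norm_zero] at hlt
      exact absurd hlt (not_lt.2 (by positivity))
    have hd : ‖((p : ℚ_[p]) ^ (-k)) • ξ‖ = (p : ℝ) ^ k * ‖ξ‖ := by
      rw [norm_smul, norm_zpow]
      simp
    obtain ⟨z, hz, hz'⟩ := hχ.2 (((p : ℚ_[p]) ^ (-k)) • ξ) (by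
      rw [hd]
      rwa [inv_lt_iff_one_lt_mul₀' hpk] at hlt)
    refine hz' ?_
    have := hx (ξ⁻¹ * z) (by
      rw [mem_ballSubgroup, norm_mul, norm_inv]
      rw [hd] at hz
      rwa [inv_mul_le_iff₀ (norm_pos_iff.2 hx0), mul_comm])
    rwa [mul_inv_cancel_left₀ hx0] at this
  · intro hξ x hx
    have h1 : x ∈ annihilator χ (ballSubgroup p K (-k)) := by
      rwa [annihilator_ballSubgroup hχ, neg_neg]
    exact h1 ξ hξ

variable [MeasurableSpace K] [BorelSpace K] {μ : Measure K} [μ.IsAddHaarMeasure]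

/-- The balls are dilates of the unit ball by powers of `p`, and the modulus of a dilation is
multiplicative. -/
lemma measure_ball_mul_measure_ball (hμ : μ (Metric.closedBall (0 : K) 1) = 1) (k : ℤ) :
    μ.real (ballSubgroup p K k) * μ.real (ballSubgroup p K (-k)) = 1 := by
  have := FiniteDimensional.proper ℚ_[p] K
  have hp0 : (p : ℚ_[p]) ≠ 0 := by exact_mod_cast (Fact.out : p.Prime).ne_zero
  have hp := one_lt_cast_prime (p := p)
  let g : ℚ_[p]ˣ := Units.mk0 (p : ℚ_[p]) hp0
  have hg : ∀ l : ℤ, (g ^ (-l)) • (ballSubgroup p K 0 : Set K) = ballSubgroup p K l := fun l => by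
    have hv : ((g ^ (-l) : ℚ_[p]ˣ) : ℚ_[p]) = (p : ℚ_[p]) ^ (-l) := by
      rw [Units.val_zpow_eq_zpow_val]
      rfl
    have hv' : (((g ^ (-l))⁻¹ : ℚ_[p]ˣ) : ℚ_[p]) = (p : ℚ_[p]) ^ l := by
      rw [← zpow_neg, neg_neg, Units.val_zpow_eq_zpow_val]
      rfl
    ext x
    rw [Set.mem_smul_set_iff_inv_smul_mem, Units.smul_def, hv', SetLike.mem_coe, SetLike.mem_coe,
      mem_ballSubgroup, mem_ballSubgroup, norm_smul, norm_zpow, zpow_zero]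
    have hpl : 0 < (p : ℝ) ^ l := by positivity
    rw [Padic.norm_p, inv_zpow, inv_mul_le_iff₀ hpl, mul_one]
  have h0 : μ.real (ballSubgroup p K 0) = 1 := by
    rw [coe_ballSubgroup, zpow_zero, Measure.real, hμ, ENNReal.toReal_one]
  have hs : ∀ l : ℤ, μ.real (ballSubgroup p K l) = distribHaarChar K (g ^ (-l)) := fun l => by
    rw [← hg, Measure.real, ← distribHaarChar_mul μ, ENNReal.toReal_mul, ← Measure.real, h0,
      mul_one, ENNReal.coe_toReal]
  rw [hs, hs, ← NNReal.coe_mul, ← map_mul, neg_neg, zpow_neg, inv_mul_cancel, map_one,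
    NNReal.coe_one]

variable {h : QuadraticForm ℚ_[p] K} (hh : h.Anisotropic) (hχ : IsRankZero χ) {α : ℝ} (hα : 0 < α)

/-- With a ball `B ⊆ L` and its dual ball `B' ⊇ D`, where `D` is the annihilator of `L`, integrate
`χ (ξ x)` over `L × B'` in both orders. Orthogonality gives `μ(L) μ(D)` one way and `μ(B) μ(B') = 1`
the other. -/
lemma measure_lattice_mul_measure_annihilator (hχ : IsRankZero χ)
    (hμ : μ (Metric.closedBall (0 : K) 1) = 1) (j : ℤ) :
    μ.real (lattice hh j) * μ.real (annihilator χ (lattice hh j)) = 1 := by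
  classical
  have := FiniteDimensional.proper ℚ_[p] K
  obtain ⟨k, hk⟩ := exists_ball_le_lattice hh j
  have hD := annihilator_anti (χ := χ) hk
  rw [annihilator_ballSubgroup hχ] at hD
  have mB : ∀ l, MeasurableSet (ballSubgroup p K l : Set K) := fun l =>
    (isOpen_ballSubgroup l).measurableSet
  have mL := (isOpen_lattice hh j).measurableSet
  have f1 : IsFiniteMeasure (μ.restrict (lattice hh j : Set K)) :=
    ⟨by simpa using (isCompact_lattice hh j).measure_lt_top⟩
  have f2 : IsFiniteMeasure (μ.restrict (ballSubgroup p K (-k) : Set K)) :=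
    ⟨by simpa using (isCompact_ballSubgroup (-k)).measure_lt_top⟩
  have hint : Integrable (Function.uncurry fun x ξ : K => (χ (ξ * x) : ℂ))
      ((μ.restrict (ballSubgroup p K (-k) : Set K)).prod (μ.restrict (lattice hh j : Set K))) := by
    refine (integrable_const (1 : ℝ)).mono' ?_ (Eventually.of_forall fun q => (Circle.norm_coe _).le)
    have : Continuous (Function.uncurry fun x ξ : K => (χ (ξ * x) : ℂ)) :=
      (continuous_subtype_val (p := fun z : ℂ => z ∈ Submonoid.unitSphere ℂ)).comp
        (hχ.continuous.comp (by fun_prop))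
    exact this.aestronglyMeasurable
  have hswap := integral_integral_swap hint
  have hDm : MeasurableSet (annihilator χ (lattice hh j) : Set K) :=
    ((hierarchy hh hχ one_pos).isOpen_D j).measurableSet
  have e1 : ∫ x in (ballSubgroup p K (-k) : Set K), ∫ ξ in (lattice hh j : Set K),
      (χ (ξ * x) : ℂ) ∂μ ∂μ =
      ((μ.real (lattice hh j) * μ.real (annihilator χ (lattice hh j)) : ℝ) : ℂ) := by
    simp only [setIntegral_char_mul_right mL]
    have : (fun x => if x ∈ annihilator χ (lattice hh j) then ((μ.real (lattice hh j) : ℝ) : ℂ)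
        else 0) = (annihilator χ (lattice hh j) : Set K).indicator
          fun _ => ((μ.real (lattice hh j) : ℝ) : ℂ) := by
      ext x
      simp [Set.indicator_apply]
    rw [this, setIntegral_indicator hDm, Set.inter_eq_right.2 hD, setIntegral_const]
    simp [mul_comm]
  have e2 : ∫ ξ in (lattice hh j : Set K), ∫ x in (ballSubgroup p K (-k) : Set K),
      (χ (ξ * x) : ℂ) ∂μ ∂μ = 1 := by
    simp only [setIntegral_char_mul_left (mB _), forall_mem_ball_char_eq_one_iff hχ, neg_neg]
    have : (fun ξ => if ξ ∈ ballSubgroup p K k then ((μ.real (ballSubgroup p K (-k)) : ℝ) : ℂ)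
        else 0) = (ballSubgroup p K k : Set K).indicator
          fun _ => ((μ.real (ballSubgroup p K (-k)) : ℝ) : ℂ) := by
      ext x
      simp [Set.indicator_apply]
    rw [this, setIntegral_indicator (mB k), Set.inter_eq_right.2 hk, setIntegral_const]
    have := measure_ball_mul_measure_ball (p := p) hμ k
    rw [Complex.real_smul, ← Complex.ofReal_mul, this, Complex.ofReal_one]
  rw [e1, e2] at hswap
  exact_mod_cast hswap

lemma wt_hierarchy (hμ : μ (Metric.closedBall (0 : K) 1) = 1) (j : ℤ) :
    (hierarchy hh hχ hα).wt μ j = μ.real (lattice hh j) :=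
  (eq_inv_of_mul_eq_one_left (measure_lattice_mul_measure_annihilator hh hχ hμ j)).symm

/-! ### The symbol as a sum over the lattices -/

include hh in
lemma exists_norm_eq_zpow {x : K} (hx : x ≠ 0) : ∃ i : ℤ, ‖h x‖ = (p : ℝ) ^ i :=
  ⟨_, Padic.norm_eq_zpow_neg_valuation fun h0 => hx (hh x h0)⟩

include hα in
lemma continuous_symbol (h : QuadraticForm ℚ_[p] K) : Continuous (symbol h α) :=
  (continuous_quadraticForm h).norm.rpow_const fun _ => Or.inr hα.le

lemma symbol_nonneg (h : QuadraticForm ℚ_[p] K) (α : ℝ) (ξ : K) : 0 ≤ symbol h α ξ :=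
  Real.rpow_nonneg (norm_nonneg _) _

lemma mem_lattice_iff_of_norm_eq {x : K} {i : ℤ} (hi : ‖h x‖ = (p : ℝ) ^ i) (j : ℤ) :
    x ∈ lattice hh j ↔ i ≤ j := by
  rw [mem_lattice, hi, zpow_le_zpow_iff_right₀ one_lt_cast_prime]

-- If `‖h ξ‖ = p^i`, then `ξ` lies outside exactly the lattices with `j < i`, and these increments
-- telescope to `lam i`.
open Classical in
lemma hasSum_symbol (ξ : K) :
    HasSum (fun j => if ξ ∈ lattice hh j then 0 else
      (hierarchy hh hχ hα).lam (j + 1) - (hierarchy hh hχ hα).lam j) (symbol h α ξ) := by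
  have := FiniteDimensional.proper ℚ_[p] K
  by_cases h0 : ξ = 0
  · have : symbol h α ξ = 0 := by simp [symbol, h0, Real.zero_rpow hα.ne']
    rw [this, h0]
    simp only [(lattice hh _).zero_mem, if_true]
    exact hasSum_zero
  · obtain ⟨i, hi⟩ := exists_norm_eq_zpow hh h0
    have h1 := Hierarchy.hasSum_lam (H := hierarchy hh hχ hα) i
    have h2 : symbol h α ξ = (hierarchy hh hχ hα).lam i := by
      rw [symbol, hi]
      rfl
    rw [h2]
    refine h1.congr_fun ?_
    intro j
    simp only [mem_lattice_iff_of_norm_eq hh hi]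
    by_cases hij : i ≤ j
    · rw [if_pos hij, if_neg (not_lt.2 hij)]
    · rw [if_neg hij, if_pos (not_le.1 hij)]

open Classical in
lemma hasSum_resolvent_symbol {m : ℝ} (hm : 0 < m) (ξ : K) :
    HasSum (fun j => if ξ ∈ lattice hh j then (hierarchy hh hχ hα).coef m j else 0)
      (symbol h α ξ + m ^ 2)⁻¹ := by
  have := FiniteDimensional.proper ℚ_[p] K
  by_cases h0 : ξ = 0
  · have : symbol h α ξ = 0 := by simp [symbol, h0, Real.zero_rpow hα.ne']
    rw [this, h0, zero_add]
    simp only [(lattice hh _).zero_mem, if_true]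
    exact Hierarchy.hasSum_coef hm
  · obtain ⟨i, hi⟩ := exists_norm_eq_zpow hh h0
    have h2 : symbol h α ξ = (hierarchy hh hχ hα).lam i := by
      rw [symbol, hi]
      rfl
    rw [h2]
    simp only [mem_lattice_iff_of_norm_eq hh hi]
    exact Hierarchy.hasSum_coef_ge hm i

/-! ### The Fourier transform of test functions -/

-- Support in a ball makes the transform invariant under the dual ball; invariance under a ball
-- confines the transform to the dual ball.
include hh in
lemma isTestMap_fourierK (hχ : IsRankZero χ) {φ : K → ℂ} (hφ : IsTestMap Set.univ φ) :
    IsTestMap Set.univ (fourierK χ μ φ) := by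
  have := FiniteDimensional.proper ℚ_[p] K
  obtain ⟨k, hk⟩ : ∃ k, ∀ x, x ∉ ballSubgroup p K k → φ x = 0 := by
    obtain ⟨r, hr⟩ := hφ.2.1.isCompact.isBounded.subset_closedBall 0
    obtain ⟨k, hk⟩ := exists_le_zpow (p := p) r
    refine ⟨k, fun x hx => ?_⟩
    by_contra hne
    have := hr (subset_tsupport _ hne)
    rw [mem_closedBall_zero_iff] at this
    exact hx (this.trans hk)
  refine ⟨(IsLocallyConstant.iff_eventually_eq _).2 fun ξ => ?_, ?_, Set.subset_univ _⟩
  · have h1 : {η | η - ξ ∈ ballSubgroup p K (-k)} ∈ 𝓝 ξ := by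
      have : Continuous fun η : K => η - ξ := by fun_prop
      exact ((isOpen_ballSubgroup (-k)).preimage this).mem_nhds
        (by simp [(ballSubgroup p K (-k)).zero_mem])
    filter_upwards [h1] with η hη
    simp only [fourierK]
    congr 1; ext x
    by_cases hx : x ∈ ballSubgroup p K k
    · have h2 := (forall_mem_ball_char_eq_one_iff hχ k (η - ξ)).2 hη x hx
      rw [← sub_add_cancel η ξ, add_mul, AddChar.map_add_eq_mul, h2, one_mul]
    · rw [hk x hx, mul_zero, mul_zero]
  · obtain ⟨J, hJ⟩ := Hierarchy.exists_inv (H := hierarchy hh hχ one_pos) hφ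
    obtain ⟨l, hl⟩ := exists_ballSubgroup_subset (p := p)
      (((hierarchy hh hχ one_pos).isOpen_D J).mem_nhds (AddSubgroup.zero_mem _))
    refine HasCompactSupport.intro (isCompact_ballSubgroup (p := p) (-l)) fun ξ hξ => ?_
    by_contra hne
    refine hξ ((forall_mem_ball_char_eq_one_iff hχ l ξ).1 fun d hd => ?_)
    have h1 : fourierK χ μ φ ξ = (χ (ξ * d) : ℂ) * fourierK χ μ φ ξ := by
      simp only [fourierK]
      rw [← integral_const_mul, ← integral_add_right_eq_self _ d]
      congr 1; ext x
      have h2 : φ (x + d) = φ x := hJ x d (hl hd)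
      rw [h2, mul_add, AddChar.map_add_eq_mul, Circle.coe_mul]
      ring
    have h3 : (χ (ξ * d) : ℂ) = 1 := by
      have := mul_right_cancel₀ hne (h1.symm.trans (one_mul _).symm)
      exact this
    exact Circle.ext (by simpa using h3)

end PadicElliptic

/-! ### The pseudo-differential operator as a hierarchical Laplacian. -/

namespace PadicElliptic

open scoped ENNReal NNReal Pointwise

variable {p : ℕ} [Fact p.Prime]
  {K : Type*} [NormedDivisionRing K] [NormedAlgebra ℚ_[p] K] [FiniteDimensional ℚ_[p] K]
  {χ : AddChar K Circle}
  [MeasurableSpace K] [BorelSpace K] {μ : Measure K} [μ.IsAddHaarMeasure]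
  {h : QuadraticForm ℚ_[p] K} (hh : h.Anisotropic) (hχ : IsRankZero χ) {α : ℝ} (hα : 0 < α)

lemma continuous_circle_coe : Continuous fun z : Circle => (z : ℂ) :=
  continuous_subtype_val (p := fun z : ℂ => z ∈ Submonoid.unitSphere ℂ)

/-- After Fubini the inner integral of the character over the lattice is `μ(lattice)` times the
indicator of the annihilator; by duality of measures this is the normalized bump. -/
lemma setIntegral_char_fourierK (hμ : μ (Metric.closedBall (0 : K) 1) = 1) {φ : K → ℂ}
    (hφ : IsTestMap Set.univ φ) (j : ℤ) (x : K) :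
    ∫ ξ in (lattice hh j : Set K), (χ (-(ξ * x)) : ℂ) * fourierK χ μ φ ξ ∂μ =
      (hierarchy hh hχ hα).avg μ j φ x := by
  classical
  have := FiniteDimensional.proper ℚ_[p] K
  have f1 : IsFiniteMeasure (μ.restrict (lattice hh j : Set K)) :=
    ⟨by simpa using (isCompact_lattice hh j).measure_lt_top⟩
  have mL := (isOpen_lattice hh j).measurableSet
  have hφi : Integrable φ μ := Hierarchy.integrable_test hφ
  have hcont : Continuous (Function.uncurry fun ξ y : K => (χ (ξ * (y - x)) : ℂ) * φ y) := by
    refine Continuous.mul ?_ (hφ.1.continuous.comp continuous_snd)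
    exact continuous_circle_coe.comp (hχ.continuous.comp (by fun_prop))
  have hint : Integrable (Function.uncurry fun ξ y : K => (χ (ξ * (y - x)) : ℂ) * φ y)
      ((μ.restrict (lattice hh j : Set K)).prod μ) := by
    refine ((integrable_const (1 : ℝ)).mul_prod hφi.norm).mono' hcont.aestronglyMeasurable
      (Eventually.of_forall fun q => ?_)
    simp only [Function.uncurry]
    rw [norm_mul, Circle.norm_coe]
  have e1 : ∀ ξ, (χ (-(ξ * x)) : ℂ) * fourierK χ μ φ ξ =
      ∫ y, (χ (ξ * (y - x)) : ℂ) * φ y ∂μ := fun ξ => by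
    rw [fourierK, ← integral_const_mul]
    congr 1; ext y
    rw [← mul_assoc, ← Circle.coe_mul, ← AddChar.map_add_eq_mul, mul_sub, neg_add_eq_sub]
  simp only [e1]
  rw [integral_integral_swap hint, ← Hierarchy.integral_bump_smul]
  congr 1; ext y
  rw [integral_mul_const, setIntegral_char_mul_right mL, Complex.real_smul]
  congr 1
  have hD : (hierarchy hh hχ hα).D j = annihilator χ (lattice hh j) := rfl
  split_ifs with hy
  · rw [Hierarchy.bump_of_mem, wt_hierarchy hh hχ hα hμ]
    rw [hD, ← neg_sub]
    exact neg_mem hy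
  · rw [Hierarchy.bump_of_notMem, Complex.ofReal_zero]
    rw [hD, ← neg_sub]
    exact fun hy' => hy (by simpa using neg_mem hy')

include hh hχ in
lemma integrable_char_mul_fourierK {g : K → ℂ} (hg : Continuous g) {φ : K → ℂ}
    (hφ : IsTestMap Set.univ φ) (x : K) :
    Integrable (fun ξ => (χ (-(ξ * x)) : ℂ) * (g ξ * fourierK χ μ φ ξ)) μ := by
  have h1 := isTestMap_fourierK (μ := μ) hh hχ hφ
  refine Continuous.integrable_of_hasCompactSupport ?_ (h1.2.1.mul_left.mul_left)
  refine Continuous.mul ?_ (hg.mul h1.1.continuous)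
  exact continuous_circle_coe.comp (hχ.continuous.comp (by fun_prop))

include hh in
/-- Fourier inversion for test functions. -/
lemma integral_char_fourierK (hχ : IsRankZero χ) (hμ : μ (Metric.closedBall (0 : K) 1) = 1)
    {φ : K → ℂ} (hφ : IsTestMap Set.univ φ) (x : K) :
    ∫ ξ, (χ (-(ξ * x)) : ℂ) * fourierK χ μ φ ξ ∂μ = φ x := by
  have := FiniteDimensional.proper ℚ_[p] K
  have h1 := isTestMap_fourierK (μ := μ) hh hχ hφ
  obtain ⟨J, hJ⟩ := Hierarchy.exists_inv (H := hierarchy hh hχ one_pos) hφ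
  obtain ⟨j, hj⟩ : ∃ j, ∀ ξ, ξ ∉ lattice hh j → fourierK χ μ φ ξ = 0 := by
    obtain ⟨r, hr⟩ := h1.2.1.isCompact.isBounded.subset_closedBall 0
    obtain ⟨k, hk⟩ := exists_le_zpow (p := p) r
    obtain ⟨j, hj⟩ := exists_ball_le hh k
    refine ⟨j, fun ξ hξ => ?_⟩
    by_contra hne
    have := hr (subset_tsupport _ hne)
    rw [mem_closedBall_zero_iff] at this
    exact hξ (hj (this.trans hk))
  -- At this scale averaging does nothing to `φ` and cutting off does nothing to its transform.
  have hJ' : (hierarchy hh hχ one_pos).Inv (max J j) φ := Hierarchy.Inv.mono (le_max_left J j) hJ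
  rw [← Hierarchy.avg_of_inv (μ := μ) hJ' x, ← setIntegral_char_fourierK hh hχ one_pos hμ hφ,
    setIntegral_eq_integral_of_forall_compl_eq_zero]
  intro ξ hξ
  rw [hj ξ fun h => hξ (lattice_mono hh (le_max_right J j) h), mul_zero]

/-- The pseudo-differential operator is the hierarchical Laplacian. -/
lemma pseudoDiff_symbol (hμ : μ (Metric.closedBall (0 : K) 1) = 1) {φ : K → ℂ}
    (hφ : IsTestMap Set.univ φ) :
    pseudoDiff χ μ (symbol h α) φ = (hierarchy hh hχ hα).lap μ φ := by
  classical
  have := FiniteDimensional.proper ℚ_[p] K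
  ext x
  set H := hierarchy hh hχ hα with hH
  have hF := isTestMap_fourierK (μ := μ) hh hχ hφ
  have hint1 : Integrable (fun ξ => (χ (-(ξ * x)) : ℂ) * fourierK χ μ φ ξ) μ := by
    simpa using integrable_char_mul_fourierK (μ := μ) hh hχ (g := fun _ => 1) continuous_const hφ x
  -- The absolute values of the terms add up to `a ‖F φ‖`, integrable because `F φ` is a test
  -- function.
  have key := hasSum_integral_of_dominated_convergence (μ := μ)
    (F := fun (j : ℤ) ξ => (χ (-(ξ * x)) : ℂ) *
      (((if ξ ∈ lattice hh j then 0 else H.lam (j + 1) - H.lam j : ℝ) : ℂ) * fourierK χ μ φ ξ))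
    (f := fun ξ => (χ (-(ξ * x)) : ℂ) * ((symbol h α ξ : ℂ) * fourierK χ μ φ ξ))
    (bound := fun j ξ => (if ξ ∈ lattice hh j then 0 else H.lam (j + 1) - H.lam j) *
      ‖fourierK χ μ φ ξ‖) ?_ ?_ ?_ ?_ ?_
  · rw [pseudoDiff, fourierInvK, ← key.tsum_eq, Hierarchy.lap]
    refine tsum_congr fun j => ?_
    rw [← setIntegral_char_fourierK hh hχ hα hμ hφ, ← integral_char_fourierK hh hχ hμ hφ x,
      ← integral_indicator (isOpen_lattice hh j).measurableSet, ← integral_sub hint1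
        (hint1.indicator (isOpen_lattice hh j).measurableSet), ← integral_smul]
    congr 1; ext ξ
    simp only [Set.indicator_apply, SetLike.mem_coe, Complex.real_smul]
    split_ifs
    · simp
    · simp; ring
  · intro j
    refine Measurable.aestronglyMeasurable ?_
    refine Measurable.mul ?_ (Measurable.mul ?_ hF.1.continuous.measurable)
    · exact (continuous_circle_coe.comp (hχ.continuous.comp (by fun_prop))).measurable
    · exact Complex.measurable_ofReal.comp
        (Measurable.ite (isOpen_lattice hh j).measurableSet measurable_const measurable_const)
  · intro j
    refine Eventually.of_forall fun ξ => ?_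
    have h0 : 0 ≤ (if ξ ∈ lattice hh j then 0 else H.lam (j + 1) - H.lam j) := by
      split_ifs
      · exact le_rfl
      · exact Hierarchy.dlam_nonneg j
    rw [norm_mul, norm_mul, Circle.norm_coe, one_mul, Complex.norm_real, Real.norm_of_nonneg h0]
  · exact Eventually.of_forall fun ξ => (hasSum_symbol hh hχ hα ξ).summable.mul_right _
  · have h2 := integrable_char_mul_fourierK (μ := μ) hh hχ (g := fun ξ => (symbol h α ξ : ℂ))
      (Complex.continuous_ofReal.comp (continuous_symbol hα h)) hφ x
    refine h2.norm.congr (Eventually.of_forall fun ξ => ?_)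
    dsimp only
    rw [((hasSum_symbol hh hχ hα ξ).mul_right _).tsum_eq, norm_mul, norm_mul, Circle.norm_coe,
      one_mul, Complex.norm_real, Real.norm_of_nonneg (symbol_nonneg h α ξ)]
  · refine Eventually.of_forall fun ξ => ?_
    have h3 := Complex.hasSum_ofReal.2 (hasSum_symbol hh hχ hα ξ)
    exact (h3.mul_right _).mul_left _

end PadicElliptic

/-! ### The Green function of the symbol. -/

namespace PadicElliptic

open scoped ENNReal NNReal Pointwise

variable {p : ℕ} [Fact p.Prime]
  {K : Type*} [NormedDivisionRing K] [NormedAlgebra ℚ_[p] K] [FiniteDimensional ℚ_[p] K]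
  {χ : AddChar K Circle}
  [MeasurableSpace K] [BorelSpace K] {μ : Measure K} [μ.IsAddHaarMeasure]
  {h : QuadraticForm ℚ_[p] K} (hh : h.Anisotropic) (hχ : IsRankZero χ) {α : ℝ} (hα : 0 < α)
  {m : ℝ}

variable (p K) in
include p in
lemma exists_addSubgroup_eq_closedBall {r : ℝ} (hr : 0 ≤ r) :
    ∃ L : AddSubgroup K, (L : Set K) = Metric.closedBall 0 r := by
  have := isUltrametricDist_of_normedAlgebra p K
  refine ⟨⟨⟨⟨Metric.closedBall 0 r, ?_⟩, by simpa using hr⟩, ?_⟩, rfl⟩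
  · intro a b ha hb
    rw [mem_closedBall_zero_iff] at *
    exact (IsUltrametricDist.norm_add_le_max a b).trans (max_le ha hb)
  · intro a ha
    simpa using ha

-- Layer decomposition of `1 / (a + m ^ 2)`, integrated term by term: a character integrated over
-- the subgroup `L ⊓ lattice j` gives its measure or `0`.
open Classical in
lemma hasSum_setIntegral_char_resolvent (hm : 0 < m) {L : AddSubgroup K}
    (hL : MeasurableSet (L : Set K)) (hLc : IsCompact (L : Set K)) (x : K) :
    HasSum (fun j => (hierarchy hh hχ hα).coef m j *
      if x ∈ annihilator χ (L ⊓ lattice hh j) then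
        μ.real ((L : Set K) ∩ lattice hh j) else 0)
      (∫ ξ in (L : Set K), (χ (-(ξ * x)) : ℂ) * (((symbol h α ξ + m ^ 2)⁻¹ : ℝ) : ℂ) ∂μ).re := by
  have := FiniteDimensional.proper ℚ_[p] K
  set H := hierarchy hh hχ hα with hH
  have hco : Continuous fun ξ : K => (χ (-(ξ * x)) : ℂ) :=
    continuous_circle_coe.comp (hχ.continuous.comp (by fun_prop))
  have h0 : ∀ (j : ℤ) (ξ : K), 0 ≤ if ξ ∈ lattice hh j then H.coef m j else 0 := fun j ξ => by
    split_ifs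
    · exact Hierarchy.coef_nonneg hm j
    · exact le_rfl
  have key := hasSum_integral_of_dominated_convergence (μ := μ.restrict (L : Set K))
    (F := fun (j : ℤ) ξ => (χ (-(ξ * x)) : ℂ) *
      ((if ξ ∈ lattice hh j then H.coef m j else 0 : ℝ) : ℂ))
    (f := fun ξ => (χ (-(ξ * x)) : ℂ) * (((symbol h α ξ + m ^ 2)⁻¹ : ℝ) : ℂ))
    (bound := fun j ξ => if ξ ∈ lattice hh j then H.coef m j else 0) ?_ ?_ ?_ ?_ ?_
  · refine (key.mapL Complex.reCLM).congr_fun ?_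
    intro j
    have mj := (isOpen_lattice hh j).measurableSet
    have e1 : ∀ ξ : K, (χ (-(ξ * x)) : ℂ) *
        ((if ξ ∈ lattice hh j then H.coef m j else 0 : ℝ) : ℂ) =
        (lattice hh j : Set K).indicator
          (fun ξ => (H.coef m j : ℂ) * (χ (ξ * (-x)) : ℂ)) ξ := fun ξ => by
      by_cases hξ : ξ ∈ lattice hh j
      · rw [if_pos hξ, Set.indicator_of_mem (by exact hξ), mul_neg, mul_comm]
      · rw [if_neg hξ, Set.indicator_of_notMem (by exact hξ), Complex.ofReal_zero, mul_zero]
    simp only [e1]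
    rw [setIntegral_indicator mj, integral_const_mul, ← AddSubgroup.coe_inf,
      setIntegral_char_mul_right (hL.inter mj)]
    by_cases hxa : x ∈ annihilator χ (L ⊓ lattice hh j)
    · rw [if_pos hxa, if_pos (neg_mem hxa), ← Complex.ofReal_mul]
      rfl
    · rw [if_neg hxa, if_neg fun h' => hxa (by simpa using neg_mem h'), mul_zero, mul_zero, map_zero]
  · intro j
    refine Measurable.aestronglyMeasurable (hco.measurable.mul ?_)
    exact Complex.measurable_ofReal.comp
        (Measurable.ite (isOpen_lattice hh j).measurableSet measurable_const measurable_const)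
  · intro j
    refine Eventually.of_forall fun ξ => ?_
    rw [norm_mul, Circle.norm_coe, one_mul, Complex.norm_real, Real.norm_of_nonneg (h0 j ξ)]
  · exact Eventually.of_forall fun ξ => (hasSum_resolvent_symbol hh hχ hα hm ξ).summable
  · have e2 := fun ξ => (hasSum_resolvent_symbol hh hχ hα hm ξ).tsum_eq
    simp only [hH, e2]
    refine ContinuousOn.integrableOn_compact hLc (Continuous.continuousOn ?_)
    refine ((continuous_symbol hα h).add continuous_const).inv₀ fun ξ => ?_
    exact (add_pos_of_nonneg_of_pos (symbol_nonneg h α ξ) (pow_pos hm 2)).ne'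
  · exact Eventually.of_forall fun ξ =>
      (Complex.hasSum_ofReal.2 (hasSum_resolvent_symbol hh hχ hα hm ξ)).mul_left _

/-- The Green function of the symbol is the Green function of the hierarchical Laplacian. -/
lemma greenFunction_eq (hμ : μ (Metric.closedBall (0 : K) 1) = 1) (hm : 0 < m) {x : K}
    (hx : x ≠ 0 ∨ Summable fun j =>
      (hierarchy hh hχ hα).coef m j * (hierarchy hh hχ hα).wt μ j) :
    greenFunction χ μ (symbol h α) m x = (hierarchy hh hχ hα).green μ m x := by
  classical
  have := FiniteDimensional.proper ℚ_[p] K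
  refine Tendsto.limUnder_eq ?_
  have hLex : ∀ k : ℕ, ∃ L : AddSubgroup K, (L : Set K) = Metric.closedBall 0 k := fun k =>
    exists_addSubgroup_eq_closedBall p K k.cast_nonneg
  choose L hL using hLex
  have hLm : ∀ k, MeasurableSet (L k : Set K) := fun k => by
    rw [hL]; exact Metric.isClosed_closedBall.measurableSet
  have hLc : ∀ k, IsCompact (L k : Set K) := fun k => by
    rw [hL]; exact isCompact_closedBall _ _
  set H := hierarchy hh hχ hα with hH
  simp only [← hL]
  have e := fun k =>
    (hasSum_setIntegral_char_resolvent (μ := μ) hh hχ hα hm (hLm k) (hLc k) x).tsum_eq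
  simp only [← e]
  have hfin : ∀ j, μ (lattice hh j : Set K) ≠ ∞ := fun j =>
    (isCompact_lattice hh j).measure_lt_top.ne
  have hterm : ∀ (k : ℕ) (j : ℤ), 0 ≤ H.coef m j * (if x ∈ annihilator χ (L k ⊓ lattice hh j) then
      μ.real ((L k : Set K) ∩ lattice hh j) else 0) := fun k j =>
    mul_nonneg (Hierarchy.coef_nonneg hm j) (by
      split_ifs
      exacts [measureReal_nonneg, le_rfl])
  have hle : ∀ (k : ℕ) (j : ℤ), (if x ∈ annihilator χ (L k ⊓ lattice hh j) then
      μ.real ((L k : Set K) ∩ lattice hh j) else 0) ≤ H.wt μ j := fun k j => by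
    rw [wt_hierarchy hh hχ hα hμ]
    split_ifs
    · exact measureReal_mono Set.inter_subset_right (hfin j)
    · exact measureReal_nonneg
  -- Each term is eventually constant in `k`, as soon as the ball contains the lattice `j`.
  have hlim : ∀ j : ℤ, Tendsto (fun k : ℕ => H.coef m j *
      (if x ∈ annihilator χ (L k ⊓ lattice hh j) then
      μ.real ((L k : Set K) ∩ lattice hh j) else 0)) atTop (𝓝 (H.coef m j * H.bump μ j x)) := by
    intro j
    obtain ⟨k₀, hk₀⟩ := exists_lattice_le_ball hh j
    obtain ⟨k₁, hk₁⟩ := exists_nat_ge ((p : ℝ) ^ k₀)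
    refine tendsto_const_nhds.congr' ?_
    filter_upwards [eventually_ge_atTop k₁] with k hk
    have h1 : lattice hh j ≤ L k := fun ξ hξ => by
      have h2 : ‖ξ‖ ≤ (p : ℝ) ^ k₀ := hk₀ hξ
      have h3 : (k₁ : ℝ) ≤ k := by exact_mod_cast hk
      have : ξ ∈ (L k : Set K) := by
        rw [hL, mem_closedBall_zero_iff]
        linarith
      exact this
    rw [inf_eq_right.2 h1, Set.inter_eq_right.2 h1, ← wt_hierarchy hh hχ hα hμ]
    rfl
  rw [Hierarchy.green]
  rcases hx with hx | hs
  · have hJ : ∃ J, x ∉ H.D J := by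
      obtain ⟨J, hJ⟩ := H.exists_subset {x}ᶜ (isOpen_compl_singleton.mem_nhds hx.symm)
      exact ⟨J, fun h => hJ h rfl⟩
    obtain ⟨J, hJ⟩ := hJ
    -- Once the ball contains `ξ₀`, all terms with `j ≥ J` vanish. The others are dominated using
    -- `wt j ≤ wt J`, so for `x ≠ 0` no summability of `coef * wt` is needed.
    obtain ⟨ξ₀, hξ₀, hne⟩ : ∃ ξ₀ ∈ lattice hh J, χ (ξ₀ * x) ≠ 1 := by
      by_contra! hcon
      exact hJ hcon
    refine tendsto_tsum_of_dominated_convergence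
      (bound := fun j => (if j < J then H.coef m j else 0) * H.wt μ J)
      ((Hierarchy.hasSum_coef_lt hm J).summable.mul_right _) hlim ?_
    obtain ⟨k₁, hk₁⟩ := exists_nat_ge ‖ξ₀‖
    filter_upwards [eventually_ge_atTop k₁] with k hk j
    rw [Real.norm_of_nonneg (hterm k j)]
    by_cases hj : j < J
    · rw [if_pos hj]
      exact mul_le_mul_of_nonneg_left ((hle k j).trans (Hierarchy.wt_mono hj.le))
        (Hierarchy.coef_nonneg hm j)
    · rw [if_neg hj, zero_mul, if_neg, mul_zero]
      intro hxa
      refine hne (hxa ξ₀ ⟨?_, lattice_mono hh (not_lt.1 hj) hξ₀⟩)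
      have h3 : (k₁ : ℝ) ≤ k := by exact_mod_cast hk
      have : ξ₀ ∈ (L k : Set K) := by
        rw [hL, mem_closedBall_zero_iff]
        linarith
      exact this
  · refine tendsto_tsum_of_dominated_convergence hs hlim (Eventually.of_forall fun k j => ?_)
    rw [Real.norm_of_nonneg (hterm k j)]
    exact mul_le_mul_of_nonneg_left (hle k j) (Hierarchy.coef_nonneg hm j)

end PadicElliptic

/-! ### Volume growth of the lattices and finiteness of the Green function at the origin. -/

namespace PadicElliptic

open scoped ENNReal NNReal Pointwise

variable {p : ℕ} [Fact p.Prime]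

section Dilation

variable (p) in
/-- The dilation by `p⁻¹`. -/
noncomputable def dilation : ℚ_[p]ˣ :=
  Units.mk0 (p : ℚ_[p])⁻¹ (inv_ne_zero (by exact_mod_cast (Fact.out : p.Prime).ne_zero))

variable {K : Type*} [NormedAddCommGroup K] [NormedSpace ℚ_[p] K] [FiniteDimensional ℚ_[p] K]
  [MeasurableSpace K] [BorelSpace K]

lemma mem_dilation_smul {s : Set K} {x : K} : x ∈ dilation p • s ↔ (p : ℚ_[p]) • x ∈ s := by
  rw [Set.mem_smul_set_iff_inv_smul_mem, Units.smul_def, dilation]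
  simp

variable (p K) in
/-- The dilation by `p⁻¹` multiplies volumes by at most `p ^ n`. -/
lemma distribHaarChar_dilation_le [LocallyCompactSpace K] :
    distribHaarChar K (dilation p) ≤ (p : ℝ≥0) ^ Module.finrank ℚ_[p] K := by
  have hp0 : (p : ℚ_[p]) ≠ 0 := by exact_mod_cast (Fact.out : p.Prime).ne_zero
  let b := Module.finBasis ℚ_[p] K
  let μ : Measure K := Measure.addHaar
  let e := b.equivFun
  have he : Continuous e := LinearMap.continuous_of_finiteDimensional e.toLinearMap
  have he' : Continuous e.symm := LinearMap.continuous_of_finiteDimensional e.symm.toLinearMap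
  let M : Set K := e ⁻¹' Metric.closedBall 0 1
  have hMo : IsOpen M := (IsUltrametricDist.isOpen_closedBall _ one_ne_zero).preimage he
  have hMc : IsCompact M := by
    have : M = e.symm '' Metric.closedBall 0 1 := (e.toEquiv.image_symm_eq_preimage _).symm
    rw [this]
    exact (isCompact_closedBall _ _).image he'
  have hM0 : μ M ≠ 0 := (hMo.measure_pos μ ⟨0, by simp [M]⟩).ne'
  -- In coordinates, `p y` is integral; subtracting its last digit divided by `p` from `y` gives an
  -- integral vector. There are `p` digits in each of the `n` coordinates.
  have hcov : dilation p • M ⊆ ⋃ a : Fin (Module.finrank ℚ_[p] K) → Fin p,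
      (e.symm fun i => (p : ℚ_[p])⁻¹ * ((a i : ℕ) : ℚ_[p])) +ᵥ M := by
    intro y hy
    rw [mem_dilation_smul] at hy
    have hy' : ‖e ((p : ℚ_[p]) • y)‖ ≤ 1 := by simpa [M] using hy
    have hy1 : ∀ i, ‖(p : ℚ_[p]) * e y i‖ ≤ 1 := fun i => by
      have := (norm_le_pi_norm _ i).trans hy'
      simpa using this
    let z : Fin (Module.finrank ℚ_[p] K) → ℤ_[p] := fun i => ⟨(p : ℚ_[p]) * e y i, hy1 i⟩
    refine Set.mem_iUnion.2 ⟨fun i => ⟨(z i).zmodRepr, PadicInt.zmodRepr_lt_p _⟩, ?_⟩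
    rw [Set.mem_vadd_set_iff_neg_vadd_mem, vadd_eq_add, Set.mem_preimage, map_add, map_neg,
      LinearEquiv.apply_symm_apply, mem_closedBall_zero_iff, pi_norm_le_iff_of_nonneg zero_le_one]
    intro i
    obtain ⟨w, hw⟩ := (PadicInt.norm_lt_one_iff_dvd _).1 (PadicInt.norm_sub_zmodRepr_lt_one (z i))
    have h1 : (p : ℚ_[p]) * e y i - ((z i).zmodRepr : ℚ_[p]) = p * (w : ℚ_[p]) := by
      have := congrArg (fun t : ℤ_[p] => (t : ℚ_[p])) hw
      simp only [PadicInt.coe_sub, PadicInt.coe_mul, PadicInt.coe_natCast] at this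
      exact this
    have h2 : -((p : ℚ_[p])⁻¹ * ((z i).zmodRepr : ℚ_[p])) + e y i = w := by
      rw [sub_eq_iff_eq_add] at h1
      apply mul_left_cancel₀ hp0
      rw [mul_add, h1]
      field_simp
      ring
    change ‖-((p : ℚ_[p])⁻¹ * ((z i).zmodRepr : ℚ_[p])) + e y i‖ ≤ 1
    rw [h2]
    exact w.2
  have h1 : μ (dilation p • M) ≤ (p : ℝ≥0∞) ^ Module.finrank ℚ_[p] K * μ M := by
    refine (measure_mono hcov).trans ((measure_iUnion_fintype_le _ _).trans ?_)
    simp [measure_vadd]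
  rw [← distribHaarChar_mul μ] at h1
  have h2 := (ENNReal.mul_le_mul_iff_left hM0 hMc.measure_ne_top).1 h1
  exact_mod_cast h2

end Dilation

variable {K : Type*} [NormedDivisionRing K] [NormedAlgebra ℚ_[p] K] [FiniteDimensional ℚ_[p] K]
  {χ : AddChar K Circle}
  [MeasurableSpace K] [BorelSpace K] {μ : Measure K} [μ.IsAddHaarMeasure]
  {h : QuadraticForm ℚ_[p] K} (hh : h.Anisotropic) (hχ : IsRankZero χ) {α : ℝ} (hα : 0 < α)
  {m : ℝ}

/-- Multiplication by `p⁻¹` multiplies `‖h‖` by `p²`, hence moves the lattice index by two. -/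
lemma measure_lattice_add_two_le (j : ℤ) :
    μ.real (lattice hh (j + 2)) ≤
      (p : ℝ) ^ Module.finrank ℚ_[p] K * μ.real (lattice hh j) := by
  have := FiniteDimensional.proper ℚ_[p] K
  have hp := one_lt_cast_prime (p := p)
  have hp0 : 0 < (p : ℝ) := by linarith
  have e : (lattice hh (j + 2) : Set K) = dilation p • (lattice hh j : Set K) := by
    ext x
    rw [mem_dilation_smul, SetLike.mem_coe, SetLike.mem_coe, mem_lattice, mem_lattice,
      QuadraticMap.map_smul, smul_eq_mul, norm_mul, norm_mul, Padic.norm_p,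
      zpow_add₀ hp0.ne', ← mul_inv, inv_mul_le_iff₀ (by positivity), mul_comm ((p : ℝ) ^ j)]
    norm_cast
    rw [sq]
  rw [e, Measure.real, ← distribHaarChar_mul μ, ENNReal.toReal_mul, ← Measure.real,
    ENNReal.coe_toReal]
  refine mul_le_mul_of_nonneg_right ?_ measureReal_nonneg
  exact_mod_cast distribHaarChar_dilation_le p K

/-- For `j → ∞` the weight grows at most like `p^(nj/2)` while `coef ≤ p^(-αj)`; for `j ≤ 0` the
weight is bounded and `coef` is summable. -/
lemma summable_coef_mul_wt (hμ : μ (Metric.closedBall (0 : K) 1) = 1) (hm : 0 < m)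
    (hn : (Module.finrank ℚ_[p] K : ℝ) / 2 < α) :
    Summable fun j => (hierarchy hh hχ hα).coef m j * (hierarchy hh hχ hα).wt μ j := by
  have := FiniteDimensional.proper ℚ_[p] K
  set H := hierarchy hh hχ hα with hH
  set n := Module.finrank ℚ_[p] K with hn'
  have hp := one_lt_cast_prime (p := p)
  have hp0 : 0 < (p : ℝ) := by linarith
  have hnn : ∀ j, 0 ≤ H.coef m j * H.wt μ j := fun j =>
    mul_nonneg (Hierarchy.coef_nonneg hm j) (Hierarchy.wt_pos j).le
  refine Summable.of_nat_of_neg ?_ ?_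
  · set s : ℝ := (p : ℝ) ^ ((n : ℝ) / 2) with hs
    have hs0 : 0 < s := by positivity
    have hs2 : s ^ 2 = (p : ℝ) ^ n := by
      rw [hs, ← Real.rpow_natCast, ← Real.rpow_mul hp0.le, ← Real.rpow_natCast]
      congr 1
      push_cast
      ring
    have hs1 : 1 ≤ s := Real.one_le_rpow hp.le (by positivity)
    -- Two index steps cost `p^n = s²`; `wt 1` dominates both starting values of the two-step
    -- induction.
    have hw : ∀ j : ℕ, H.wt μ j ≤ H.wt μ 1 * s ^ j := fun j => by
      induction j using Nat.twoStepInduction with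
      | zero => simpa using Hierarchy.wt_mono (H := H) (μ := μ) zero_le_one
      | one =>
        have := (Hierarchy.wt_pos (H := H) (μ := μ) 1).le
        simpa using le_mul_of_one_le_right this hs1
      | more j ih _ =>
        have h1 := measure_lattice_add_two_le (μ := μ) hh (j : ℤ)
        rw [← wt_hierarchy hh hχ hα hμ, ← wt_hierarchy hh hχ hα hμ, ← hs2] at h1
        have h2 : ((j + 2 : ℕ) : ℤ) = (j : ℤ) + 2 := by push_cast; ring
        rw [h2]
        calc H.wt μ (j + 2) ≤ s ^ 2 * H.wt μ j := h1
          _ ≤ s ^ 2 * (H.wt μ 1 * s ^ j) := by gcongr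
          _ = _ := by ring
    have hc : ∀ j : ℕ, H.coef m j ≤ (((p : ℝ) ^ α)⁻¹) ^ j := fun j => by
      have h1 : H.coef m j ≤ H.res m j := sub_le_self _ (Hierarchy.res_pos hm _).le
      refine h1.trans ?_
      have h2 : H.lam j = ((p : ℝ) ^ α) ^ j := by
        change ((p : ℝ) ^ (j : ℤ)) ^ α = _
        rw [zpow_natCast, Real.rpow_pow_comm hp0.le]
      rw [Hierarchy.res, h2, inv_pow]
      exact inv_anti₀ (by positivity) (by nlinarith [sq_nonneg m])
    have hr : ((p : ℝ) ^ α)⁻¹ * s < 1 := by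
      rw [inv_mul_lt_iff₀ (by positivity), mul_one]
      exact Real.rpow_lt_rpow_of_exponent_lt hp hn
    refine Summable.of_nonneg_of_le (fun j => hnn j) (fun j => ?_)
      ((summable_geometric_of_lt_one (by positivity) hr).mul_left (H.wt μ 1))
    calc H.coef m j * H.wt μ j ≤ (((p : ℝ) ^ α)⁻¹) ^ j * (H.wt μ 1 * s ^ j) :=
          mul_le_mul (hc j) (hw j) (Hierarchy.wt_pos _).le (by positivity)
      _ = _ := by rw [mul_pow]; ring
  · have h1 : Summable fun j : ℕ => H.coef m (-(j : ℤ)) :=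
      (Hierarchy.hasSum_coef hm).summable.comp_injective fun a b hab => by simpa using hab
    refine Summable.of_nonneg_of_le (fun j => hnn _) (fun j => ?_) (h1.mul_right (H.wt μ 0))
    exact mul_le_mul_of_nonneg_left (Hierarchy.wt_mono (by omega)) (Hierarchy.coef_nonneg hm _)

end PadicElliptic

theorem proposition2p1 (p : ℕ) [Fact p.Prime] (hp : p ≠ 2)
    {K : Type*} [NormedDivisionRing K] [NormedAlgebra ℚ_[p] K] [FiniteDimensional ℚ_[p] K]
    [MeasurableSpace K] [BorelSpace K]
    (μ : Measure K) [μ.IsAddHaarMeasure] (hμ : μ (Metric.closedBall (0 : K) 1) = 1)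
    (χ : AddChar K Circle) (hχ : PadicElliptic.IsRankZero χ)
    (h : QuadraticForm ℚ_[p] K) (hh : h.Anisotropic)
    (α m : ℝ) (hα : (Module.finrank ℚ_[p] K : ℝ) / 2 ≤ α) (hm : 0 < m)
    (a : K → ℝ) (ha : a = PadicElliptic.symbol h α)
    (E : K → ℝ) (hE : E = PadicElliptic.greenFunction χ μ a m) :
    -- `E` is the convolution kernel of the resolvent on the whole of `K`
    PadicElliptic.IsResolventKernel χ μ a m Set.univ (fun x y => E (x - y)) ∧
    ∃ G : Set K → K → K → ℝ,
      (∀ S : Set K, IsCompact S → IsOpen S →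
        PadicElliptic.IsResolventKernel χ μ a m S (G S) ∧
        (∃ Φ : K → K → ℝ,
          IsLocallyConstant (fun z : S × S => Φ z.1 z.2) ∧
          ∀ x ∈ S, ∀ y ∈ S, G S x y = E (x - y) + Φ x y) ∧
        -- on the diagonal `E (x - y)` is infinite if `α = n / 2`
        ∀ x ∈ S, ∀ y ∈ S, (x ≠ y ∨ (Module.finrank ℚ_[p] K : ℝ) / 2 < α) →
          0 ≤ G S x y ∧ G S x y ≤ E (x - y)) ∧
      ∀ S T : Set K, IsCompact S → IsOpen S → IsCompact T → IsOpen T → S ⊆ T →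
        ∀ x ∈ S, ∀ y ∈ S, (x ≠ y ∨ (Module.finrank ℚ_[p] K : ℝ) / 2 < α) →
          G S x y ≤ G T x y := by 
  have hproper : ProperSpace K := FiniteDimensional.proper ℚ_[p] K
  have hnc : NoncompactSpace K := NormedSpace.noncompactSpace ℚ_[p] K
  have hn : (0 : ℝ) < Module.finrank ℚ_[p] K := by exact_mod_cast Module.finrank_pos
  have hα0 : 0 < α := by linarith
  -- Nondiscreteness makes points null for the Haar measure, so the diagonal does not affect the
  -- integral operators.
  have hne : (𝓝[≠] (0 : K)).NeBot :=
    Module.punctured_nhds_neBot ℚ_[p] K 0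
  subst ha hE
  exact PadicElliptic.Hierarchy.exists_resolventKernel
    (H := PadicElliptic.hierarchy hh hχ hα0) hm
    (fun φ hφ => PadicElliptic.pseudoDiff_symbol hh hχ hα0 hμ hφ)
    (fun hP => PadicElliptic.summable_coef_mul_wt hh hχ hα0 hμ hm hP)
    fun x hx => PadicElliptic.greenFunction_eq hh hχ hα0 hμ hm
      (hx.imp_right fun hP => PadicElliptic.summable_coef_mul_wt hh hχ hα0 hμ hm hP)
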